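/- Let $k$ be a field of characteristic $p>0$, let $E$ be an elementary abelian $p$-group of rank $r$ with generators $g_1,\dots,g_r$, and put $X_i=g_i-1\in kE$. Let $\mathcal O$ be the structure sheaf of $\mathbb P^{r-1}=\operatorname{Proj} k[Y_1,\dots,Y_r]$. For a finitely generated $kE$-module $M$ let $\theta_M\colon M\otimes_k\mathcal O(t)\to M\otimes_k\mathcal O(t+1)$ be $m\otimes f\mapsto\sum_i X_im\otimes Y_if$, and let $\mathcal F_1(M)=\operatorname{Ker}\theta_M/(\operatorname{Ker}\theta_M\cap\operatorname{Im}\theta_M)$, a functorial subquotient of $M\otimes_k\mathcal O$; we write $\mathcal F_1(M)(t)$ for its twists, the corresponding subquotients of $M\otimes_k\mathcal O(t)$. Let $\Omega^a k$ ($a\in\mathbb Z$) be Heller shifts of the trivial module, given by short exact sequences $0\to\Omega^{a+1}k\to Q_a\to\Omega^a k\to 0$ of finitely generated $kE$-modules with $Q_a$ projective and $\Omega^0k\cong k$. A homomorphism $\hat\zeta\colon\Omega^{b+N}k\to\Omega^bk$ with $N\ge 0$ *represents* a class $\zeta\in H^N(E,k)$ if it is a Heller shift (positive or negative) of a homomorphism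 $\Omega^Nk\to\Omega^0k=k$ whose associated cocycle on the resolution $Q_*$ of $k$ has class $\zeta$. Let $y_1,\dots,y_r\in H^1(E,k)=\operatorname{Hom}(E,k)$ be given by $y_i(g_j)=\delta_{ij}$, and let $x_i\in H^2(E,k)$ be the Bockstein of $y_i$. The switchback (connecting) map of $0\to\Omega^{a+1}k\to Q_a\to\Omega^ak\to0$ sends a local section $\mu$ of $\operatorname{Ker}\theta$ to the class of $\theta u$, where $u$ is a local lift of $\mu$. **(a) $p$ odd.** There are isomorphisms $\varphi_l\colon\mathcal O(t-pl)\cong\mathcal F_1(\Omega^{2l}k)(t)$, for all $l,t\in\mathbb Z$, such that $\varphi_0$ is the canonical identification $\mathcal O(t)=\mathcal F_1(k)(t)$ and $\varphi_{l+1}$ is obtained from $\varphi_l$ by composition with the map $\mathcal F_1(\Omega^{2l}k)(t)\to\mathcal F_1(\Omega^{2l+2}k)(t+p)$ given by the switchback map for $a=2l$, followed by $\theta^{p-2}$, followed by the switchback map for $a=2l+1$. For these, let $\zeta$ be a homogeneous polynomial of degree $n\ge 0$ in $k[x_1,\dots,x_r]$, regarded as an element of $H^{2n}(E,k)$, let $\rho\colon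 k[x_1,\dots,x_r]\to k[Y_1,\dots,Y_r]$ be the $k$-algebra homomorphism with $\rho(x_i)=Y_i^p$, and let $j\in\mathbb Z$. Then $\zeta$ is represented by some homomorphism $\Omega^{2(n+j)}k\to\Omega^{2j}k$, and for every $\hat\zeta\colon\Omega^{2(n+j)}k\to\Omega^{2j}k$ that represents $\zeta$ the diagram $$\begin{array}{ccc}\mathcal O(-p(n+j))&\xrightarrow{\ \rho(\zeta)\ }&\mathcal O(-pj)\\ {\scriptstyle\varphi_{n+j}}\downarrow\cong&&{\scriptstyle\varphi_j}\downarrow\cong\\ \mathcal F_1(\Omega^{2(n+j)}k)&\xrightarrow{\ \mathcal F_1(\hat\zeta)\ }&\mathcal F_1(\Omega^{2j}k)\end{array}$$ commutes. **(b) $p=2$.** There are isomorphisms $\varphi_a\colon\mathcal O(t-a)\cong\mathcal F_1(\Omega^{a}k)(t)$, for all $a,t\in\mathbb Z$, such that $\varphi_0$ is the canonical identification $\mathcal O(t)=\mathcal F_1(k)(t)$ and $\varphi_{a+1}$ is obtained from $\varphi_a$ by composition with the switchback map $\mathcal F_1(\Omega^{a}k)(t)\to\mathcal F_1(\Omega^{a+1}k)(t+1)$.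 For these, let $\zeta$ be a homogeneous polynomial of degree $n\ge0$ in $k[y_1,\dots,y_r]=H^*(E,k)$, let $\rho\colon k[y_1,\dots,y_r]\to k[Y_1,\dots,Y_r]$ be the $k$-algebra homomorphism with $\rho(y_i)=Y_i$, and let $j\in\mathbb Z$. Then $\zeta\in H^n(E,k)$ is represented by some homomorphism $\Omega^{n+j}k\to\Omega^jk$, and for every $\hat\zeta\colon\Omega^{n+j}k\to\Omega^jk$ that represents $\zeta$ the diagram $$\begin{array}{ccc}\mathcal O(-n-j)&\xrightarrow{\ \rho(\zeta)\ }&\mathcal O(-j)\\ {\scriptstyle\varphi_{n+j}}\downarrow\cong&&{\scriptstyle\varphi_j}\downarrow\cong\\ \mathcal F_1(\Omega^{n+j}k)&\xrightarrow{\ \mathcal F_1(\hat\zeta)\ }&\mathcal F_1(\Omega^{j}k)\end{array}$$ commutes. -/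

import Mathlib

open CategoryTheory CategoryTheory.Limits AlgebraicGeometry TopologicalSpace Opposite
open scoped TensorProduct

universe u

noncomputable section

namespace GradedTilde

variable {A σ : Type u} [CommRing A] [SetLike σ A] [AddSubgroupClass σ A]
  (𝒜 : ℕ → σ) [GradedRing 𝒜]

/-- The multiplicative set `A ∖ x` for a point `x` of `Proj 𝒜`. -/
abbrev compl (x : ProjectiveSpectrum 𝒜) : Submonoid A :=
  Ideal.primeCompl (HomogeneousIdeal.toIdeal (ProjectiveSpectrum.asHomogeneousIdeal x))

/-- The value at a point `x ∈ U` of a section of the structure sheaf over `U`, as an element of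
the localization `A_x`. -/
def value {U : Opens (ProjectiveSpectrum.top 𝒜)}
    (c : (ProjectiveSpectrum.Proj.structureSheaf 𝒜).1.obj (op U)) (x : U) :
    Localization (compl 𝒜 x.1) :=
  HomogeneousLocalization.val (c.1 x)

section value

variable {U : Opens (ProjectiveSpectrum.top 𝒜)}
  (c d : (ProjectiveSpectrum.Proj.structureSheaf 𝒜).1.obj (op U)) (x : U)

theorem value_zero :
    value 𝒜 (0 : (ProjectiveSpectrum.Proj.structureSheaf 𝒜).1.obj (op U)) x = 0 :=
  HomogeneousLocalization.val_zero

theorem value_one :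
    value 𝒜 (1 : (ProjectiveSpectrum.Proj.structureSheaf 𝒜).1.obj (op U)) x = 1 :=
  HomogeneousLocalization.val_one

theorem value_add : value 𝒜 (c + d) x = value 𝒜 c x + value 𝒜 d x :=
  HomogeneousLocalization.val_add _ _

theorem value_mul : value 𝒜 (c * d) x = value 𝒜 c x * value 𝒜 d x :=
  HomogeneousLocalization.val_mul _ _

end value

variable {τ N : Type u} [AddCommGroup N] [Module A N] [SetLike τ N] [AddSubgroupClass τ N]
  (𝓝 : ℕ → τ) [SetLike.GradedSMul 𝒜 𝓝]

/-- `f` is given on all of `U` by one fraction `n / s` with `n` and `s` homogeneous and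
`deg n = deg s + t`. -/
def IsFraction (t : ℤ) {U : Opens (ProjectiveSpectrum.top 𝒜)}
    (f : ∀ x : U, LocalizedModule (compl 𝒜 x.1) N) : Prop :=
  ∃ (i j : ℕ) (n : N) (s : A), n ∈ 𝓝 j ∧ s ∈ 𝒜 i ∧ (j : ℤ) = i + t ∧
    ∀ x : U, ∃ hs : s ∈ compl 𝒜 x.1, f x = LocalizedModule.mk n ⟨s, hs⟩

/-- The prelocal predicate of being a fraction of degree `t`. -/
def isFractionPrelocal (t : ℤ) :
    TopCat.PrelocalPredicate fun x : ProjectiveSpectrum.top 𝒜 => LocalizedModule (compl 𝒜 x) N where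
  pred f := IsFraction 𝒜 𝓝 t f
  res := by
    rintro V U i f ⟨a, b, n, s, hn, hs, hab, h⟩
    exact ⟨a, b, n, s, hn, hs, hab, fun x => h (i x)⟩

/-- The local predicate of being locally a fraction of degree `t`. -/
def isLocallyFraction (t : ℤ) :
    TopCat.LocalPredicate fun x : ProjectiveSpectrum.top 𝒜 => LocalizedModule (compl 𝒜 x) N :=
  (isFractionPrelocal 𝒜 𝓝 t).sheafify

theorem zero_pred (t : ℤ) (U : Opens (ProjectiveSpectrum.top 𝒜)) :
    (isLocallyFraction 𝒜 𝓝 t).pred (0 : ∀ x : U, LocalizedModule (compl 𝒜 x.1) N) := by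
  classical
  intro x
  obtain ⟨f, m, hf, hm, hx⟩ : ∃ (f : A) (m : ℕ) (_ : f ∈ 𝒜 m) (_ : 0 < m), f ∉ x.1.1 := by
    by_contra! hcon
    refine x.1.not_irrelevant_le fun z hz => ?_
    rw [← DirectSum.sum_support_decompose 𝒜 z]
    exact x.1.1.toIdeal.sum_mem fun k hk => hcon _ k (SetLike.coe_mem _) <| by_contra <| by aesop
  have hpow : f ^ t.natAbs ∈ 𝒜 (t.natAbs • m) := SetLike.pow_mem_graded _ hf
  refine ⟨U ⊓ ProjectiveSpectrum.basicOpen 𝒜 f, ⟨x.2, hx⟩, Opens.infLELeft _ _,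
    t.natAbs • m, (((t.natAbs • m : ℕ) : ℤ) + t).toNat, 0, f ^ t.natAbs, zero_mem _, hpow, ?_,
    fun y => ⟨pow_mem (S := compl 𝒜 y.1) y.2.2 _, ?_⟩⟩
  · have h1 : t.natAbs ≤ t.natAbs • m := by
      rw [smul_eq_mul]; exact Nat.le_mul_of_pos_right _ hm
    omega
  · exact (LocalizedModule.zero_mk _).symm

theorem add_pred (t : ℤ) (U : Opens (ProjectiveSpectrum.top 𝒜))
    {a b : ∀ x : U, LocalizedModule (compl 𝒜 x.1) N}
    (ha : (isLocallyFraction 𝒜 𝓝 t).pred a) (hb : (isLocallyFraction 𝒜 𝓝 t).pred b) :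
    (isLocallyFraction 𝒜 𝓝 t).pred (a + b) := by
  intro x
  obtain ⟨Va, ma, ia, i, j, n, s, hn, hs, hij, wa⟩ := ha x
  obtain ⟨Vb, mb, ib, i', j', n', s', hn', hs', hij', wb⟩ := hb x
  have e : i' +ᵥ j = i +ᵥ j' := by simp only [vadd_eq_add]; omega
  refine ⟨Va ⊓ Vb, ⟨ma, mb⟩, Opens.infLELeft _ _ ≫ ia, i + i', i' +ᵥ j, s' • n + s • n', s * s',
    add_mem (SetLike.GradedSMul.smul_mem hs' hn)
      (e ▸ SetLike.GradedSMul.smul_mem hs hn'), SetLike.mul_mem_graded hs hs', ?_, fun y => ?_⟩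
  · simp only [vadd_eq_add]; push_cast; omega
  · obtain ⟨h1, e1⟩ := wa ⟨y.1, y.2.1⟩
    obtain ⟨h2, e2⟩ := wb ⟨y.1, y.2.2⟩
    exact ⟨mul_mem h1 h2, congr($e1 + $e2).trans (LocalizedModule.mk_add_mk ..)⟩

theorem neg_pred (t : ℤ) (U : Opens (ProjectiveSpectrum.top 𝒜))
    {a : ∀ x : U, LocalizedModule (compl 𝒜 x.1) N}
    (ha : (isLocallyFraction 𝒜 𝓝 t).pred a) :
    (isLocallyFraction 𝒜 𝓝 t).pred (-a) := by
  intro x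
  obtain ⟨Va, ma, ia, i, j, n, s, hn, hs, hij, wa⟩ := ha x
  refine ⟨Va, ma, ia, i, j, -n, s, neg_mem hn, hs, hij, fun y => ?_⟩
  obtain ⟨h1, e1⟩ := wa y
  exact ⟨h1, congr(-$e1).trans LocalizedModule.mk_neg.symm⟩

theorem smul_pred (t : ℤ) (U : Opens (ProjectiveSpectrum.top 𝒜))
    (c : (ProjectiveSpectrum.Proj.structureSheaf 𝒜).1.obj (op U))
    {a : ∀ x : U, LocalizedModule (compl 𝒜 x.1) N}
    (ha : (isLocallyFraction 𝒜 𝓝 t).pred a) :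
    (isLocallyFraction 𝒜 𝓝 t).pred
      (fun x : U => value 𝒜 c x • a x) := by
  intro x
  obtain ⟨Va, ma, ia, i, j, n, s, hn, hs, hij, wa⟩ := ha x
  obtain ⟨Vc, mc, ic, l, ⟨p, hp⟩, ⟨q, hq⟩, hq', wc⟩ := c.2 x
  refine ⟨Va ⊓ Vc, ⟨ma, mc⟩, Opens.infLELeft _ _ ≫ ia, l + i, l +ᵥ j, p • n, q * s,
    SetLike.GradedSMul.smul_mem hp hn, SetLike.mul_mem_graded hq hs, ?_, fun y => ?_⟩
  · simp only [vadd_eq_add]; push_cast; omega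
  · obtain ⟨h1, e1⟩ := wa ⟨y.1, y.2.1⟩
    have h2 : q ∈ compl 𝒜 y.1 := hq' ⟨y.1, y.2.2⟩
    refine ⟨mul_mem h2 h1, ?_⟩
    have e2 : value 𝒜 c ⟨y.1, ia.le y.2.1⟩ = Localization.mk p ⟨q, h2⟩ :=
      (congrArg HomogeneousLocalization.val (wc ⟨y.1, y.2.2⟩)).trans
        (HomogeneousLocalization.val_mk _)
    exact congr($e2 • $e1).trans (LocalizedModule.mk_smul_mk ..)

/-- The sections over `U` of `N(t)~`. -/
def sections (t : ℤ) (U : Opens (ProjectiveSpectrum.top 𝒜)) :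
    AddSubgroup (∀ x : U, LocalizedModule (compl 𝒜 x.1) N) where
  carrier := {f | (isLocallyFraction 𝒜 𝓝 t).pred f}
  zero_mem' := zero_pred 𝒜 𝓝 t U
  add_mem' := add_pred 𝒜 𝓝 t U
  neg_mem' := neg_pred 𝒜 𝓝 t U

instance sectionsModule (t : ℤ) (U : Opens (ProjectiveSpectrum.top 𝒜)) :
    Module ((ProjectiveSpectrum.Proj.structureSheaf 𝒜).1.obj (op U)) (sections 𝒜 𝓝 t U) where
  smul c a := ⟨fun x => value 𝒜 c x • a.1 x, smul_pred 𝒜 𝓝 t U c a.2⟩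
  one_smul a := Subtype.ext <| funext fun x =>
    congr($(value_one 𝒜 x) • a.1 x).trans (one_smul _ _)
  mul_smul c d a := Subtype.ext <| funext fun x =>
    congr($(value_mul 𝒜 c d x) • a.1 x).trans (mul_smul _ _ _)
  smul_zero _ := Subtype.ext <| funext fun _ => smul_zero _
  smul_add _ _ _ := Subtype.ext <| funext fun _ => smul_add _ _ _
  add_smul c d a := Subtype.ext <| funext fun x =>
    congr($(value_add 𝒜 c d x) • a.1 x).trans (add_smul _ _ _)
  zero_smul a := Subtype.ext <| funext fun x =>
    congr($(value_zero 𝒜 x) • a.1 x).trans (zero_smul _ _)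

/-- The presheaf of abelian groups underlying `N(t)~`. -/
def abPresheaf (t : ℤ) : TopCat.Presheaf Ab.{u} (ProjectiveSpectrum.top 𝒜) where
  obj U := AddCommGrpCat.of (sections 𝒜 𝓝 t U.unop)
  map i := AddCommGrpCat.ofHom
    { toFun := fun f => ⟨fun x => f.1 (i.unop x),
        (isLocallyFraction 𝒜 𝓝 t).res i.unop f.1 f.2⟩
      map_zero' := rfl
      map_add' := fun _ _ => rfl }

/-- The presheaf of modules underlying `N(t)~`. -/
def presheafOfModules (t : ℤ) : PresheafOfModules (Proj 𝒜).ringCatSheaf.obj :=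
  letI (U : (Opens (Proj 𝒜))ᵒᵖ) :
      Module ((Proj 𝒜).ringCatSheaf.obj.obj U) ((abPresheaf 𝒜 𝓝 t).obj U) :=
    sectionsModule 𝒜 𝓝 t U.unop
  .ofPresheaf (abPresheaf 𝒜 𝓝 t) fun _ _ _ _ _ => rfl

/-- The sheaf of modules `N(t)~` on `Proj 𝒜`, for a graded `A`-module `N`. -/
def tilde (t : ℤ) : (Proj 𝒜).Modules where
  val := presheafOfModules 𝒜 𝓝 t
  isSheaf := (TopCat.Presheaf.isSheaf_iff_isSheaf_comp (forget Ab.{u}) _).2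
    (TopCat.subsheafToTypes (isLocallyFraction 𝒜 𝓝 t)).2

variable {τ' N' : Type u} [AddCommGroup N'] [Module A N'] [SetLike τ' N'] [AddSubgroupClass τ' N']
  (𝓝' : ℕ → τ') [SetLike.GradedSMul 𝒜 𝓝']

/-- The map on sections induced by an `A`-linear map homogeneous of degree `e`. -/
def sectionsMap (φ : N →ₗ[A] N') (e : ℕ) (hφ : ∀ j, ∀ n ∈ 𝓝 j, φ n ∈ 𝓝' (j + e))
    (t t' : ℤ) (ht : t' = t + e) (U : Opens (ProjectiveSpectrum.top 𝒜)) :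
    sections 𝒜 𝓝 t U →+ sections 𝒜 𝓝' t' U where
  toFun f := ⟨fun x => LocalizedModule.map (compl 𝒜 x.1) φ (f.1 x), fun x => by
    obtain ⟨V, hx, i, a, b, n, s, hn, hs, hab, h⟩ := f.2 x
    refine ⟨V, hx, i, a, b + e, φ n, s, hφ b n hn, hs, by push_cast; omega, fun y => ?_⟩
    obtain ⟨h1, h2⟩ := h y
    exact ⟨h1, congr(LocalizedModule.map (compl 𝒜 y.1) φ $h2).trans
      (LocalizedModule.map_mk ..)⟩⟩
  map_zero' := Subtype.ext <| funext fun _ => map_zero _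
  map_add' _ _ := Subtype.ext <| funext fun _ => map_add _ _ _

/-- The morphism `N(t)~ ⟶ N'(t')~`, `t' = t + e`, induced by an `A`-linear map `N → N'` that is
homogeneous of degree `e`. -/
def tildeMap (φ : N →ₗ[A] N') (e : ℕ) (hφ : ∀ j, ∀ n ∈ 𝓝 j, φ n ∈ 𝓝' (j + e))
    (t t' : ℤ) (ht : t' = t + e) : tilde 𝒜 𝓝 t ⟶ tilde 𝒜 𝓝' t' where
  val := PresheafOfModules.homMk (M₁ := presheafOfModules 𝒜 𝓝 t)
    (M₂ := presheafOfModules 𝒜 𝓝' t')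
    { app := fun U => AddCommGrpCat.ofHom (sectionsMap 𝒜 𝓝 𝓝' φ e hφ t t' ht U.unop)
      naturality := fun _ _ _ => rfl }
    fun U c f => Subtype.ext <| funext fun x =>
      (LocalizedModule.map (compl 𝒜 x.1) φ).map_smul
        (value 𝒜 (U := U.unop) c x) ((show sections 𝒜 𝓝 t U.unop from f).1 x)

theorem tildeMap_comp {τ'' N'' : Type u} [AddCommGroup N''] [Module A N''] [SetLike τ'' N'']
    [AddSubgroupClass τ'' N''] (𝓝'' : ℕ → τ'') [SetLike.GradedSMul 𝒜 𝓝'']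
    (φ : N →ₗ[A] N') (e : ℕ) (hφ : ∀ j, ∀ n ∈ 𝓝 j, φ n ∈ 𝓝' (j + e))
    (φ' : N' →ₗ[A] N'') (e' : ℕ) (hφ' : ∀ j, ∀ n ∈ 𝓝' j, φ' n ∈ 𝓝'' (j + e'))
    (ψ : N →ₗ[A] N'') (d : ℕ) (hψ : ∀ j, ∀ n ∈ 𝓝 j, ψ n ∈ 𝓝'' (j + d))
    (t t' t'' : ℤ) (ht : t' = t + e) (ht' : t'' = t' + e') (ht'' : t'' = t + d)
    (h : φ' ∘ₗ φ = ψ) :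
    tildeMap 𝒜 𝓝 𝓝' φ e hφ t t' ht ≫ tildeMap 𝒜 𝓝' 𝓝'' φ' e' hφ' t' t'' ht' =
      tildeMap 𝒜 𝓝 𝓝'' ψ d hψ t t'' ht'' := by
  subst h
  refine Scheme.Modules.hom_ext _ _ fun U => ?_
  ext f
  refine Subtype.ext <| funext fun x => ?_
  change LocalizedModule.map (compl 𝒜 x.1) φ' (LocalizedModule.map (compl 𝒜 x.1) φ
    ((show sections 𝒜 𝓝 t U from f).1 x)) = LocalizedModule.map (compl 𝒜 x.1) (φ' ∘ₗ φ)
    ((show sections 𝒜 𝓝 t U from f).1 x)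
  induction (show sections 𝒜 𝓝 t U from f).1 x with
  | h m s => simp [LocalizedModule.map_mk]

end GradedTilde

namespace ElemAb

open GradedTilde

attribute [local instance] MvPolynomial.gradedAlgebra

/-! ### Line bundles and trivial bundles on projective space -/

section Bundles

variable (k : Type u) [Field k] (r : ℕ)

/-- The polynomial ring `k[Y_1, …, Y_r]`. -/
abbrev Poly : Type u := MvPolynomial (Fin r) k

/-- The grading of `k[Y_1, …, Y_r]` by degree. -/
abbrev polyGr : ℕ → Submodule k (Poly k r) := MvPolynomial.homogeneousSubmodule (Fin r) k

/-- The projective space `ℙ^{r-1}` over `k`. -/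
abbrev PSpace : Scheme.{u} := Proj (polyGr k r)

/-- The line bundle `𝒪(d)` on `ℙ^{r-1}`. -/
def lineBundle (d : ℤ) : (PSpace k r).Modules := tilde (polyGr k r) (polyGr k r) d

variable {k r}

/-- Multiplication `𝒪(d) ⟶ 𝒪(d')`, `d' = d + e`, by a homogeneous polynomial of degree `e`. -/
def mulHom (f : Poly k r) (e : ℕ) (hf : f.IsHomogeneous e) (d d' : ℤ) (h : d' = d + e) :
    lineBundle k r d ⟶ lineBundle k r d' :=
  tildeMap (polyGr k r) (polyGr k r) (polyGr k r) (LinearMap.mulLeft (Poly k r) f) e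
    (fun j n hn => by
      have := hf.mul ((MvPolynomial.mem_homogeneousSubmodule j n).1 hn)
      rw [add_comm] at this
      exact this) d d' h

variable (k r) in
/-- The grading of `k[Y_1, …, Y_r] ⊗_k M` in which `M` has degree zero. -/
def tensorGr (M : Type u) [AddCommGroup M] [Module k M] (j : ℕ) :
    Submodule k (Poly k r ⊗[k] M) :=
  Submodule.map₂ (TensorProduct.mk k (Poly k r) M) (polyGr k r j) ⊤

theorem map_mem_of_tmul {M V : Type u} [AddCommGroup M] [Module k M] [AddCommGroup V] [Module k V]
    {j : ℕ} (φ : Poly k r ⊗[k] M →ₗ[k] V) (Q : Submodule k V)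
    (h : ∀ a ∈ polyGr k r j, ∀ m : M, φ (a ⊗ₜ m) ∈ Q) (n : Poly k r ⊗[k] M)
    (hn : n ∈ tensorGr k r M j) : φ n ∈ Q :=
  show n ∈ Q.comap φ from (Submodule.map₂_le.2 fun a ha m _ => h a ha m :
    tensorGr k r M j ≤ Q.comap φ) hn

theorem tmul_mem_tensorGr {M : Type u} [AddCommGroup M] [Module k M] {j : ℕ} {a : Poly k r}
    (ha : a ∈ polyGr k r j) (m : M) : a ⊗ₜ[k] m ∈ tensorGr k r M j :=
  Submodule.apply_mem_map₂ _ ha trivial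

instance (M : Type u) [AddCommGroup M] [Module k M] :
    SetLike.GradedSMul (polyGr k r) (tensorGr k r M) where
  smul_mem {i j a n} ha hn := by
    refine map_mem_of_tmul ((LinearMap.lsmul (Poly k r) (Poly k r ⊗[k] M) a).restrictScalars k) _ (fun b hb m => ?_) n hn
    change a • (b ⊗ₜ[k] m) ∈ _
    rw [TensorProduct.smul_tmul']
    exact tmul_mem_tensorGr (SetLike.mul_mem_graded ha hb) m

/-- The twisted trivial bundle `M ⊗_k 𝒪(t)`. -/
def trivBundle (r : ℕ) (M : Type u) [AddCommGroup M] [Module k M] (t : ℤ) :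
    (PSpace k r).Modules :=
  tilde (polyGr k r) (tensorGr k r M) t

theorem baseChange_mem {M N : Type u} [AddCommGroup M] [Module k M] [AddCommGroup N] [Module k N]
    (f : M →ₗ[k] N) (j : ℕ) (n : Poly k r ⊗[k] M) (hn : n ∈ tensorGr k r M j) :
    f.baseChange (Poly k r) n ∈ tensorGr k r N j := by
  refine map_mem_of_tmul ((f.baseChange (Poly k r)).restrictScalars k) _ (fun a ha m => ?_) n hn
  rw [LinearMap.restrictScalars_apply, LinearMap.baseChange_tmul]
  exact tmul_mem_tensorGr ha _

/-- The map `M ⊗ 𝒪(t) ⟶ N ⊗ 𝒪(t)` induced by a `k`-linear map `M → N`. -/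
def trivMap (r : ℕ) {M N : Type u} [AddCommGroup M] [Module k M] [AddCommGroup N] [Module k N]
    (f : M →ₗ[k] N) (t : ℤ) : trivBundle (k := k) r M t ⟶ trivBundle (k := k) r N t :=
  tildeMap (polyGr k r) (tensorGr k r M) (tensorGr k r N) (f.baseChange (Poly k r)) 0
    (fun j n hn => baseChange_mem f j n hn) t t (by simp)

/-- The map `𝒪(t) ⟶ M ⊗ 𝒪(t)`, `s ↦ m ⊗ s`, given by an element `m` of `M`. -/
def unitHom (r : ℕ) {M : Type u} [AddCommGroup M] [Module k M] (m : M) (t : ℤ) :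
    lineBundle k r t ⟶ trivBundle (k := k) r M t :=
  tildeMap (polyGr k r) (polyGr k r) (tensorGr k r M)
    (LinearMap.toSpanSingleton (Poly k r) _ ((1 : Poly k r) ⊗ₜ[k] m)) 0
    (fun j a ha => by
      rw [LinearMap.toSpanSingleton_apply, TensorProduct.smul_tmul', smul_eq_mul, mul_one]
      exact tmul_mem_tensorGr ha m) t t (by simp)

end Bundles

/-! ### The operator `θ` and the functor `ℱ₁` -/

section Theta

variable {k : Type u} [Field k] {r : ℕ} {E : Type u} [Group E] (g : Fin r → E)

/-- The action of `X_i = g_i - 1` on a `kE`-module `M`. -/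
def xAct (M : Rep.{u} k E) (i : Fin r) : M.V →ₗ[k] M.V := M.ρ (g i) - 1

/-- The `k[Y_1, …, Y_r]`-linear map `f ⊗ m ↦ ∑ i, Y_i f ⊗ X_i m`. -/
def thetaLin (M : Rep.{u} k E) : Module.End (Poly k r) (Poly k r ⊗[k] M.V) :=
  ∑ i, (MvPolynomial.X i : Poly k r) • (xAct g M i).baseChange (Poly k r)

theorem thetaLin_tmul (M : Rep.{u} k E) (a : Poly k r) (m : M.V) :
    thetaLin g M (a ⊗ₜ m) = ∑ i, (MvPolynomial.X i * a) ⊗ₜ xAct g M i m := by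
  simp [thetaLin, LinearMap.sum_apply, TensorProduct.smul_tmul']

theorem thetaLin_mem (M : Rep.{u} k E) (j : ℕ) (n : Poly k r ⊗[k] M.V)
    (hn : n ∈ tensorGr k r M.V j) : thetaLin g M n ∈ tensorGr k r M.V (j + 1) := by
  refine map_mem_of_tmul ((thetaLin g M).restrictScalars k) _ (fun a ha m => ?_) n hn
  rw [LinearMap.restrictScalars_apply, thetaLin_tmul]
  refine sum_mem fun i _ => tmul_mem_tensorGr ?_ _
  have := (MvPolynomial.isHomogeneous_X k i).mul ((MvPolynomial.mem_homogeneousSubmodule j a).1 ha)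
  rw [add_comm] at this
  exact this

theorem thetaLin_pow_mem (M : Rep.{u} k E) (e j : ℕ) (n : Poly k r ⊗[k] M.V)
    (hn : n ∈ tensorGr k r M.V j) : (thetaLin g M ^ e) n ∈ tensorGr k r M.V (j + e) := by
  induction e with
  | zero => simpa using hn
  | succ e ih =>
    rw [pow_succ', Module.End.mul_apply]
    exact thetaLin_mem g M _ _ ih

/-- The power `θ_M ^ e : M ⊗ 𝒪(t) ⟶ M ⊗ 𝒪(t')`, `t' = t + e`. -/
def thetaPow (M : Rep.{u} k E) (e : ℕ) (t t' : ℤ) (h : t' = t + e) :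
    trivBundle (k := k) r M.V t ⟶ trivBundle (k := k) r M.V t' :=
  tildeMap (polyGr k r) (tensorGr k r M.V) (tensorGr k r M.V) (thetaLin g M ^ e) e
    (fun j n hn => thetaLin_pow_mem g M e j n hn) t t' h

/-- The operator `θ_M : M ⊗ 𝒪(t) ⟶ M ⊗ 𝒪(t')`, `t' = t + 1`. -/
abbrev theta (M : Rep.{u} k E) (t t' : ℤ) (h : t' = t + 1) :
    trivBundle (k := k) r M.V t ⟶ trivBundle (k := k) r M.V t' :=
  thetaPow g M 1 t t' h

/-- The map `M ⊗ 𝒪(t) ⟶ N ⊗ 𝒪(t)` induced by a homomorphism of `kE`-modules. -/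
abbrev repMap (r : ℕ) {M N : Rep.{u} k E} (f : M ⟶ N) (t : ℤ) :
    trivBundle (k := k) r M.V t ⟶ trivBundle (k := k) r N.V t :=
  trivMap r f.hom.toLinearMap t

theorem repMap_theta {M N : Rep.{u} k E} (f : M ⟶ N) (t t' : ℤ) (h : t' = t + 1) :
    repMap r f t ≫ theta g N t t' h = theta g M t t' h ≫ repMap r f t' := by
  have hlin : (thetaLin g N ^ 1) ∘ₗ f.hom.toLinearMap.baseChange (Poly k r) =
      f.hom.toLinearMap.baseChange (Poly k r) ∘ₗ (thetaLin g M ^ 1) := by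
    ext m
    simp [thetaLin_tmul, xAct, Rep.hom_comm_apply, TensorProduct.tmul_sub]
  have hdeg : ∀ j, ∀ n ∈ tensorGr k r M.V j,
      (f.hom.toLinearMap.baseChange (Poly k r) ∘ₗ (thetaLin g M ^ 1)) n ∈
        tensorGr k r N.V (j + 1) := fun j n hn =>
    baseChange_mem f.hom.toLinearMap _ _ (thetaLin_pow_mem g M 1 j n hn)
  exact (tildeMap_comp _ _ _ _ _ _ _ _ _ _ _ 1 hdeg _ _ _ _ _ h hlin).trans
    (tildeMap_comp _ _ _ _ _ _ _ _ _ _ _ 1 hdeg _ _ _ _ _ h rfl).symm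

/-- The inclusion `Ker θ_M ∩ Im θ_M ⟶ Ker θ_M` of subsheaves of `M ⊗ 𝒪(t)`; the intersection is
the fibre product over `M ⊗ 𝒪(t)`. -/
def interIncl (M : Rep.{u} k E) (t : ℤ) :
    pullback (kernel.ι (theta g M t (t + 1) rfl))
      (image.ι (theta g M (t - 1) t (by ring))) ⟶ kernel (theta g M t (t + 1) rfl) :=
  pullback.fst _ _

/-- The sheaf `ℱ₁(M)(t) = Ker θ_M / (Ker θ_M ∩ Im θ_M)`, a subquotient of `M ⊗ 𝒪(t)`. -/
def F1 (M : Rep.{u} k E) (t : ℤ) : (PSpace k r).Modules := cokernel (interIncl g M t)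

/-- The map `Ker θ_M ⟶ Ker θ_N` induced by a homomorphism of `kE`-modules. -/
def kerMap {M N : Rep.{u} k E} (f : M ⟶ N) (t : ℤ) :
    kernel (theta g M t (t + 1) rfl) ⟶ kernel (theta g N t (t + 1) rfl) :=
  kernel.map _ _ (repMap r f t) (repMap r f (t + 1)) (repMap_theta g f t (t + 1) rfl).symm

/-- The map `Im θ_M ⟶ Im θ_N` induced by a homomorphism of `kE`-modules. -/
def imMap {M N : Rep.{u} k E} (f : M ⟶ N) (t : ℤ) :
    image (theta g M (t - 1) t (by ring)) ⟶ image (theta g N (t - 1) t (by ring)) :=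
  image.map (f := Arrow.mk (theta g M (t - 1) t (by ring)))
    (g := Arrow.mk (theta g N (t - 1) t (by ring))) (Arrow.homMk (u := repMap r f (t - 1)) (v := repMap r f t)
    (repMap_theta g f (t - 1) t (by ring)))

theorem imMap_ι {M N : Rep.{u} k E} (f : M ⟶ N) (t : ℤ) :
    imMap g f t ≫ image.ι (theta g N (t - 1) t (by ring)) =
      image.ι (theta g M (t - 1) t (by ring)) ≫ repMap r f t :=
  image.map_ι (f := Arrow.mk (theta g M (t - 1) t (by ring)))
    (g := Arrow.mk (theta g N (t - 1) t (by ring))) (Arrow.homMk (u := repMap r f (t - 1))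
      (v := repMap r f t) (repMap_theta g f (t - 1) t (by ring)))

/-- The map `ℱ₁(M)(t) ⟶ ℱ₁(N)(t)` induced by a homomorphism of `kE`-modules. -/
def F1map {M N : Rep.{u} k E} (f : M ⟶ N) (t : ℤ) : F1 g M t ⟶ F1 g N t :=
  cokernel.map _ _
    (pullback.map _ _ _ _ (kerMap g f t) (imMap g f t) (repMap r f t)
      (kernel.lift_ι _ _ _).symm (imMap_ι g f t).symm)
    (kerMap g f t) (pullback.lift_fst _ _ _).symm

/-- The section `ξ` of `ℱ₁(M)(t)` over `U` is the class of the section `μ` of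
`Ker θ_M ⊆ M ⊗ 𝒪(t)`. -/
def IsClass (M : Rep.{u} k E) (t : ℤ) {U : (PSpace k r).Opens}
    (μ : Γ(trivBundle (k := k) r M.V t, U)) (ξ : Γ(F1 g M t, U)) : Prop :=
  ∃ κ : Γ(kernel (theta g M t (t + 1) rfl), U),
    (kernel.ι (theta g M t (t + 1) rfl)).app U κ = μ ∧ (cokernel.π (interIncl g M t)).app U κ = ξ

end Theta

/-! ### Heller shifts of the trivial module -/

section Heller

variable (k : Type u) [Field k] (E : Type u) [Group E]

/-- A choice of Heller shifts `Ω^a k`, `a ∈ ℤ`, of the trivial `kE`-module: short exact sequences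
`0 → Ω^{a+1} k → Q_a → Ω^a k → 0` of finitely generated modules with `Q_a` projective, together
with an isomorphism `k ≅ Ω^0 k`. Taking projective covers for `a ≥ 0` and injective hulls for
`a < 0` gives the usual choice; minimality is not needed. -/
structure HellerShifts where
  /-- The module `Ω^a k`. -/
  Ω : ℤ → Rep.{u} k E
  /-- The projective module `Q_a`. -/
  Q : ℤ → Rep.{u} k E
  /-- The inclusion `Ω^{a+1} k ⟶ Q_a`. -/
  ι : ∀ a b : ℤ, b = a + 1 → (Ω b ⟶ Q a)
  /-- The projection `Q_a ⟶ Ω^a k`. -/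
  π : ∀ a : ℤ, Q a ⟶ Ω a
  finite : ∀ a, Module.Finite k (Q a).V
  projective : ∀ a, Projective (Q a)
  ι_injective : ∀ a b h, Function.Injective (ι a b h).hom
  π_surjective : ∀ a, Function.Surjective (π a).hom
  exact : ∀ a b h, Function.Exact (ι a b h).hom (π a).hom
  /-- The identification `k ≅ Ω^0 k`. -/
  trivialIso : Rep.trivial k E k ≅ Ω 0

variable {k E} (H : HellerShifts k E)

/-- A comparison map from the bar resolution of `k` to the projective resolution
`⋯ → Q_1 → Q_0 → k`, given by the images `c m (h_1, …, h_m) ∈ Q_m` of the basis elements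
`[h_1 | ⋯ | h_m]`. -/
structure IsComparison (c : ∀ (m : ℕ) (a : ℤ), a = m → (Fin m → E) → (H.Q a).V) : Prop where
  augmentation : ∀ h, (H.π 0).hom (c 0 0 rfl h) = H.trivialIso.hom.hom (1 : k)
  differential : ∀ (m : ℕ) (a b : ℤ) (ha : a = m) (hb : b = (m + 1 : ℕ)) (hab : b = a + 1)
    (h : Fin (m + 1) → E),
    (H.ι a b hab).hom ((H.π b).hom (c (m + 1) b hb h)) =
      (inhomogeneousCochains.d (H.Q a) m).hom (c m a ha) h

/-- The homomorphism `f : Ω^N k ⟶ Ω^0 k = k` represents the cohomology class in `H^N(E, k)` of the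
inhomogeneous cocycle `z`: the cocycle that it induces on the bar resolution is cohomologous
to `z`. -/
def RepresentsClass (N : ℕ) (z : (Fin N → E) → k) (a : ℤ) (ha : a = N) (f : H.Ω a ⟶ H.Ω 0) :
    Prop :=
  ∃ c : ∀ (m : ℕ) (a : ℤ), a = m → (Fin m → E) → (H.Q a).V, IsComparison H c ∧
    ∃ w, ((groupCohomology.inhomogeneousCochains (Rep.trivial k E k)).d
        ((ComplexShape.up ℕ).prev N) N).hom w =
      fun h : Fin N → E => H.trivialIso.inv.hom (f.hom ((H.π a).hom (c N a ha h))) - z h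

/-- The homomorphism `ζ : Ω^a k ⟶ Ω^b k`, `a = b + N`, represents the cohomology class in
`H^N(E, k)` of the inhomogeneous cocycle `z`: it belongs to a family of homomorphisms
`Ω^{m+N} k ⟶ Ω^m k`, `m ∈ ℤ`, each of which is a Heller shift of the previous one (that is, obtained
from it through a map of the projective modules), and the member `Ω^N k ⟶ Ω^0 k = k` of the family
represents the class of `z`. -/
def Represents (N : ℕ) (z : (Fin N → E) → k) (a b : ℤ) (hab : a = b + N) (ζ : H.Ω a ⟶ H.Ω b) :
    Prop :=
  ∃ (f : ∀ a b : ℤ, a = b + N → (H.Ω a ⟶ H.Ω b)) (q : ∀ a b : ℤ, a = b + N → (H.Q a ⟶ H.Q b)),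
    (∀ (a b : ℤ) (h : a = b + N), q a b h ≫ H.π b = H.π a ≫ f a b h) ∧
    (∀ (a b a' b' : ℤ) (h : a = b + N) (h' : a' = b' + N) (ha : a' = a + 1) (hb : b' = b + 1),
      H.ι a a' ha ≫ q a b h = f a' b' h' ≫ H.ι b b' hb) ∧
    f a b hab = ζ ∧ RepresentsClass H N z N rfl (f N 0 (by simp))

end Heller

/-! ### Cohomology classes in degrees one and two and their polynomials -/

section Cochains

variable (k : Type u) [Field k] {p r : ℕ} {E : Type u} [Group E]
  (e : E ≃* Multiplicative (Fin r → ZMod p))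

/-- The generators `g_1, …, g_r` of the elementary abelian group `E`. -/
def gen (i : Fin r) : E := e.symm (Multiplicative.ofAdd (Pi.single i 1))

/-- The homomorphism `E → ℤ/p` that is dual to the generator `g_i`. -/
def coord (i : Fin r) (h : E) : ZMod p := Multiplicative.toAdd (e h) i

/-- The algebra of inhomogeneous cochains of the finite group `E` with trivial coefficients `k`,
under the cup product `(u ∪ v)(h_1, …, h_{m+n}) = u(h_1, …, h_m) v(h_{m+1}, …, h_{m+n})`. A cochain
is recorded by its values on tuples `(h_1, …, h_n)`, which are words in `E`; the cup product is the
product of the monoid algebra of words. -/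
abbrev CochainAlg (k : Type u) [Field k] (E : Type u) : Type u := MonoidAlgebra k (FreeMonoid E)

variable {k} in
/-- The component in degree `N` of an element of the cochain algebra. -/
def component (z : CochainAlg k E) (N : ℕ) : (Fin N → E) → k :=
  fun h => z.coeff (FreeMonoid.ofList (List.ofFn h))

variable {k} in
/-- The value of the polynomial `ζ` at the cochains `c_1, …, c_r`, with respect to the cup
product. -/
def evalCochain (c : Fin r → CochainAlg k E) (ζ : MvPolynomial (Fin r) k) : CochainAlg k E :=
  ∑ s ∈ ζ.support, ζ.coeff s • (List.ofFn fun i => c i ^ s i).prod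

variable [Fintype E]

/-- The degree one cocycle `h ↦ coord i h`, representing the class `y_i ∈ H^1(E, k)` dual to
`X_i`. -/
def yCochain (i : Fin r) : CochainAlg k E :=
  ∑ h, MonoidAlgebra.single (FreeMonoid.of h) ((coord e i h).val : k)

/-- The degree two cocycle `(h, h') ↦ (ỹ(h) + ỹ(h') - ỹ(h h')) / p`, where `ỹ(h) ∈ {0, …, p - 1}`
lifts `coord i h` (the division is exact), representing the Bockstein `x_i ∈ H^2(E, k)`
of `y_i`. -/
def xCochain (i : Fin r) : CochainAlg k E :=
  ∑ h, ∑ h', MonoidAlgebra.single (FreeMonoid.of h * FreeMonoid.of h')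
    ((((coord e i h).val + (coord e i h').val - (coord e i (h * h')).val) / p : ℕ) : k)

end Cochains

/-! ### The identifications of `ℱ₁` of the Heller shifts with line bundles -/

section Identifications

variable {k : Type u} [Field k] {r : ℕ} {E : Type u} [Group E] (g : Fin r → E)
  (H : HellerShifts k E)

/-- `φ l : 𝒪(t - p l) ≅ ℱ₁(Ω^{2l} k)(t)` are the canonical identifications. For `l = 0` it is
induced by `𝒪 = k ⊗ 𝒪`. The identification for `l + 1` is obtained from the one for `l` through the
isomorphism `ℱ₁(Ω^{2l} k)(t) ≅ ℱ₁(Ω^{2l+2} k)(t + p)` which is the composite of the switchback map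
of `0 → Ω^{2l+1} k → Q_{2l} → Ω^{2l} k → 0`, the map `θ ^ (p - 2)`, and the switchback map of
`0 → Ω^{2l+2} k → Q_{2l+1} → Ω^{2l+1} k → 0`: a local section `μ` of the kernel of `θ` is lifted to
`u`, then `θ ^ (p - 1) u` is lifted to `v`, and `θ v = w`. -/
structure IsOddIdentification (p : ℕ)
    (φ : ∀ l a d t : ℤ, a = 2 * l → t = d + p * l → (lineBundle k r d ≅ F1 g (H.Ω a) t)) :
    Prop where
  zero : ∀ (d : ℤ) (h₁ : (0 : ℤ) = 2 * 0) (h₂ : d = d + p * 0) (U : (PSpace k r).Opens)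
    (s : Γ(lineBundle k r d, U)),
    IsClass g (H.Ω 0) d ((unitHom r (H.trivialIso.hom.hom (1 : k)) d).app U s)
      ((φ 0 0 d d h₁ h₂).hom.app U s)
  succ : ∀ (l a b c d t t₁ t₂ : ℤ) (ha : a = 2 * l) (hb : b = a + 1) (hc : c = b + 1)
    (hc' : c = 2 * (l + 1)) (ht : t = d + p * l) (ht₁ : t₁ = t + (p - 1 : ℕ)) (ht₂ : t₂ = t₁ + 1)
    (ht₂' : t₂ = d + p * (l + 1)) (U : (PSpace k r).Opens) (s : Γ(lineBundle k r d, U))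
    (μ : Γ(trivBundle r (H.Ω a).V t, U)) (u : Γ(trivBundle r (H.Q a).V t, U))
    (v : Γ(trivBundle r (H.Q b).V t₁, U)) (w : Γ(trivBundle r (H.Ω c).V t₂, U)),
    IsClass g (H.Ω a) t μ ((φ l a d t ha ht).hom.app U s) →
    (repMap r (H.π a) t).app U u = μ →
    (repMap r (H.π b ≫ H.ι a b hb) t₁).app U v = (thetaPow g (H.Q a) (p - 1) t t₁ ht₁).app U u →
    (repMap r (H.ι b c hc) t₂).app U w = (theta g (H.Q b) t₁ t₂ ht₂).app U v →
    (theta g (H.Ω c) t₂ (t₂ + 1) rfl).app U w = 0 →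
    IsClass g (H.Ω c) t₂ w ((φ (l + 1) c d t₂ hc' ht₂').hom.app U s)

/-- `φ a : 𝒪(t - a) ≅ ℱ₁(Ω^a k)(t)` are the canonical identifications in characteristic two. For
`a = 0` it is induced by `𝒪 = k ⊗ 𝒪`. The identification for `a + 1` is obtained from the one for
`a` through the isomorphism `ℱ₁(Ω^a k)(t) ≅ ℱ₁(Ω^{a+1} k)(t + 1)` which is the switchback map of
`0 → Ω^{a+1} k → Q_a → Ω^a k → 0`: a local section `μ` of the kernel of `θ` is lifted to `u`, and
`θ u = w`. -/
structure IsEvenIdentification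
    (φ : ∀ a d t : ℤ, t = d + a → (lineBundle k r d ≅ F1 g (H.Ω a) t)) : Prop where
  zero : ∀ (d : ℤ) (h : d = d + 0) (U : (PSpace k r).Opens) (s : Γ(lineBundle k r d, U)),
    IsClass g (H.Ω 0) d ((unitHom r (H.trivialIso.hom.hom (1 : k)) d).app U s)
      ((φ 0 d d h).hom.app U s)
  succ : ∀ (a b d t t₁ : ℤ) (hb : b = a + 1) (ht : t = d + a) (ht₁ : t₁ = t + 1)
    (ht₁' : t₁ = d + b) (U : (PSpace k r).Opens) (s : Γ(lineBundle k r d, U))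
    (μ : Γ(trivBundle r (H.Ω a).V t, U)) (u : Γ(trivBundle r (H.Q a).V t, U))
    (w : Γ(trivBundle r (H.Ω b).V t₁, U)),
    IsClass g (H.Ω a) t μ ((φ a d t ht).hom.app U s) →
    (repMap r (H.π a) t).app U u = μ →
    (repMap r (H.ι a b hb) t₁).app U w = (theta g (H.Q a) t t₁ ht₁).app U u →
    IsClass g (H.Ω b) t₁ w ((φ b d t₁ ht₁').hom.app U s)

variable (k r) in
/-- The `k`-algebra homomorphism `ρ` with `x_i ↦ Y_i ^ p`. -/
def rhoOdd (p : ℕ) : MvPolynomial (Fin r) k →ₐ[k] Poly k r :=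
  MvPolynomial.aeval fun i => MvPolynomial.X i ^ p

theorem rhoOdd_isHomogeneous (p : ℕ) {n : ℕ} {ζ : MvPolynomial (Fin r) k}
    (hζ : ζ.IsHomogeneous n) : (rhoOdd k r p ζ).IsHomogeneous (p * n) :=
  hζ.aeval _ fun i => MvPolynomial.isHomogeneous_X_pow i p

variable (k r) in
/-- The `k`-algebra homomorphism `ρ` with `y_i ↦ Y_i`. -/
def rhoEven : MvPolynomial (Fin r) k →ₐ[k] Poly k r :=
  MvPolynomial.aeval MvPolynomial.X

theorem rhoEven_isHomogeneous {n : ℕ} {ζ : MvPolynomial (Fin r) k}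
    (hζ : ζ.IsHomogeneous n) : (rhoEven k r ζ).IsHomogeneous n := by
  simpa [rhoEven] using hζ

end Identifications

end ElemAb

end

/-! Let X = ∑ Y_i (g_i - 1) in the group algebra of E over k[Y_1, …, Y_r]. Then θ is the action of
X, and X ^ p = 0 in characteristic p.

The geometric input is that Ker θ ^ b = Im θ ^ a on Q ⊗ 𝒪 for Q projective, a + b = p and b ≥ 1.
Higman's criterion gives a k-linear τ on Q that commutes with g_j for j ≠ i and satisfies ∑ g_i ^ c
τ g_i ^ (p - 1 - c) = 1. In characteristic p such a sum is the iterated commutator ad(g_i) ^ (p - 1)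
τ, and ad(θ) ^ (p - 1) τ = Y_i ^ (p - 1) ad(g_i - 1) ^ (p - 1) τ. So ∑ θ ^ c τ θ ^ (p - 1 - c) = Y_i
^ (p - 1). Cutting this sum at c = a gives Y_i ^ (p - 1) = θ ^ a G + H θ ^ b, and some Y_i is
invertible near each point (`exists_theta_splitting`, `thetaPow_exact`). A diagram chase turns
exactness into the switchback isomorphisms (`exists_isOddSwitch`, `exists_isEvenSwitch`), and the φ
arise from φ_0 by recursion in both directions.

The switchback isomorphisms are natural for Heller shifts of homomorphisms, so the diagrams for j
and j + 1 are equivalent and j = 0 suffices. There φ_n is computed from a comparison map c from the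
bar resolution to Q_*. Extend c multilinearly to words of group algebra elements and evaluate it at
W_n = [X ^ (p - 1) | X | … | X ^ (p - 1) | X] of length 2n, or at [X | … | X] of length n if p = 2.
Consecutive letters have product X ^ p = 0 and the last letter has augmentation zero, so the bar
differential retains only the face in which the first letter acts. The resulting relations, such as
θ c(W) = ι π c(X, W), say that the values of c are the successive lifts required by the switchback;
hence φ_n(s) is the class of s π c(W_n) (`isClass_oddWord`, `isClass_evenWord`). A homomorphism
representing ζ sends π c(W_n) to the value on W_n of a cocycle of ζ. Coboundaries vanish on W_n,
evaluation is multiplicative for cup products, x_i takes the value Y_i ^ p on [X ^ (p - 1) | X] and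
y_i the value Y_i on [X] (`pairsTo_x`, `pairsTo_y`). So the value is ρ(ζ) (`pairing_evalCochain`).

Representatives exist by dimension shifting, as projective modules have no cohomology in positive
degrees (`IsComparison.exists_hom`). Projective modules are moreover injective relative to k-split
inclusions, so homomorphisms can be shifted in both directions (`exists_heller_family`). -/

noncomputable section

/-! ### Local criteria for sheaves of modules -/

namespace AlgebraicGeometry.Scheme.Modules

variable {X : Scheme.{u}} {F G K : X.Modules}

/-- The functor of sections over an open subset. -/
def sectionsFunctor (U : X.Opens) : X.Modules ⥤ Ab.{u} :=
  toPresheaf X ⋙ (CategoryTheory.evaluation _ _).obj (op U)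

instance (U : X.Opens) : PreservesFiniteLimits (sectionsFunctor U) where
  preservesFiniteLimits _ _ _ :=
    @comp_preservesLimitsOfShape _ _ _ _ _ _ _ _ (toPresheaf X)
      ((CategoryTheory.evaluation _ _).obj (op U)) inferInstance
      (evaluation_preservesLimitsOfShape _)

instance (U : X.Opens) : (sectionsFunctor U).Additive where
  map_add := rfl

theorem app_injective (f : F ⟶ G) [Mono f] (U : X.Opens) : Function.Injective (f.app U) :=
  (AddCommGrpCat.mono_iff_injective _).1
    (inferInstanceAs (Mono ((sectionsFunctor U).map f)))

/-- Taking sections is left exact, so exactness in the middle survives when the first map is mono.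
-/
theorem exists_of_exact_of_mono (S : ShortComplex X.Modules) (hS : S.Exact) [Mono S.f]
    (U : X.Opens) (μ : Γ(S.X₂, U)) (h : S.g.app U μ = 0) : ∃ κ, S.f.app U κ = μ := by
  have := hS.map_of_mono_of_preservesKernel (sectionsFunctor U) inferInstance inferInstance
  exact (ShortComplex.ab_exact_iff _).1 this μ h

theorem exists_kernel_section (f : F ⟶ G) (U : X.Opens) (μ : Γ(F, U)) (h : f.app U μ = 0) :
    ∃ κ, (kernel.ι f).app U κ = μ :=
  exists_of_exact_of_mono (ShortComplex.mk _ _ (kernel.condition f))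
    (ShortComplex.exact_kernel f) U μ h

theorem section_ext (U : X.Opens) (s t : Γ(F, U))
    (h : ∀ x ∈ U, ∃ (V : X.Opens) (i : V ⟶ U), x ∈ V ∧
      F.presheaf.map i.op s = F.presheaf.map i.op t) : s = t := by
  choose V i hx hV using h
  refine TopCat.Sheaf.eq_of_locally_eq' ⟨F.presheaf, F.isSheaf⟩ (fun x : U => V x.1 x.2) U
    (fun x => i x.1 x.2) (fun x hxU => ?_) s t fun x => hV x.1 x.2
  exact Opens.mem_iSup.2 ⟨⟨x, hxU⟩, hx x hxU⟩

/-- A morphism that kills `f` kills every section locally, hence kills it because its target is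
separated. -/
theorem epi_of_locally_surjective (f : F ⟶ G)
    (h : ∀ (U : X.Opens) (s : Γ(G, U)), ∀ x ∈ U, ∃ (V : X.Opens) (i : V ⟶ U), x ∈ V ∧
      ∃ t, f.app V t = G.presheaf.map i.op s) : Epi f := by
  refine Preadditive.epi_of_cancel_zero _ fun {K} g hg => ?_
  refine hom_ext _ _ fun U => ?_
  ext s
  refine section_ext U _ _ fun x hx => ?_
  obtain ⟨V, i, hxV, t, ht⟩ := h U s x hx
  refine ⟨V, i, hxV, ?_⟩
  have h1 : K.presheaf.map i.op (g.app U s) = g.app V (G.presheaf.map i.op s) :=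
    (ConcreteCategory.congr_hom (g.mapPresheaf.naturality i.op) s).symm
  have h2 : g.app V (f.app V t) = 0 :=
    congr($(congr(($hg).app V)) t)
  rw [h1, ← ht, h2]
  exact (map_zero _).symm

/-- Exactness means that the map to the kernel is epi; local preimages of a kernel section serve for
this, since `kernel.ι` is injective on sections. -/
theorem exact_of_locally_exact (S : ShortComplex X.Modules)
    (h : ∀ (U : X.Opens) (s : Γ(S.X₂, U)), S.g.app U s = 0 → ∀ x ∈ U,
      ∃ (V : X.Opens) (i : V ⟶ U), x ∈ V ∧ ∃ t, S.f.app V t = S.X₂.presheaf.map i.op s) :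
    S.Exact := by
  rw [ShortComplex.exact_iff_epi_kernel_lift]
  refine epi_of_locally_surjective _ fun U κ x hx => ?_
  have h0 : S.g.app U ((kernel.ι S.g).app U κ) = 0 :=
    congr($(congr(($(kernel.condition S.g)).app U)) κ)
  obtain ⟨V, i, hxV, t, ht⟩ := h U _ h0 x hx
  refine ⟨V, i, hxV, t, app_injective (kernel.ι S.g) V ?_⟩
  have h1 : (kernel.ι S.g).app V ((kernel S.g).presheaf.map i.op κ) =
      S.X₂.presheaf.map i.op ((kernel.ι S.g).app U κ) :=
    ConcreteCategory.congr_hom ((kernel.ι S.g).mapPresheaf.naturality i.op) κ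
  rw [h1, ← ht]
  exact congr($(congr(($(kernel.lift_ι S.g S.f S.zero)).app V)) t)

end AlgebraicGeometry.Scheme.Modules

/-! ### Sections of the sheaf of a graded module -/

namespace GradedTilde

variable {A σ : Type u} [CommRing A] [SetLike σ A] [AddSubgroupClass σ A]
  (𝒜 : ℕ → σ) [GradedRing 𝒜]
  {τ N : Type u} [AddCommGroup N] [Module A N] [SetLike τ N] [AddSubgroupClass τ N]
  (𝓝 : ℕ → τ) [SetLike.GradedSMul 𝒜 𝓝]
  {τ' N' : Type u} [AddCommGroup N'] [Module A N'] [SetLike τ' N'] [AddSubgroupClass τ' N']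
  (𝓝' : ℕ → τ') [SetLike.GradedSMul 𝒜 𝓝']

variable {𝒜 𝓝} in
/-- A section of `N(t)~` as a family of elements of the localizations of `N`. -/
def germs {t : ℤ} {U : (Proj 𝒜).Opens} (s : Γ(tilde 𝒜 𝓝 t, U)) : sections 𝒜 𝓝 t U := s

theorem germs_ext {t : ℤ} {U : (Proj 𝒜).Opens} {s s' : Γ(tilde 𝒜 𝓝 t, U)}
    (h : ∀ x, (germs s).1 x = (germs s').1 x) : s = s' :=
  Subtype.ext (funext h)

theorem tilde_hom_ext {t : ℤ} {F : (Proj 𝒜).Modules} {f g : F ⟶ tilde 𝒜 𝓝 t}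
    (h : ∀ (U : (Proj 𝒜).Opens) (s : Γ(F, U)) (x : U),
      (germs (f.app U s)).1 x = (germs (g.app U s)).1 x) : f = g := by
  refine Scheme.Modules.hom_ext _ _ fun U => ?_
  ext s
  exact germs_ext 𝒜 𝓝 (h U s)

theorem tildeMap_add (φ φ' φ'' : N →ₗ[A] N') (e : ℕ) (hφ : ∀ j, ∀ n ∈ 𝓝 j, φ n ∈ 𝓝' (j + e))
    (hφ' : ∀ j, ∀ n ∈ 𝓝 j, φ' n ∈ 𝓝' (j + e)) (hφ'' : ∀ j, ∀ n ∈ 𝓝 j, φ'' n ∈ 𝓝' (j + e))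
    (h : φ'' = φ + φ') (t t' : ℤ) (ht : t' = t + e) :
    tildeMap 𝒜 𝓝 𝓝' φ'' e hφ'' t t' ht =
      tildeMap 𝒜 𝓝 𝓝' φ e hφ t t' ht + tildeMap 𝒜 𝓝 𝓝' φ' e hφ' t t' ht := by
  subst h
  refine tilde_hom_ext 𝒜 𝓝' fun U s x => ?_
  change LocalizedModule.map (compl 𝒜 x.1) (φ + φ') ((germs s).1 x) =
    LocalizedModule.map (compl 𝒜 x.1) φ ((germs s).1 x) +
      LocalizedModule.map (compl 𝒜 x.1) φ' ((germs s).1 x)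
  rw [map_add, LinearMap.add_apply]

theorem tildeMap_zero (φ : N →ₗ[A] N') (e : ℕ) (hφ : ∀ j, ∀ n ∈ 𝓝 j, φ n ∈ 𝓝' (j + e))
    (t t' : ℤ) (ht : t' = t + e) (h : φ = 0) : tildeMap 𝒜 𝓝 𝓝' φ e hφ t t' ht = 0 := by
  subst h
  refine tilde_hom_ext 𝒜 𝓝' fun U s x => ?_
  change LocalizedModule.map (compl 𝒜 x.1) 0 ((germs s).1 x) = 0
  rw [map_zero, LinearMap.zero_apply]

theorem tildeMap_id (φ : N →ₗ[A] N) (hφ : ∀ j, ∀ n ∈ 𝓝 j, φ n ∈ 𝓝 (j + 0))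
    (t : ℤ) (ht : t = t + (0 : ℕ)) (h : φ = LinearMap.id) :
    tildeMap 𝒜 𝓝 𝓝 φ 0 hφ t t ht = 𝟙 _ := by
  subst h
  refine tilde_hom_ext 𝒜 𝓝 fun U s x => ?_
  change LocalizedModule.map (compl 𝒜 x.1) LinearMap.id ((germs s).1 x) = (germs s).1 x
  induction (germs s).1 x with
  | h m s => simp

/-- Division of a section by a homogeneous element that vanishes nowhere. -/
theorem exists_section_div {t : ℤ} {U : (Proj 𝒜).Opens} (s : Γ(tilde 𝒜 𝓝 t, U)) (f : A) (e : ℕ)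
    (hf : f ∈ 𝒜 e) (hU : ∀ x : U, f ∈ compl 𝒜 x.1) (t' : ℤ) (ht : t = t' + e) :
    ∃ s' : Γ(tilde 𝒜 𝓝 t', U), ∀ x : U, (germs s').1 x =
      Localization.mk 1 (⟨f, hU x⟩ : compl 𝒜 x.1) • (germs s).1 x := by
  refine ⟨(⟨fun x => Localization.mk 1 (⟨f, hU x⟩ : compl 𝒜 x.1) • (germs s).1 x,
    fun x => ?_⟩ : sections 𝒜 𝓝 t' U), fun x => rfl⟩
  obtain ⟨V, hx, i, a, b, n, q, hn, hq, hab, h⟩ := (germs s).2 x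
  -- The quotient of n / q by f is n / (f q): the degree of the denominator grows by e, so the twist
  -- drops from t to t'.
  refine ⟨V, hx, i, e + a, b, n, f * q, hn, SetLike.mul_mem_graded hf hq, by push_cast; omega,
    fun y => ?_⟩
  obtain ⟨h1, h2⟩ := h y
  refine ⟨mul_mem (hU ⟨y.1, i.le y.2⟩) h1, ?_⟩
  refine (congr(Localization.mk 1 (⟨f, hU ⟨y.1, i.le y.2⟩⟩ : compl 𝒜 y.1) • $h2)).trans ?_
  exact (LocalizedModule.mk_smul_mk ..).trans (by rw [one_smul]; rfl)

end GradedTilde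

/-! ### Iterated commutators in characteristic p -/

section AdPower

/-- In characteristic `p`, `∑ x ^ i * y ^ (p - 1 - i)` is the power `(x - y) ^ (p - 1)` for commuting
elements `x` and `y`. -/
theorem Commute.geom_sum₂_eq_sub_pow {R : Type*} [Ring R] (p : ℕ) [Fact p.Prime]
    (hp0 : (p : R) = 0) {x y : R} (h : Commute x y) :
    ∑ i ∈ Finset.range p, x ^ i * y ^ (p - 1 - i) = (x - y) ^ (p - 1) := by
  -- The identity is proved over 𝔽_p in two variables, where X_0 - X_1 can be cancelled: after
  -- multiplication by it both sides are X_0 ^ p - X_1 ^ p. It is then specialised to the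
  -- commutative subalgebra generated by x and y.
  have key : ∑ i ∈ Finset.range p,
      (MvPolynomial.X 0 : MvPolynomial (Fin 2) (ZMod p)) ^ i * MvPolynomial.X 1 ^ (p - 1 - i) =
      (MvPolynomial.X 0 - MvPolynomial.X 1) ^ (p - 1) := by
    have hp : 0 < p := (Fact.out : p.Prime).pos
    have h1 : (MvPolynomial.X 0 - MvPolynomial.X 1 : MvPolynomial (Fin 2) (ZMod p)) ≠ 0 := by
      rw [sub_ne_zero]
      exact fun h => zero_ne_one (MvPolynomial.X_injective h)
    refine mul_right_cancel₀ h1 ?_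
    rw [geom_sum₂_mul, ← pow_succ, Nat.sub_add_cancel hp, sub_pow_char]
  rcases subsingleton_or_nontrivial R with _ | _
  · exact Subsingleton.elim _ _
  have : CharP R p := (CharP.charP_iff_prime_eq_zero Fact.out).2 hp0
  let _ : Algebra (ZMod p) R := ZMod.algebra R p
  have hc := Algebra.isMulCommutative_adjoin (ZMod p) (s := {x, y}) (by
    rintro a (rfl | rfl) b (rfl | rfl)
    exacts [rfl, h, h.symm, rfl])
  let S : Subalgebra (ZMod p) R := Algebra.adjoin (ZMod p) {x, y}
  let _ : CommRing S := { (inferInstance : Ring S) with mul_comm := hc.is_comm.comm }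
  let x' : S := ⟨x, Algebra.subset_adjoin (by simp)⟩
  let y' : S := ⟨y, Algebra.subset_adjoin (by simp)⟩
  have := congrArg (fun q => S.val (MvPolynomial.aeval ![x', y'] q)) key
  simpa [map_sum, x', y'] using this

/-- In characteristic `p`, the sum `∑ a ^ i * τ * a ^ (p - 1 - i)` is the `(p - 1)`-st iterated
commutator of `a` with `τ`. -/
theorem sum_pow_mul_pow_eq_ad {A : Type*} [Ring A] (p : ℕ) [Fact p.Prime] (hp0 : (p : A) = 0)
    (a τ : A) :
    ∑ i ∈ Finset.range p, a ^ i * τ * a ^ (p - 1 - i) =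
      ((LinearMap.mulLeft ℤ a - LinearMap.mulRight ℤ a) ^ (p - 1)) τ := by
  -- Left and right multiplication by a commute, so the geometric sum identity applies to them in
  -- the ring of additive endomorphisms of A.
  have h0 : (p : Module.End ℤ A) = 0 := by
    ext x
    simp [Module.End.natCast_apply, nsmul_eq_mul (α := A), hp0]
  rw [← Commute.geom_sum₂_eq_sub_pow p h0 (LinearMap.commute_mulLeft_right a a),
    LinearMap.sum_apply]
  refine Finset.sum_congr rfl fun i _ => ?_
  simp [LinearMap.pow_mulLeft, LinearMap.pow_mulRight, mul_assoc]

end AdPower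

/-! ### Higman's criterion for projective modules -/

section Higman

variable {k : Type u} [Field k] {E : Type u} [Group E] [Fintype E]

/-- Functions from `E` to a representation `Q` (with no action on the values). -/
def regularFunctions (Q : Rep.{u} k E) : Rep.{u} k E :=
  Rep.of (X := E → Q.V)
    { toFun g :=
        { toFun φ x := φ (g⁻¹ * x)
          map_add' _ _ := rfl
          map_smul' _ _ := rfl }
      map_one' := by ext; simp
      map_mul' g h := by ext; simp [mul_assoc] }

omit [Fintype E] in
theorem regularFunctions_apply (Q : Rep.{u} k E) (g : E) (φ : E → Q.V) (x : E) :
    (regularFunctions Q).ρ g φ x = φ (g⁻¹ * x) := rfl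

/-- The surjection `φ ↦ ∑ x • φ x`. -/
def evalRegular (Q : Rep.{u} k E) : regularFunctions Q ⟶ Q :=
  Rep.ofHom
    { toFun := fun φ : E → Q.V => ∑ x : E, Q.ρ x (φ x)
      map_add' := fun φ ψ => by simp [Finset.sum_add_distrib]
      map_smul' := fun c φ => by simp [Finset.smul_sum]
      isIntertwining' g := by
        refine LinearMap.ext fun φ : E → Q.V => ?_
        change ∑ x : E, Q.ρ x ((regularFunctions Q).ρ g φ x) = Q.ρ g (∑ x : E, Q.ρ x (φ x))
        rw [map_sum]
        refine (Fintype.sum_equiv (Equiv.mulLeft g) _ _ fun x => ?_).symm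
        simp [regularFunctions_apply] }

theorem evalRegular_apply (Q : Rep.{u} k E) (φ : E → Q.V) :
    (evalRegular Q).hom φ = ∑ x, Q.ρ x (φ x) := rfl

/-- The surjection `evalRegular` onto the projective module Q splits. Reading the splitting at the
identity of E gives T, and equivariance recovers its other values, so that the splitting identity
becomes the trace identity. -/
theorem exists_trace_eq_one (Q : Rep.{u} k E) [Projective Q] :
    ∃ T : Q.V →ₗ[k] Q.V, ∀ m, ∑ g : E, Q.ρ g (T (Q.ρ g⁻¹ m)) = m := by
  classical
  have hs : Function.Surjective (evalRegular Q).hom := fun m => ⟨Pi.single 1 m, by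
    rw [evalRegular_apply, Finset.sum_eq_single 1]
    · simp
    · intro b _ hb
      simp [Pi.single_eq_of_ne hb]
    · simp⟩
  have : Epi (evalRegular Q) := (Rep.epi_iff_surjective _).2 hs
  let s := Projective.factorThru (𝟙 Q) (evalRegular Q)
  have hsec : s ≫ evalRegular Q = 𝟙 Q := Projective.factorThru_comp _ _
  let s' : Q.V →ₗ[k] (E → Q.V) := s.hom.toLinearMap
  refine ⟨LinearMap.proj 1 ∘ₗ s', fun m => ?_⟩
  have h1 : ∀ g : E, s' (Q.ρ g⁻¹ m) 1 = s' m g := fun g => by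
    have : s' (Q.ρ g⁻¹ m) = (regularFunctions Q).ρ g⁻¹ (s' m) := Rep.hom_comm_apply s g⁻¹ m
    rw [this, regularFunctions_apply]
    simp
  have h2 : (evalRegular Q).hom (s' m) = m := congr(($hsec).hom m)
  rw [evalRegular_apply] at h2
  simpa [h1] using h2

end Higman

namespace ElemAb

open GradedTilde

attribute [local instance] MvPolynomial.gradedAlgebra

variable {k : Type u} [Field k] {p r : ℕ} {E : Type u} [CommGroup E]

/-! ### The generic element X = ∑ Y_i (g_i - 1) -/

section GroupAlgebra

variable (g : Fin r → E)

/-- The action of the group algebra `k[Y_1, …, Y_r][E]` on `k[Y_1, …, Y_r] ⊗ M`. -/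
def groupAlgebraAction (r : ℕ) (M : Rep.{u} k E) :
    MonoidAlgebra (Poly k r) E →ₐ[Poly k r] Module.End (Poly k r) (Poly k r ⊗[k] M.V) :=
  MonoidAlgebra.lift (Poly k r) _ E
    ((Module.End.baseChangeHom k (Poly k r) M.V : _ →* _).comp M.ρ)

theorem groupAlgebraAction_single (M : Rep.{u} k E) (h : E) (a : Poly k r) :
    groupAlgebraAction r M (MonoidAlgebra.single h a) = a • (M.ρ h).baseChange (Poly k r) := by
  simp only [groupAlgebraAction, MonoidAlgebra.lift_single]
  rfl

/-- The element `∑ Y_i (g_i - 1)` of the group algebra. -/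
def thetaElt : MonoidAlgebra (Poly k r) E :=
  ∑ i, (MvPolynomial.X i : Poly k r) • (MonoidAlgebra.single (g i) 1 - 1)

theorem groupAlgebraAction_thetaElt (M : Rep.{u} k E) :
    groupAlgebraAction r M (thetaElt g) = thetaLin g M := by
  simp only [thetaElt, map_sum, map_smul, map_sub, map_one, groupAlgebraAction_single, one_smul,
    thetaLin, xAct]
  refine Finset.sum_congr rfl fun i _ => ?_
  rw [LinearMap.baseChange_sub]
  congr 2
  exact LinearMap.baseChange_id.symm

variable [Fact p.Prime] [CharP k p]

/-- The group algebra is commutative of characteristic p, so the p-th power is additive and the i-th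
term becomes Y_i ^ p (g_i ^ p - 1) = 0. -/
theorem thetaElt_pow (hg : ∀ i, g i ^ p = 1) : (thetaElt g : MonoidAlgebra (Poly k r) E) ^ p = 0 := by
  have : CharP (MonoidAlgebra (Poly k r) E) p := charP_of_injective_algebraMap
    (FaithfulSMul.algebraMap_injective (Poly k r) (MonoidAlgebra (Poly k r) E)) p
  rw [thetaElt, sum_pow_char p]
  refine Finset.sum_eq_zero fun i _ => ?_
  rw [smul_pow, sub_pow_char, MonoidAlgebra.single_pow, hg]
  simp [MonoidAlgebra.one_def]

theorem thetaLin_pow_prime (hg : ∀ i, g i ^ p = 1) (M : Rep.{u} k E) : thetaLin g M ^ p = 0 := by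
  rw [← groupAlgebraAction_thetaElt, ← map_pow, thetaElt_pow g hg, map_zero]

end GroupAlgebra

section Generators

variable (e : E ≃* Multiplicative (Fin r → ZMod p))

theorem coord_one (i : Fin r) : coord e i 1 = 0 := by simp [coord]

theorem coord_mul (i : Fin r) (x y : E) : coord e i (x * y) = coord e i x + coord e i y := by
  simp [coord]

theorem coord_inv (i : Fin r) (x : E) : coord e i x⁻¹ = - coord e i x := by
  simp [coord]

theorem coord_pow (i : Fin r) (x : E) (n : ℕ) : coord e i (x ^ n) = n * coord e i x := by
  simp [coord]

theorem coord_gen (i j : Fin r) : coord e i (gen e j) = if i = j then 1 else 0 := by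
  simp [coord, gen, Pi.single_apply]

theorem pow_prime_eq_one (e : E ≃* Multiplicative (Fin r → ZMod p)) (x : E) : x ^ p = 1 := by
  apply e.injective
  apply Multiplicative.toAdd.injective
  ext i
  change coord e i (x ^ p) = coord e i 1
  rw [coord_pow, coord_one, CharP.cast_eq_zero, zero_mul]

end Generators

theorem sum_range_eq_add_of_add_eq {M : Type*} [AddCommMonoid M] {a b n : ℕ}
    (h : a + b = n) (f : ℕ → M) :
    ∑ i ∈ Finset.range n, f i =
      ∑ i ∈ Finset.range a, f i + ∑ i ∈ Finset.range b, f (a + i) := by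
  subst h
  exact Finset.sum_range_add ..

theorem sum_mul_sub_mul_sum {A ι : Type*} [Ring A] (s : Finset ι) (f : ι → A) (z : A) :
    (∑ i ∈ s, f i) * z - z * ∑ i ∈ s, f i = ∑ i ∈ s, (f i * z - z * f i) := by
  rw [Finset.sum_mul, Finset.mul_sum, Finset.sum_sub_distrib]

/-- Iterated commutators with `∑ y_j x_j` of an element commuting with all `x_j` but one. -/
theorem ad_pow_sum {S A B ι F : Type*} [Fintype ι] [CommRing S] [Ring A] [Algebra S A] [Ring B]
    [FunLike F B A] [RingHomClass F B A] (β : F) (y : ι → S) (x : ι → B) (i : ι)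
    (hx : ∀ j, Commute (x i) (x j)) (τ : B) (hτ : ∀ j ≠ i, Commute τ (x j)) (m : ℕ) :
    ((LinearMap.mulLeft ℤ (∑ j, y j • β (x j)) - LinearMap.mulRight ℤ (∑ j, y j • β (x j))) ^ m)
      (β τ) = y i ^ m • β (((LinearMap.mulLeft ℤ (x i) - LinearMap.mulRight ℤ (x i)) ^ m) τ) := by
  set D' := LinearMap.mulLeft ℤ (∑ j, y j • β (x j)) - LinearMap.mulRight ℤ (∑ j, y j • β (x j))
  set D := LinearMap.mulLeft ℤ (x i) - LinearMap.mulRight ℤ (x i)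
  -- Commutation with the x_j, j ≠ i, is carried along in the induction: it makes these terms drop
  -- out of the next commutator.
  have key : (∀ j ≠ i, Commute ((D ^ m) τ) (x j)) ∧ (D' ^ m) (β τ) = y i ^ m • β ((D ^ m) τ) := by
    induction m with
    | zero => simpa using hτ
    | succ m ih =>
      obtain ⟨h1, h2⟩ := ih
      have hs : (D ^ (m + 1)) τ = x i * (D ^ m) τ - (D ^ m) τ * x i := by
        rw [pow_succ']
        rfl
      have hs' : (D' ^ (m + 1)) (β τ) =
          (∑ j, y j • β (x j)) * (D' ^ m) (β τ) - (D' ^ m) (β τ) * ∑ j, y j • β (x j) := by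
        rw [pow_succ']
        rfl
      refine ⟨fun j hj => ?_, ?_⟩
      · rw [hs]
        exact ((hx j).mul_left (h1 j hj)).sub_left ((h1 j hj).mul_left (hx j))
      · rw [hs', hs, h2, sum_mul_sub_mul_sum, Finset.sum_eq_single i]
        · simp only [smul_mul_assoc, mul_smul_comm, smul_smul, map_sub, map_mul, smul_sub]
          rw [pow_succ, mul_comm (y i)]
        · intro j _ hj
          simp only [smul_mul_assoc, mul_smul_comm, ← map_mul, (h1 j hj).eq]
          rw [smul_comm, sub_self]
        · simp
  exact key.2

/-- On an element killed by β the identity reads f m = α (G m), and f is invertible in the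
localization. This turns a homotopy for multiplication by f into local exactness. -/
theorem localized_div {A N : Type*} [CommRing A] [AddCommGroup N] [Module A N] {S : Submonoid A}
    (f : A) (hf : f ∈ S) (α β G H : Module.End A N) (h : f • (1 : Module.End A N) = α * G + H * β)
    (m : LocalizedModule S N) (hm : LocalizedModule.map S β m = 0) :
    Localization.mk 1 (⟨f, hf⟩ : S) •
      LocalizedModule.map S α (LocalizedModule.map S G m) = m := by
  have h1 : LocalizedModule.map S (f • (1 : Module.End A N)) m =
      LocalizedModule.map S α (LocalizedModule.map S G m) +
        LocalizedModule.map S H (LocalizedModule.map S β m) := by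
    rw [h, map_add, LinearMap.add_apply]
    induction m with
    | h m s => simp [LocalizedModule.map_mk]
  rw [hm, map_zero, add_zero] at h1
  rw [← h1]
  induction m with
  | h m s =>
    rw [LocalizedModule.map_mk, LocalizedModule.mk_smul_mk, one_smul]
    exact LocalizedModule.mk_cancel_common_left ⟨f, hf⟩ s m

/-! ### A contraction of θ on projective modules -/

section Contraction

variable [Fintype E] [Fact p.Prime] [CharP k p] (e : E ≃* Multiplicative (Fin r → ZMod p))

omit [CharP k p] in
-- The trace of Higman's T is taken in two stages. The partial trace T' over the subgroup where the
-- i-th coordinate vanishes commutes with the other generators, because they permute this subgroup;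
-- the trace of T' over the powers of g_i is then 1.
theorem exists_contraction (Q : Rep.{u} k E) [Projective Q] (i : Fin r) :
    ∃ τ : Module.End k Q.V, (∀ j ≠ i, Commute τ (Q.ρ (gen e j))) ∧
      ∑ a ∈ Finset.range p, Q.ρ (gen e i) ^ a * τ * Q.ρ (gen e i) ^ (p - 1 - a) = 1 := by
  classical
  obtain ⟨T, hT⟩ := exists_trace_eq_one Q
  let c : E → Module.End k Q.V := fun h => Q.ρ h * T * Q.ρ h⁻¹
  have hc : ∀ x h, Q.ρ x * c h = c (x * h) * Q.ρ x := fun x h => by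
    simp only [c, mul_inv_rev, map_mul, mul_assoc]
    rw [← map_mul Q.ρ x⁻¹ x]
    simp
  let T' : Module.End k Q.V := ∑ h with coord e i h = 0, c h
  have hcomm : ∀ j ≠ i, Commute T' (Q.ρ (gen e j)) := fun j hj => by
    simp only [Commute, SemiconjBy, T', Finset.mul_sum, Finset.sum_mul, hc]
    refine Finset.sum_nbij' (fun h => (gen e j)⁻¹ * h) (fun h => gen e j * h) ?_ ?_ ?_ ?_ ?_ <;>
      simp [coord_mul, coord_inv, coord_gen, hj.symm]
  have hsum : ∑ a ∈ Finset.range p, ∑ h with coord e i h = 0, c (gen e i ^ a * h) = 1 := by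
    have h1 : ∑ h, c h = 1 := by
      ext m
      simpa [c, LinearMap.sum_apply] using hT m
    rw [← h1, ← Finset.sum_product']
    refine Finset.sum_nbij' (fun q => gen e i ^ q.1 * q.2)
      (fun h => ((coord e i h).val, (gen e i ^ (coord e i h).val)⁻¹ * h)) ?_ ?_ ?_ ?_ ?_
    · simp
    · simp [coord_mul, coord_inv, coord_pow, coord_gen, ZMod.val_lt]
    · rintro ⟨a, h⟩ hq
      simp only [Finset.mem_product, Finset.mem_range, Finset.mem_filter] at hq
      have : (coord e i (gen e i ^ a * h)).val = a := by
        simp [coord_mul, coord_pow, coord_gen, hq.2.2, ZMod.val_cast_of_lt hq.1]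
      simp [this]
    · simp
    · simp
  -- The factor g_i adjusts the exponent: g_i ^ a T' g_i g_i ^ (p - 1 - a) = g_i ^ a T' g_i ^ (-a),
  -- because g_i ^ p = 1.
  refine ⟨T' * Q.ρ (gen e i), fun j hj => (hcomm j hj).mul_left ?_, ?_⟩
  · rw [Commute, SemiconjBy, ← map_mul, ← map_mul, mul_comm]
  · rw [← hsum]
    refine Finset.sum_congr rfl fun a ha => ?_
    have hp : p - 1 - a + 1 = p - a := by
      have := Finset.mem_range.1 ha
      omega
    rw [mul_assoc, mul_assoc, ← pow_succ', hp, ← mul_assoc, ← map_pow, ← map_pow, Finset.mul_sum,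
      Finset.sum_mul]
    refine Finset.sum_congr rfl fun h _ => ?_
    rw [hc, mul_assoc, ← map_mul, ← pow_add, Nat.add_sub_cancel' (Finset.mem_range.1 ha).le,
      pow_prime_eq_one e, map_one, mul_one]

/-- The sum is ad(θ) ^ (p - 1) τ. Since τ commutes with every g_j except g_i, this is Y_i ^ (p - 1)
ad(g_i - 1) ^ (p - 1) τ, and the last iterated commutator is 1 by the choice of τ. -/
theorem exists_theta_contraction (Q : Rep.{u} k E) [Projective Q] (i : Fin r) :
    ∃ τ : Module.End k Q.V,
      ∑ a ∈ Finset.range p, thetaLin (gen e) Q ^ a * τ.baseChange (Poly k r) *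
        thetaLin (gen e) Q ^ (p - 1 - a) = (MvPolynomial.X i : Poly k r) ^ (p - 1) • 1 := by
  obtain ⟨τ, hτ, h1⟩ := exists_contraction e Q i
  refine ⟨τ, ?_⟩
  let β : Module.End k Q.V →ₐ[k] Module.End (Poly k r) (Poly k r ⊗[k] Q.V) :=
    Module.End.baseChangeHom k (Poly k r) Q.V
  have hp0 : (p : Module.End k Q.V) = 0 := by
    rw [← map_natCast (algebraMap k (Module.End k Q.V)), CharP.cast_eq_zero, map_zero]
  have hp1 : (p : Module.End (Poly k r) (Poly k r ⊗[k] Q.V)) = 0 := by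
    rw [← map_natCast β, hp0, map_zero]
  have hD := ad_pow_sum β (fun j => (MvPolynomial.X j : Poly k r))
    (fun j => Q.ρ (gen e j) - 1) i (fun j => ?_) τ (fun j hj => ?_) (p - 1)
  rw [sum_pow_mul_pow_eq_ad p hp0] at h1
  -- Commutators do not see the difference between g_i - 1 and g_i.
  · have hsub : LinearMap.mulLeft ℤ (Q.ρ (gen e i) - 1) - LinearMap.mulRight ℤ (Q.ρ (gen e i) - 1) =
        LinearMap.mulLeft ℤ (Q.ρ (gen e i)) - LinearMap.mulRight ℤ (Q.ρ (gen e i)) := by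
      refine LinearMap.ext fun z => ?_
      simp [sub_mul, mul_sub]
    rw [hsub, h1, map_one] at hD
    exact (sum_pow_mul_pow_eq_ad p hp1 _ _).trans hD
  · have : Commute (Q.ρ (gen e i)) (Q.ρ (gen e j)) := by
      rw [Commute, SemiconjBy, ← map_mul, ← map_mul, mul_comm]
    exact (this.sub_right (Commute.one_right _)).sub_left (Commute.one_left _)
  · exact (hτ j hj).sub_right (Commute.one_right _)

/-- On `k[Y_1, …, Y_r] ⊗ Q`, with `Q` projective, multiplication by `Y_i ^ (p - 1)` factors through
`θ ^ a` up to a map factoring through `θ ^ b`, where `a + b = p`. -/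
theorem exists_theta_splitting (Q : Rep.{u} k E) [Projective Q] (i : Fin r) (a b : ℕ)
    (hab : a + b = p) (hb : 1 ≤ b) :
    ∃ G H : Module.End (Poly k r) (Poly k r ⊗[k] Q.V),
      (∀ j, ∀ n ∈ tensorGr k r Q.V j, G n ∈ tensorGr k r Q.V (j + (b - 1))) ∧
      (MvPolynomial.X i : Poly k r) ^ (p - 1) • (1 : Module.End (Poly k r) (Poly k r ⊗[k] Q.V)) =
        thetaLin (gen e) Q ^ a * G + H * thetaLin (gen e) Q ^ b := by
  obtain ⟨τ, hτ⟩ := exists_theta_contraction e Q i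
  let θ := thetaLin (gen e) Q
  let T := τ.baseChange (Poly k r)
  -- The sum ∑ θ ^ c τ θ ^ (p - 1 - c) is cut at c = a. Terms with c ≥ a have θ ^ a on the left and
  -- make up G; terms with c < a have θ ^ b on the right, as p - 1 - c = (a - 1 - c) + b, and make
  -- up H.
  refine ⟨∑ c ∈ Finset.range b, θ ^ c * T * θ ^ (b - 1 - c),
    ∑ c ∈ Finset.range a, θ ^ c * T * θ ^ (a - 1 - c), fun j n hn => ?_, ?_⟩
  · rw [LinearMap.sum_apply]
    refine sum_mem fun c hc => ?_
    have h1 := thetaLin_pow_mem (gen e) Q c _ _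
      (baseChange_mem τ _ _ (thetaLin_pow_mem (gen e) Q (b - 1 - c) j n hn))
    have h2 : j + (b - 1 - c) + c = j + (b - 1) := by
      have := Finset.mem_range.1 hc
      omega
    exact h2 ▸ h1
  · rw [← hτ, sum_range_eq_add_of_add_eq hab, add_comm, Finset.mul_sum, Finset.sum_mul]
    congr 1
    · refine Finset.sum_congr rfl fun c hc => ?_
      have h2 : p - 1 - (a + c) = b - 1 - c := by omega
      rw [h2, pow_add]
      simp only [mul_assoc, θ, T]
    · refine Finset.sum_congr rfl fun c hc => ?_
      have h2 : p - 1 - c = a - 1 - c + b := by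
        have := Finset.mem_range.1 hc
        omega
      rw [h2, pow_add]
      simp only [mul_assoc, θ, T]

end Contraction

/-! ### Exactness of powers of θ on projective modules -/

section Exactness

variable (g : Fin r → E)

theorem thetaPow_comp (M : Rep.{u} k E) (a b c : ℕ) (hc : c = a + b) (t t' t'' : ℤ) (h : t' = t + a)
    (h' : t'' = t' + b) (h'' : t'' = t + c) :
    thetaPow g M a t t' h ≫ thetaPow g M b t' t'' h' = thetaPow g M c t t'' h'' :=
  tildeMap_comp _ _ _ _ _ _ _ _ _ _ _ _ _ _ _ _ _ _ _ (by
    rw [hc, add_comm a b, pow_add]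
    rfl)

theorem thetaPow_eq_zero (M : Rep.{u} k E) (a : ℕ) (t t' : ℤ) (h : t' = t + a)
    (ha : thetaLin g M ^ a = 0) : thetaPow g M a t t' h = 0 :=
  tildeMap_zero _ _ _ _ _ _ _ _ _ ha

variable [Fact p.Prime] [CharP k p] (e : E ≃* Multiplicative (Fin r → ZMod p))

/-- A point containing all the variables would contain every polynomial without constant term, that
is, the irrelevant ideal. -/
theorem exists_X_notMem (x : ProjectiveSpectrum (polyGr k r)) :
    ∃ i : Fin r, (MvPolynomial.X i : Poly k r) ∈ compl (polyGr k r) x := by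
  by_contra! hcon
  refine x.not_irrelevant_le fun z hz => ?_
  have h1 : Ideal.span (MvPolynomial.X '' (Set.univ : Set (Fin r))) ≤
      x.asHomogeneousIdeal.toIdeal := by
    rw [Ideal.span_le]
    rintro _ ⟨i, -, rfl⟩
    exact not_not.1 (hcon i)
  refine h1 (MvPolynomial.mem_ideal_span_X_image.2 fun m hm => ?_)
  by_contra! h
  have hm0 : m = 0 := Finsupp.ext fun i => h i trivial
  subst hm0
  refine MvPolynomial.mem_support_iff.1 hm ?_
  have h2 : MvPolynomial.homogeneousComponent 0 z = 0 := by
    rw [HomogeneousIdeal.mem_irrelevant_iff] at hz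
    exact (MvPolynomial.decomposition.decompose'_apply z 0).symm.trans hz
  simpa using h2

theorem thetaPow_zero_of_add_eq (M : Rep.{u} k E) (a b : ℕ)
    (hab : a + b = p) (t t' t'' : ℤ) (h : t' = t + a) (h' : t'' = t' + b) :
    thetaPow (gen e) M a t t' h ≫ thetaPow (gen e) M b t' t'' h' = 0 := by
  rw [thetaPow_comp (gen e) M a b p hab.symm t t' t'' h h' (by omega)]
  exact thetaPow_eq_zero _ _ _ _ _ _
    (thetaLin_pow_prime (gen e) (fun i => pow_prime_eq_one e _) M)

/-- Where Y_i does not vanish, a section killed by θ ^ b is recovered by applying θ ^ a G to its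
quotient by Y_i ^ (p - 1). As G has degree b - 1, the twists match: t' - (p - 1) + (b - 1) = t. -/
theorem thetaPow_exact [Fintype E] (Q : Rep.{u} k E) [Projective Q] (a b : ℕ)
    (hab : a + b = p) (hb : 1 ≤ b) (t t' t'' : ℤ) (h : t' = t + a) (h' : t'' = t' + b) :
    (ShortComplex.mk (thetaPow (gen e) Q a t t' h) (thetaPow (gen e) Q b t' t'' h')
      (thetaPow_zero_of_add_eq e Q a b hab t t' t'' h h')).Exact := by
  refine Scheme.Modules.exact_of_locally_exact _ fun U s hs x hx => ?_
  obtain ⟨i, hi⟩ := exists_X_notMem x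
  obtain ⟨G, H, hG, hGH⟩ := exists_theta_splitting e Q i a b hab hb
  let V : (PSpace k r).Opens :=
    U ⊓ ProjectiveSpectrum.basicOpen (polyGr k r) (MvPolynomial.X i : Poly k r)
  let ι : V ⟶ U := Opens.infLELeft _ _
  have hV : ∀ y : V, (MvPolynomial.X i : Poly k r) ^ (p - 1) ∈ compl (polyGr k r) y.1 := fun y =>
    pow_mem (S := compl (polyGr k r) y.1) y.2.2 _
  have hs' : ∀ y : U, LocalizedModule.map (compl (polyGr k r) y.1) (thetaLin (gen e) Q ^ b)
      ((germs (𝒜 := polyGr k r) (𝓝 := tensorGr k r Q.V) s).1 y) = 0 := fun y =>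
    congr(($hs : sections (polyGr k r) (tensorGr k r Q.V) t'' U).1 y)
  obtain ⟨s', h1⟩ := exists_section_div (polyGr k r) (tensorGr k r Q.V)
    ((trivBundle (k := k) r Q.V t').presheaf.map ι.op s) _ (p - 1)
    ((MvPolynomial.mem_homogeneousSubmodule _ _).2 (MvPolynomial.isHomogeneous_X_pow i (p - 1)))
    hV (t' - (p - 1 : ℕ)) (by ring)
  refine ⟨V, ι, ⟨hx, hi⟩, (tildeMap (polyGr k r) (tensorGr k r Q.V) (tensorGr k r Q.V) G (b - 1) hG
    (t' - (p - 1 : ℕ)) t (by omega)).app V s', ?_⟩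
  refine germs_ext (polyGr k r) (tensorGr k r Q.V) fun y => ?_
  change LocalizedModule.map (compl (polyGr k r) y.1) (thetaLin (gen e) Q ^ a)
    (LocalizedModule.map (compl (polyGr k r) y.1) G ((germs s').1 y)) = _
  rw [h1 y]
  refine (congrArg _ (map_smul _ _ _)).trans ((map_smul _ _ _).trans ?_)
  exact localized_div _ (hV y) _ _ G H hGH _ (hs' ⟨y.1, ι.le y.2⟩)

end Exactness

end ElemAb

namespace AlgebraicGeometry.Scheme.Modules

variable {X : Scheme.{u}} {F G : X.Modules}

theorem app_congr {f f' : F ⟶ G} (h : f = f') (U : X.Opens) (s : Γ(F, U)) :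
    f.app U s = f'.app U s := by rw [h]

end AlgebraicGeometry.Scheme.Modules

namespace ElemAb

open GradedTilde Scheme.Modules

attribute [local instance] MvPolynomial.gradedAlgebra

section TrivMap

variable {k : Type u} [Field k] (r : ℕ) {M N K : Type u} [AddCommGroup M] [Module k M]
  [AddCommGroup N] [Module k N] [AddCommGroup K] [Module k K]

theorem trivMap_comp (f : M →ₗ[k] N) (g : N →ₗ[k] K) (t : ℤ) :
    trivMap r f t ≫ trivMap r g t = trivMap r (g ∘ₗ f) t :=
  tildeMap_comp _ _ _ _ _ _ _ _ _ _ _ _ _ _ _ _ _ _ _ (LinearMap.baseChange_comp _ _).symm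

theorem trivMap_add (f f' : M →ₗ[k] N) (t : ℤ) :
    trivMap r (f + f') t = trivMap r f t + trivMap r f' t :=
  tildeMap_add _ _ _ _ _ _ _ _ _ _ (LinearMap.baseChange_add _ _) _ _ _

theorem trivMap_id (t : ℤ) : trivMap r (LinearMap.id : M →ₗ[k] M) t = 𝟙 _ :=
  tildeMap_id _ _ _ _ _ _ LinearMap.baseChange_id

theorem trivMap_zero (t : ℤ) : trivMap r (0 : M →ₗ[k] N) t = 0 :=
  tildeMap_zero _ _ _ _ _ _ _ _ _ LinearMap.baseChange_zero

end TrivMap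

/-! ### Classes in ℱ₁ of sections and of generalized elements -/

section Classes

variable {k : Type u} [Field k] {r : ℕ} {E : Type u} [Group E] (g : Fin r → E)

theorem repMap_thetaPow {M N : Rep.{u} k E} (f : M ⟶ N) (e : ℕ) (t t' : ℤ) (h : t' = t + e) :
    repMap r f t ≫ thetaPow g N e t t' h = thetaPow g M e t t' h ≫ repMap r f t' := by
  have hlin1 : thetaLin g N ∘ₗ f.hom.toLinearMap.baseChange (Poly k r) =
      f.hom.toLinearMap.baseChange (Poly k r) ∘ₗ thetaLin g M := by
    ext m
    simp [thetaLin_tmul, xAct, Rep.hom_comm_apply, TensorProduct.tmul_sub]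
  have hlin : (thetaLin g N ^ e) ∘ₗ f.hom.toLinearMap.baseChange (Poly k r) =
      f.hom.toLinearMap.baseChange (Poly k r) ∘ₗ (thetaLin g M ^ e) := by
    induction e generalizing t' with
    | zero => rfl
    | succ e ih =>
      rw [pow_succ', pow_succ', Module.End.mul_eq_comp, Module.End.mul_eq_comp,
        LinearMap.comp_assoc, ih _ rfl, ← LinearMap.comp_assoc, hlin1, LinearMap.comp_assoc]
  have hdeg : ∀ j, ∀ n ∈ tensorGr k r M.V j,
      (f.hom.toLinearMap.baseChange (Poly k r) ∘ₗ (thetaLin g M ^ e)) n ∈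
        tensorGr k r N.V (j + e) := fun j n hn =>
    baseChange_mem f.hom.toLinearMap _ _ (thetaLin_pow_mem g M e j n hn)
  exact (tildeMap_comp _ _ _ _ _ _ _ _ _ _ _ e hdeg _ _ _ _ _ h hlin).trans
    (tildeMap_comp _ _ _ _ _ _ _ _ _ _ _ e hdeg _ _ _ _ _ h rfl).symm

theorem thetaPow_repMap_assoc {M N : Rep.{u} k E} (f : M ⟶ N) (e : ℕ) (t t' : ℤ) (h : t' = t + e)
    {Z : (PSpace k r).Modules} (z : trivBundle r N.V t' ⟶ Z) :
    thetaPow g M e t t' h ≫ repMap r f t' ≫ z = repMap r f t ≫ thetaPow g N e t t' h ≫ z := by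
  rw [← Category.assoc, ← repMap_thetaPow, Category.assoc]

variable {g} {M N : Rep.{u} k E} {t : ℤ}

instance : Mono (interIncl g M t) := by
  unfold interIncl
  infer_instance

/-- A vanishing class means factorization through Ker θ ∩ Im θ; lifting from Im θ to the source of θ
is possible after an epi onto A. Such refinements play the role of passing to smaller open sets. -/
theorem comp_cls_eq_zero_iff {A : (PSpace k r).Modules}
    (x : A ⟶ kernel (theta g M t (t + 1) rfl)) (t₀ : ℤ) (h : t = t₀ + 1) :
    x ≫ cokernel.π (interIncl g M t) = 0 ↔
      ∃ (A' : (PSpace k r).Modules) (e : A' ⟶ A) (_ : Epi e) (ν : A' ⟶ trivBundle r M.V t₀),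
        e ≫ x ≫ kernel.ι (theta g M t (t + 1) rfl) = ν ≫ theta g M t₀ t h := by
  obtain rfl : t₀ = t - 1 := by omega
  constructor
  · intro hx
    let y : A ⟶ _ := (ShortComplex.exact_cokernel (interIncl g M t)).lift x hx
    have hy : y ≫ interIncl g M t = x := (ShortComplex.exact_cokernel (interIncl g M t)).lift_f x hx
    obtain ⟨A', e, he, ν, hν⟩ := surjective_up_to_refinements_of_epi
      (factorThruImage (theta g M (t - 1) t h)) (y ≫ pullback.snd _ _)
    refine ⟨A', e, he, ν, ?_⟩
    have hfac : (ν ≫ factorThruImage (theta g M (t - 1) t h)) ≫ image.ι (theta g M (t - 1) t h) =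
        ν ≫ theta g M (t - 1) t h := by rw [Category.assoc, image.fac]
    rw [← hy, Category.assoc, interIncl, pullback.condition, ← hfac, ← hν]
    simp only [Category.assoc]
  · rintro ⟨A', e, he, ν, hν⟩
    rw [← cancel_epi e, comp_zero]
    have h1 : (e ≫ x) ≫ kernel.ι (theta g M t (t + 1) rfl) =
        (ν ≫ factorThruImage (theta g M (t - 1) t h)) ≫ image.ι (theta g M (t - 1) t h) := by
      rw [Category.assoc, Category.assoc, image.fac, hν]
    have h2 : e ≫ x = pullback.lift _ _ h1 ≫ interIncl g M t := (pullback.lift_fst _ _ h1).symm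
    rw [← Category.assoc, h2, Category.assoc, cokernel.condition, comp_zero]

variable {U : (PSpace k r).Opens}

theorem IsClass.unique {μ : Γ(trivBundle (k := k) r M.V t, U)} {ξ ξ' : Γ(F1 g M t, U)}
    (h : IsClass g M t μ ξ) (h' : IsClass g M t μ ξ') : ξ = ξ' := by
  obtain ⟨κ, h1, rfl⟩ := h
  obtain ⟨κ', h1', rfl⟩ := h'
  rw [app_injective (kernel.ι (theta g M t (t + 1) rfl)) U (h1.trans h1'.symm)]

theorem IsClass.add {μ μ' : Γ(trivBundle (k := k) r M.V t, U)} {ξ ξ' : Γ(F1 g M t, U)}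
    (h : IsClass g M t μ ξ) (h' : IsClass g M t μ' ξ') : IsClass g M t (μ + μ') (ξ + ξ') := by
  obtain ⟨κ, rfl, rfl⟩ := h
  obtain ⟨κ', rfl, rfl⟩ := h'
  exact ⟨κ + κ', map_add _ _ _, map_add _ _ _⟩

theorem isClass_app {A : (PSpace k r).Modules} (x : A ⟶ kernel (theta g M t (t + 1) rfl))
    (s : Γ(A, U)) :
    IsClass g M t ((x ≫ kernel.ι (theta g M t (t + 1) rfl)).app U s)
      ((x ≫ cokernel.π (interIncl g M t)).app U s) :=
  ⟨x.app U s, rfl, rfl⟩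

/-- The universal case is the kernel of the composite θ θ, on which θ is a generalized element of
Ker θ that visibly factors through Im θ. -/
theorem isClass_theta (t₀ : ℤ) (h : t = t₀ + 1) (m : Γ(trivBundle (k := k) r M.V t₀, U))
    (hm : (theta g M t (t + 1) rfl).app U ((theta g M t₀ t h).app U m) = 0) :
    IsClass g M t ((theta g M t₀ t h).app U m) 0 := by
  let f := theta g M t₀ t h ≫ theta g M t (t + 1) rfl
  obtain ⟨m', rfl⟩ := exists_kernel_section f U m hm
  let x : kernel f ⟶ kernel (theta g M t (t + 1) rfl) :=
    kernel.lift _ (kernel.ι f ≫ theta g M t₀ t h)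
      ((Category.assoc _ _ _).trans (kernel.condition f))
  have hx : x ≫ kernel.ι (theta g M t (t + 1) rfl) = kernel.ι f ≫ theta g M t₀ t h :=
    kernel.lift_ι _ _ _
  have hx0 : x ≫ cokernel.π (interIncl g M t) = 0 :=
    (comp_cls_eq_zero_iff x t₀ h).2 ⟨_, 𝟙 _, inferInstance, kernel.ι f, by
      rw [Category.id_comp, hx]⟩
  have := isClass_app x m'
  rwa [hx, hx0] at this

theorem IsClass.theta_eq_zero {μ : Γ(trivBundle (k := k) r M.V t, U)} {ξ : Γ(F1 g M t, U)}
    (h : IsClass g M t μ ξ) : (theta g M t (t + 1) rfl).app U μ = 0 := by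
  obtain ⟨κ, rfl, rfl⟩ := h
  exact app_congr (kernel.condition (theta g M t (t + 1) rfl)) U κ

theorem IsClass.map {μ : Γ(trivBundle (k := k) r M.V t, U)} {ξ : Γ(F1 g M t, U)}
    (h : IsClass g M t μ ξ) (f : M ⟶ N) :
    IsClass g N t ((repMap r f t).app U μ) ((F1map g f t).app U ξ) := by
  obtain ⟨κ, rfl, rfl⟩ := h
  have h1 : kerMap g f t ≫ kernel.ι (theta g N t (t + 1) rfl) =
      kernel.ι (theta g M t (t + 1) rfl) ≫ repMap r f t := kernel.lift_ι _ _ _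
  have h2 : cokernel.π (interIncl g M t) ≫ F1map g f t =
      kerMap g f t ≫ cokernel.π (interIncl g N t) := cokernel.π_desc _ _ _
  exact ⟨(kerMap g f t).app U κ, app_congr h1 U κ, (app_congr h2 U κ).symm⟩

/-- The projection from Ker θ to ℱ₁ is epi, so classes of sections determine a morphism, although a
section of ℱ₁ over U need only locally be such a class. -/
theorem F1_hom_ext {t' : ℤ} {f f' : F1 g M t ⟶ F1 g N t'}
    (h : ∀ (U : (PSpace k r).Opens) (μ : Γ(trivBundle (k := k) r M.V t, U)) (ξ : Γ(F1 g M t, U)),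
      IsClass g M t μ ξ → f.app U ξ = f'.app U ξ) : f = f' := by
  have : Epi (cokernel.π (interIncl g M t)) := inferInstance
  refine (cancel_epi (cokernel.π (interIncl g M t))).1 (hom_ext _ _ fun U => ?_)
  ext κ
  exact h U _ _ ⟨κ, rfl, rfl⟩

end Classes

/-! ### k-linear splittings of the Heller sequences -/

section Splitting

variable {k : Type u} [Field k] (r : ℕ) {E : Type u} [Group E] (H : HellerShifts k E)

/-- A `k`-linear splitting of `0 → Ω^{a+1} k → Q_a → Ω^a k → 0`. -/
structure Splitting (a b : ℤ) (hb : b = a + 1) where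
  /-- The section of the projection. -/
  σ : (H.Ω a).V →ₗ[k] (H.Q a).V
  /-- The retraction of the inclusion. -/
  ρ : (H.Q a).V →ₗ[k] (H.Ω b).V
  π_σ : (H.π a).hom.toLinearMap ∘ₗ σ = LinearMap.id
  ρ_ι : ρ ∘ₗ (H.ι a b hb).hom.toLinearMap = LinearMap.id
  decomp : (H.ι a b hb).hom.toLinearMap ∘ₗ ρ + σ ∘ₗ (H.π a).hom.toLinearMap = LinearMap.id
  π_ι : (H.π a).hom.toLinearMap ∘ₗ (H.ι a b hb).hom.toLinearMap = 0

/-- The choice of a splitting. -/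
def splitting (a b : ℤ) (hb : b = a + 1) : Splitting H a b hb := by
  let ι' := (H.ι a b hb).hom.toLinearMap
  let π' := (H.π a).hom.toLinearMap
  have hι : Function.Injective ι' := H.ι_injective a b hb
  have hπ : Function.Surjective π' := H.π_surjective a
  have hex : Function.Exact ι' π' := H.exact a b hb
  let σ := (π'.exists_rightInverse_of_surjective (LinearMap.range_eq_top.2 hπ)).choose
  have hσ : π' ∘ₗ σ = LinearMap.id :=
    (π'.exists_rightInverse_of_surjective (LinearMap.range_eq_top.2 hπ)).choose_spec
  let ρ' := (ι'.exists_leftInverse_of_injective (LinearMap.ker_eq_bot.2 hι)).choose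
  have hρ : ρ' ∘ₗ ι' = LinearMap.id :=
    (ι'.exists_leftInverse_of_injective (LinearMap.ker_eq_bot.2 hι)).choose_spec
  have h0 : ∀ x, π' (ι' x) = 0 := hex.apply_apply_eq_zero
  have hσ' : ∀ x, π' (σ x) = x := LinearMap.congr_fun hσ
  have hρ' : ∀ x, ρ' (ι' x) = x := LinearMap.congr_fun hρ
  -- An arbitrary retraction ρ' is corrected to vanish on the image of σ; this is what yields
  -- `decomp`.
  refine ⟨σ, ρ' ∘ₗ (LinearMap.id - σ ∘ₗ π'), hσ, ?_, ?_, LinearMap.ext h0⟩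
  · refine LinearMap.ext fun x => ?_
    change ρ' (ι' x - σ (π' (ι' x))) = x
    rw [h0, map_zero, sub_zero, hρ']
  · refine LinearMap.ext fun x => ?_
    change ι' (ρ' (x - σ (π' x))) + σ (π' x) = x
    obtain ⟨y, hy⟩ := (hex (x - σ (π' x))).1 (by rw [map_sub, hσ', sub_self])
    rw [← hy, hρ', hy, sub_add_cancel]

variable {H} {a b : ℤ} {hb : b = a + 1}

theorem Splitting.σ_π (S : Splitting H a b hb) (t : ℤ) : trivMap r S.σ t ≫ repMap r (H.π a) t = 𝟙 _ := by
  rw [repMap, trivMap_comp, S.π_σ, trivMap_id]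

theorem Splitting.ι_ρ (S : Splitting H a b hb) (t : ℤ) : repMap r (H.ι a b hb) t ≫ trivMap r S.ρ t = 𝟙 _ := by
  rw [repMap, trivMap_comp, S.ρ_ι, trivMap_id]

theorem Splitting.ι_π (S : Splitting H a b hb) (t : ℤ) : repMap r (H.ι a b hb) t ≫ repMap r (H.π a) t = 0 := by
  rw [repMap, repMap, trivMap_comp, S.π_ι, trivMap_zero]

theorem Splitting.ρ_ι_eq (S : Splitting H a b hb) (t : ℤ) : trivMap r S.ρ t ≫ repMap r (H.ι a b hb) t =
    𝟙 _ - repMap r (H.π a) t ≫ trivMap r S.σ t := by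
  rw [repMap, repMap, trivMap_comp, trivMap_comp, eq_sub_iff_add_eq, ← trivMap_add, S.decomp,
    trivMap_id]

variable (H) (a b hb) in
theorem mono_repMap_ι (t : ℤ) : Mono (repMap r (H.ι a b hb) t) :=
  mono_of_mono_fac ((splitting H a b hb).ι_ρ r t)

variable (H) (a b hb) in
theorem repMap_ι_π (t : ℤ) : repMap r (H.ι a b hb) t ≫ repMap r (H.π a) t = 0 :=
  (splitting H a b hb).ι_π r t

variable (H) (a b hb) in
-- The splitting is k-linear but not compatible with θ. That is enough to lift generalized elements
-- and sections without refining their source.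
theorem exists_comp_repMap_ι {A : (PSpace k r).Modules} {t : ℤ}
    (x : A ⟶ trivBundle r (H.Q a).V t) (h : x ≫ repMap r (H.π a) t = 0) :
    ∃ m, m ≫ repMap r (H.ι a b hb) t = x :=
  ⟨x ≫ trivMap r (splitting H a b hb).ρ t, by
    rw [Category.assoc, Splitting.ρ_ι_eq, Preadditive.comp_sub, ← Category.assoc, h, zero_comp,
      sub_zero, Category.comp_id]⟩

variable (H) (a) in
theorem exists_comp_repMap_π {A : (PSpace k r).Modules} {t : ℤ}
    (m : A ⟶ trivBundle r (H.Ω a).V t) : ∃ x, x ≫ repMap r (H.π a) t = m :=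
  ⟨m ≫ trivMap r (splitting H a (a + 1) rfl).σ t, by
    rw [Category.assoc, Splitting.σ_π, Category.comp_id]⟩

variable (H) (a b hb) in
theorem exists_app_repMap_ι {U : (PSpace k r).Opens} {t : ℤ}
    (x : Γ(trivBundle r (H.Q a).V t, U)) (h : (repMap r (H.π a) t).app U x = 0) :
    ∃ m, (repMap r (H.ι a b hb) t).app U m = x := by
  refine ⟨(trivMap r (splitting H a b hb).ρ t).app U x, ?_⟩
  have h1 := app_congr ((splitting H a b hb).ρ_ι_eq r t) U x
  have h2 : (𝟙 (trivBundle r (H.Q a).V t) -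
      repMap r (H.π a) t ≫ trivMap r (splitting H a b hb).σ t).app U x =
      x - (trivMap r (splitting H a b hb).σ t).app U ((repMap r (H.π a) t).app U x) := rfl
  rw [h2, h, map_zero, sub_zero] at h1
  exact h1

variable (H) (a) in
theorem exists_app_repMap_π {U : (PSpace k r).Opens} {t : ℤ}
    (m : Γ(trivBundle r (H.Ω a).V t, U)) : ∃ x, (repMap r (H.π a) t).app U x = m :=
  ⟨(trivMap r (splitting H a (a + 1) rfl).σ t).app U m,
    app_congr ((splitting H a (a + 1) rfl).σ_π r t) U m⟩

end Splitting

end ElemAb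

/-! ### Switchback isomorphisms -/

namespace ElemAb

open GradedTilde Scheme.Modules

attribute [local instance] MvPolynomial.gradedAlgebra

/-- The forward direction of `h`, applied to `i`, makes `y` descend to the cokernels; the converse
makes the descended map mono, and `h'` makes it epi. -/
theorem exists_iso_cokernel {C : Type*} [Category C] [Abelian C] {I K I' K' : C} (i : I ⟶ K)
    (i' : I' ⟶ K') (y : K ⟶ K')
    (h : ∀ (A : C) (x : A ⟶ K), x ≫ cokernel.π i = 0 ↔ (x ≫ y) ≫ cokernel.π i' = 0)
    (h' : ∀ (A : C) (z : A ⟶ K'), ∃ (A' : C) (e : A' ⟶ A) (_ : Epi e) (x : A' ⟶ K),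
      (x ≫ y) ≫ cokernel.π i' = (e ≫ z) ≫ cokernel.π i') :
    ∃ Sw : cokernel i ≅ cokernel i', cokernel.π i ≫ Sw.hom = y ≫ cokernel.π i' := by
  have h0 : i ≫ y ≫ cokernel.π i' = 0 := by
    rw [← Category.assoc]
    exact (h _ i).1 (cokernel.condition i)
  let f := cokernel.desc i (y ≫ cokernel.π i') h0
  have hf : cokernel.π i ≫ f = y ≫ cokernel.π i' := cokernel.π_desc _ _ _
  have hmono : Mono f := by
    refine Preadditive.mono_of_cancel_zero _ fun {A} x hx => ?_
    obtain ⟨A', e, he, x', hx'⟩ := surjective_up_to_refinements_of_epi (cokernel.π i) x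
    have h1 : (x' ≫ y) ≫ cokernel.π i' = 0 := by
      rw [Category.assoc, ← hf, ← Category.assoc, ← hx', Category.assoc, hx, comp_zero]
    rw [← cancel_epi e, hx', (h _ x').2 h1, comp_zero]
  have hepi : Epi f := by
    rw [epi_iff_surjective_up_to_refinements]
    intro A z
    obtain ⟨A', e, he, z', hz'⟩ := surjective_up_to_refinements_of_epi (cokernel.π i') z
    obtain ⟨A'', e', he', x, hx⟩ := h' _ z'
    refine ⟨A'', e' ≫ e, inferInstance, x ≫ cokernel.π i, ?_⟩
    rw [Category.assoc, Category.assoc, hf, ← Category.assoc x, hx, hz', Category.assoc]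
  have := isIso_of_mono_of_epi f
  exact ⟨asIso f, hf⟩

/-- Adding θ m keeps the class only if the result stays in Ker θ; `h0` has to be assumed because θ ^
2 need not vanish. -/
theorem IsClass.of_sub_eq_theta {k : Type u} [Field k] {r : ℕ} {E : Type u} [Group E]
    {g : Fin r → E} {M : Rep.{u} k E} {t : ℤ} {U : (PSpace k r).Opens}
    {μ μ' : Γ(trivBundle (k := k) r M.V t, U)} {ξ : Γ(F1 g M t, U)} (h : IsClass g M t μ ξ)
    (t₀ : ℤ) (ht : t = t₀ + 1) (m : Γ(trivBundle (k := k) r M.V t₀, U))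
    (hm : μ' - μ = (theta g M t₀ t ht).app U m)
    (h0 : (theta g M t (t + 1) rfl).app U μ' = 0) : IsClass g M t μ' ξ := by
  have h1 := h.add (isClass_theta t₀ ht m (by
    rw [← hm, map_sub, h0, h.theta_eq_zero, sub_zero]))
  rwa [← hm, add_sub_cancel, add_zero] at h1

theorem repMap_comp {k : Type u} [Field k] (r : ℕ) {E : Type u} [Group E] {M N K : Rep.{u} k E}
    (f : M ⟶ N) (g : N ⟶ K) (t : ℤ) :
    repMap r (f ≫ g) t = repMap r f t ≫ repMap r g t := by
  rw [repMap, repMap, repMap, trivMap_comp]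
  rfl

variable {k : Type u} [Field k] {p r : ℕ} [Fact p.Prime] [CharP k p] {E : Type u} [CommGroup E]
  [Fintype E] (e : E ≃* Multiplicative (Fin r → ZMod p)) (H : HellerShifts k E)

instance (a : ℤ) : Projective (H.Q a) := H.projective a

/-- A generalized element of `Q` killed by `θ ^ b` lies locally in the image of `θ ^ a`,
`a + b = p`. -/
theorem exists_refinement_theta (Q : Rep.{u} k E) [Projective Q] (a b : ℕ) (hab : a + b = p)
    (hb : 1 ≤ b) (t t' t'' : ℤ) (h : t' = t + a) (h' : t'' = t' + b) {A : (PSpace k r).Modules}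
    (x : A ⟶ trivBundle r Q.V t') (hx : x ≫ thetaPow (gen e) Q b t' t'' h' = 0) :
    ∃ (A' : (PSpace k r).Modules) (ε : A' ⟶ A) (_ : Epi ε) (y : A' ⟶ trivBundle r Q.V t),
      ε ≫ x = y ≫ thetaPow (gen e) Q a t t' h :=
  (thetaPow_exact e Q a b hab hb t t' t'' h h').exact_up_to_refinements x hx

/-! ### The switch for odd `p` -/

section Odd

variable {e H} {a b c : ℤ} {hb : b = a + 1} {hc : c = b + 1} {t t₁ t₂ : ℤ}
  {ht₁ : t₁ = t + (p - 1 : ℕ)} {ht₂ : t₂ = t₁ + 1} {A : (PSpace k r).Modules}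

omit [Fintype E] in
theorem theta_theta_pow (M : Rep.{u} k E) (m n : ℕ) (hmn : m + n = p) (t t' t'' : ℤ)
    (h : t' = t + m) (h' : t'' = t' + n) {A : (PSpace k r).Modules} (x : A ⟶ trivBundle r M.V t) :
    x ≫ thetaPow (gen e) M m t t' h ≫ thetaPow (gen e) M n t' t'' h' = 0 := by
  rw [thetaPow_zero_of_add_eq e M m n hmn, comp_zero]

/-- The relations between a lift `u` of an element of `Ker θ`, a lift `v` of `θ ^ (p - 1) u` and
`y = θ v`. -/
structure OddRel (e : E ≃* Multiplicative (Fin r → ZMod p)) (H : HellerShifts k E) {a b c : ℤ}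
    (hb : b = a + 1) (hc : c = b + 1) {t t₁ t₂ : ℤ} (ht₁ : t₁ = t + (p - 1 : ℕ))
    (ht₂ : t₂ = t₁ + 1) (u : A ⟶ trivBundle r (H.Q a).V t) (v : A ⟶ trivBundle r (H.Q b).V t₁)
    (y : A ⟶ trivBundle r (H.Ω c).V t₂) : Prop where
  lift : v ≫ repMap r (H.π b) t₁ ≫ repMap r (H.ι a b hb) t₁ =
    u ≫ thetaPow (gen e) (H.Q a) (p - 1) t t₁ ht₁
  eq : y ≫ repMap r (H.ι b c hc) t₂ = v ≫ theta (gen e) (H.Q b) t₁ t₂ ht₂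

theorem one_add_pred_prime : 1 + (p - 1) = p :=
  Nat.add_sub_cancel' (Fact.out : p.Prime).one_le

omit [CharP k p] [Fintype E] in
theorem OddRel.comp {u : A ⟶ trivBundle r (H.Q a).V t} {v : A ⟶ trivBundle r (H.Q b).V t₁}
    {y : A ⟶ trivBundle r (H.Ω c).V t₂} (h : OddRel e H hb hc ht₁ ht₂ u v y)
    {A' : (PSpace k r).Modules} (ε : A' ⟶ A) :
    OddRel e H hb hc ht₁ ht₂ (ε ≫ u) (ε ≫ v) (ε ≫ y) :=
  ⟨by rw [Category.assoc, Category.assoc, h.lift], by rw [Category.assoc, Category.assoc, h.eq]⟩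

omit [CharP k p] [Fintype E] in
theorem OddRel.sub {u u' : A ⟶ trivBundle r (H.Q a).V t} {v v' : A ⟶ trivBundle r (H.Q b).V t₁}
    {y y' : A ⟶ trivBundle r (H.Ω c).V t₂} (h : OddRel e H hb hc ht₁ ht₂ u v y)
    (h' : OddRel e H hb hc ht₁ ht₂ u' v' y') :
    OddRel e H hb hc ht₁ ht₂ (u - u') (v - v') (y - y') :=
  ⟨by rw [Preadditive.sub_comp, Preadditive.sub_comp, h.lift, h'.lift],
    by rw [Preadditive.sub_comp, Preadditive.sub_comp, h.eq, h'.eq]⟩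

omit [Fintype E] in
-- This makes the switch well defined. Subtracting θ of a lift of ν from u leaves ι m, and θ ^ (p -
-- 1) θ = 0 yields π v = θ ^ (p - 1) m. Repeating the argument in Q_b with a lift of m puts y in the
-- image of θ.
theorem OddRel.exists_theta {u : A ⟶ trivBundle r (H.Q a).V t}
    {v : A ⟶ trivBundle r (H.Q b).V t₁} {y : A ⟶ trivBundle r (H.Ω c).V t₂}
    (h : OddRel e H hb hc ht₁ ht₂ u v y) {t₀ : ℤ} (ht₀ : t = t₀ + 1)
    (ν : A ⟶ trivBundle r (H.Ω a).V t₀)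
    (hν : u ≫ repMap r (H.π a) t = ν ≫ theta (gen e) (H.Ω a) t₀ t ht₀) :
    ∃ m : A ⟶ trivBundle r (H.Ω c).V t₁, y = m ≫ theta (gen e) (H.Ω c) t₁ t₂ ht₂ := by
  obtain ⟨n, rfl⟩ := exists_comp_repMap_π r H a ν
  obtain ⟨m, hm⟩ := exists_comp_repMap_ι r H a b hb (u - n ≫ theta (gen e) (H.Q a) t₀ t ht₀) (by
    rw [Preadditive.sub_comp, hν, Category.assoc, Category.assoc, repMap_thetaPow, sub_self])
  have hv : v ≫ repMap r (H.π b) t₁ = m ≫ thetaPow (gen e) (H.Ω b) (p - 1) t t₁ ht₁ := by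
    have := mono_repMap_ι r H a b hb t₁
    rw [← cancel_mono (repMap r (H.ι a b hb) t₁), Category.assoc, Category.assoc, h.lift,
      ← repMap_thetaPow, ← Category.assoc m, hm, Preadditive.sub_comp, Category.assoc,
      theta_theta_pow (H.Q a) 1 (p - 1) one_add_pred_prime, sub_zero]
  obtain ⟨w, rfl⟩ := exists_comp_repMap_π r H b m
  obtain ⟨m', hm'⟩ := exists_comp_repMap_ι r H b c hc
    (v - w ≫ thetaPow (gen e) (H.Q b) (p - 1) t t₁ ht₁) (by
      rw [Preadditive.sub_comp, hv, Category.assoc, Category.assoc, repMap_thetaPow, sub_self])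
  refine ⟨m', ?_⟩
  have := mono_repMap_ι r H b c hc t₂
  rw [← cancel_mono (repMap r (H.ι b c hc) t₂), h.eq, Category.assoc, ← repMap_thetaPow,
    ← Category.assoc, hm', Preadditive.sub_comp, Category.assoc,
    theta_theta_pow (H.Q b) (p - 1) 1 (by rw [add_comm, one_add_pred_prime]), sub_zero]

/-- Injectivity of the switch comes from exactness on two projectives. First, v - ι m is killed by
θ, hence locally θ ^ (p - 1) q. Then u - ι π q is killed by θ ^ (p - 1), hence locally θ q', and π u
= θ π q'. -/
theorem OddRel.exists_theta_symm {u : A ⟶ trivBundle r (H.Q a).V t}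
    {v : A ⟶ trivBundle r (H.Q b).V t₁} {y : A ⟶ trivBundle r (H.Ω c).V t₂}
    (h : OddRel e H hb hc ht₁ ht₂ u v y) {t₀ : ℤ} (ht₀ : t = t₀ + 1)
    (m : A ⟶ trivBundle r (H.Ω c).V t₁) (hm : y = m ≫ theta (gen e) (H.Ω c) t₁ t₂ ht₂) :
    ∃ (A' : (PSpace k r).Modules) (ε : A' ⟶ A) (_ : Epi ε) (ν : A' ⟶ trivBundle r (H.Ω a).V t₀),
      ε ≫ u ≫ repMap r (H.π a) t = ν ≫ theta (gen e) (H.Ω a) t₀ t ht₀ := by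
  have hp := (Fact.out : p.Prime).two_le
  obtain ⟨A', ε, hε, q, hq⟩ := exists_refinement_theta e (H.Q b) (p - 1) 1
    (by rw [add_comm, one_add_pred_prime]) le_rfl t t₁ t₂ ht₁ ht₂
    (v - m ≫ repMap r (H.ι b c hc) t₁) (by
      rw [Preadditive.sub_comp, ← h.eq, Category.assoc, repMap_thetaPow, ← Category.assoc m, ← hm,
        sub_self])
  have h1 : ε ≫ v ≫ repMap r (H.π b) t₁ =
      q ≫ repMap r (H.π b) t ≫ thetaPow (gen e) (H.Ω b) (p - 1) t t₁ ht₁ := by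
    have := congr($hq ≫ repMap r (H.π b) t₁)
    simpa only [Category.assoc, Preadditive.sub_comp, Preadditive.comp_sub, repMap_ι_π, comp_zero,
      sub_zero, ← repMap_thetaPow] using this
  obtain ⟨A'', ε', hε', q', hq'⟩ := exists_refinement_theta e (H.Q a) 1 (p - 1)
    one_add_pred_prime (by omega) t₀ t t₁ ht₀ ht₁
    (ε ≫ u - q ≫ repMap r (H.π b) t ≫ repMap r (H.ι a b hb) t) (by
      have h2 := congr($h1 ≫ repMap r (H.ι a b hb) t₁)
      simp only [Category.assoc, h.lift, ← repMap_thetaPow] at h2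
      simp only [Preadditive.sub_comp, Category.assoc, h2, sub_self])
  refine ⟨A'', ε' ≫ ε, inferInstance, q' ≫ repMap r (H.π a) t₀, ?_⟩
  have := congr($hq' ≫ repMap r (H.π a) t)
  simpa only [Category.assoc, Preadditive.sub_comp, Preadditive.comp_sub, repMap_ι_π, comp_zero,
    sub_zero, ← repMap_thetaPow] using this

/-- Surjectivity of the switch: locally ι y = θ ^ (p - 1) q, so ι π q is killed by θ ^ (p - 1) and
locally equals θ u. Then v = θ ^ (p - 2) q completes the chain. -/
theorem exists_oddRel (hb : b = a + 1) (hc : c = b + 1) (ht₁ : t₁ = t + (p - 1 : ℕ))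
    (ht₂ : t₂ = t₁ + 1) (y : A ⟶ trivBundle r (H.Ω c).V t₂)
    (hy : y ≫ theta (gen e) (H.Ω c) t₂ (t₂ + 1) rfl = 0) :
    ∃ (A' : (PSpace k r).Modules) (ε : A' ⟶ A) (_ : Epi ε) (u : A' ⟶ trivBundle r (H.Q a).V t)
      (v : A' ⟶ trivBundle r (H.Q b).V t₁), OddRel e H hb hc ht₁ ht₂ u v (ε ≫ y) ∧
        (u ≫ repMap r (H.π a) t) ≫ theta (gen e) (H.Ω a) t (t + 1) rfl = 0 := by
  have hp := (Fact.out : p.Prime).two_le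
  obtain ⟨A', ε, hε, q, hq⟩ := exists_refinement_theta e (H.Q b) (p - 1) 1
    (by rw [add_comm, one_add_pred_prime]) le_rfl (t + 1) t₂ (t₂ + 1) (by omega) rfl
    (y ≫ repMap r (H.ι b c hc) t₂) (by
      rw [Category.assoc, repMap_thetaPow, ← Category.assoc, hy, zero_comp])
  obtain ⟨A'', ε', hε', u, hu⟩ := exists_refinement_theta e (H.Q a) 1 (p - 1)
    one_add_pred_prime (by omega) t (t + 1) t₂ rfl (by omega)
    (q ≫ repMap r (H.π b) _ ≫ repMap r (H.ι a b hb) _) (by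
      have h1 := congr($hq ≫ repMap r (H.π b) _ ≫ repMap r (H.ι a b hb) _)
      simp only [Category.assoc, thetaPow_repMap_assoc] at h1
      simp only [Category.assoc, repMap_thetaPow]
      rw [← h1, ← Category.assoc (repMap r (H.ι b c hc) _), repMap_ι_π, zero_comp, comp_zero,
        comp_zero])
  refine ⟨A'', ε' ≫ ε, inferInstance, u,
    ε' ≫ q ≫ thetaPow (gen e) (H.Q b) (p - 2) (t + 1) t₁ (by omega), ⟨?_, ?_⟩, ?_⟩
  · rw [← thetaPow_comp (gen e) (H.Q a) 1 (p - 2) (p - 1) (by omega) t (t + 1) t₁ rfl (by omega) ht₁,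
      ← Category.assoc u, ← hu]
    simp only [Category.assoc, repMap_thetaPow, thetaPow_repMap_assoc]
  · simp only [Category.assoc]
    rw [hq, thetaPow_comp (gen e) (H.Q b) (p - 2) 1 (p - 1) (by omega)]
  · rw [Category.assoc, repMap_thetaPow, ← Category.assoc, ← hu]
    simp only [Category.assoc, repMap_ι_π, comp_zero]

omit [Fintype E] in
-- An arbitrary lift v of θ ^ (p - 1) u need not give y in Ker θ. With q a lift to Q_b of the
-- element of Ω^b given by θ u, the choice v = θ ^ (p - 2) q does, since θ ^ 2 v = θ ^ p q = 0.
theorem exists_oddRel_of_theta_eq_zero (hb : b = a + 1) (hc : c = b + 1)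
    (ht₁ : t₁ = t + (p - 1 : ℕ)) (ht₂ : t₂ = t₁ + 1) (μ : A ⟶ trivBundle r (H.Ω a).V t)
    (hμ : μ ≫ theta (gen e) (H.Ω a) t (t + 1) rfl = 0) :
    ∃ (u : A ⟶ trivBundle r (H.Q a).V t) (v : A ⟶ trivBundle r (H.Q b).V t₁)
      (y : A ⟶ trivBundle r (H.Ω c).V t₂), OddRel e H hb hc ht₁ ht₂ u v y ∧
        u ≫ repMap r (H.π a) t = μ ∧ y ≫ theta (gen e) (H.Ω c) t₂ (t₂ + 1) rfl = 0 := by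
  have hp := (Fact.out : p.Prime).two_le
  obtain ⟨u, rfl⟩ := exists_comp_repMap_π r H a μ
  obtain ⟨x, hx⟩ := exists_comp_repMap_ι r H a b hb (u ≫ theta (gen e) (H.Q a) t (t + 1) rfl) (by
    rw [Category.assoc, ← repMap_thetaPow, ← Category.assoc, hμ])
  obtain ⟨q, rfl⟩ := exists_comp_repMap_π r H b x
  have hv : (q ≫ thetaPow (gen e) (H.Q b) (p - 2) (t + 1) t₁ (by omega)) ≫
      repMap r (H.π b) t₁ ≫ repMap r (H.ι a b hb) t₁ =
      u ≫ thetaPow (gen e) (H.Q a) (p - 1) t t₁ ht₁ := by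
    rw [← thetaPow_comp (gen e) (H.Q a) 1 (p - 2) (p - 1) (by omega) t (t + 1) t₁ rfl (by omega) ht₁,
      ← Category.assoc u, ← hx]
    simp only [Category.assoc, repMap_thetaPow, thetaPow_repMap_assoc]
  obtain ⟨v, hv'⟩ : ∃ v, v = q ≫ thetaPow (gen e) (H.Q b) (p - 2) (t + 1) t₁ (by omega) := ⟨_, rfl⟩
  rw [← hv'] at hv
  obtain ⟨y, hy⟩ := exists_comp_repMap_ι r H b c hc (v ≫ theta (gen e) (H.Q b) t₁ t₂ ht₂) (by
    have := mono_repMap_ι r H a b hb t₂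
    have h1 := congr($hv ≫ theta (gen e) (H.Q a) t₁ t₂ ht₂)
    rw [Category.assoc u,
      theta_theta_pow (H.Q a) (p - 1) 1 (by rw [add_comm, one_add_pred_prime])] at h1
    rw [← cancel_mono (repMap r (H.ι a b hb) t₂), zero_comp, ← h1]
    simp only [Category.assoc, repMap_thetaPow, thetaPow_repMap_assoc])
  refine ⟨u, v, y, ⟨hv, hy⟩, rfl, ?_⟩
  have := mono_repMap_ι r H b c hc (t₂ + 1)
  rw [← cancel_mono (repMap r (H.ι b c hc) (t₂ + 1)), zero_comp, Category.assoc, ← repMap_thetaPow,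
    ← Category.assoc, hy, hv']
  simp only [Category.assoc]
  rw [thetaPow_comp (gen e) (H.Q b) 1 1 2 rfl t₁ t₂ (t₂ + 1) ht₂ rfl (by push_cast; omega),
    theta_theta_pow (H.Q b) (p - 2) 2 (by omega)]

/-- `Sw` is the switchback map `ℱ₁(Ω^a k)(t) ⟶ ℱ₁(Ω^{a+2} k)(t + p)`. -/
def IsOddSwitch (e : E ≃* Multiplicative (Fin r → ZMod p)) (H : HellerShifts k E) {a b c : ℤ}
    (hb : b = a + 1) (hc : c = b + 1) {t t₁ t₂ : ℤ} (ht₁ : t₁ = t + (p - 1 : ℕ))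
    (ht₂ : t₂ = t₁ + 1) (Sw : F1 (gen e) (H.Ω a) t ⟶ F1 (gen e) (H.Ω c) t₂) : Prop :=
  ∀ (U : (PSpace k r).Opens) (μ : Γ(trivBundle r (H.Ω a).V t, U)) (ξ : Γ(F1 (gen e) (H.Ω a) t, U))
    (u : Γ(trivBundle r (H.Q a).V t, U)) (v : Γ(trivBundle r (H.Q b).V t₁, U))
    (w : Γ(trivBundle r (H.Ω c).V t₂, U)),
    IsClass (gen e) (H.Ω a) t μ ξ →
    (repMap r (H.π a) t).app U u = μ →
    (repMap r (H.π b ≫ H.ι a b hb) t₁).app U v =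
      (thetaPow (gen e) (H.Q a) (p - 1) t t₁ ht₁).app U u →
    (repMap r (H.ι b c hc) t₂).app U w = (theta (gen e) (H.Q b) t₁ t₂ ht₂).app U v →
    (theta (gen e) (H.Ω c) t₂ (t₂ + 1) rfl).app U w = 0 →
    IsClass (gen e) (H.Ω c) t₂ w (Sw.app U ξ)

/-- The lifts are chosen once, over the universal element `kernel.ι` of Ker θ, and the induced map
on ℱ₁ is an isomorphism by the preceding lemmas. Any other chain of lifts of a section ends in the
same element modulo Im θ. -/
theorem exists_isOddSwitch (e : E ≃* Multiplicative (Fin r → ZMod p)) (H : HellerShifts k E)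
    {a b c : ℤ} (hb : b = a + 1) (hc : c = b + 1) {t t₁ t₂ : ℤ} (ht₁ : t₁ = t + (p - 1 : ℕ))
    (ht₂ : t₂ = t₁ + 1) :
    ∃ Sw : F1 (gen e) (H.Ω a) t ≅ F1 (gen e) (H.Ω c) t₂, IsOddSwitch e H hb hc ht₁ ht₂ Sw.hom := by
  obtain ⟨u, v, y, hrel, hu, hy⟩ := exists_oddRel_of_theta_eq_zero (e := e) (H := H) hb hc ht₁ ht₂
    (kernel.ι (theta (gen e) (H.Ω a) t (t + 1) rfl)) (kernel.condition _)
  obtain ⟨y', hy'⟩ : ∃ y' : kernel (theta (gen e) (H.Ω a) t (t + 1) rfl) ⟶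
      kernel (theta (gen e) (H.Ω c) t₂ (t₂ + 1) rfl), y' ≫ kernel.ι _ = y :=
    ⟨kernel.lift _ y hy, kernel.lift_ι _ _ _⟩
  obtain ⟨Sw, hSw⟩ := exists_iso_cokernel (interIncl (gen e) (H.Ω a) t)
    (interIncl (gen e) (H.Ω c) t₂) y' (by
      intro A x
      rw [comp_cls_eq_zero_iff x (t - 1) (by omega), comp_cls_eq_zero_iff (x ≫ y') t₁ ht₂]
      constructor
      · rintro ⟨A', ε, hε, ν, hν⟩
        obtain ⟨m, hm⟩ := (hrel.comp (ε ≫ x)).exists_theta (by omega) ν (by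
          rw [Category.assoc, hu, Category.assoc, hν])
        exact ⟨A', ε, hε, m, by rw [Category.assoc, hy', ← hm, Category.assoc]⟩
      · rintro ⟨A', ε, hε, m, hm⟩
        obtain ⟨A'', ε', hε', ν, hν⟩ := (hrel.comp (ε ≫ x)).exists_theta_symm
          (t₀ := t - 1) (by omega) m (by rw [← hm, Category.assoc, Category.assoc, hy'])
        refine ⟨A'', ε' ≫ ε, inferInstance, ν, ?_⟩
        rw [← hν, Category.assoc (ε ≫ x), hu]
        simp only [Category.assoc]) (by
      intro A z
      obtain ⟨A', ε, hε, u', v', hrel', hu'⟩ := exists_oddRel hb hc ht₁ ht₂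
        (z ≫ kernel.ι (theta (gen e) (H.Ω c) t₂ (t₂ + 1) rfl)) (by
          rw [Category.assoc, kernel.condition, comp_zero])
      obtain ⟨x, hx⟩ : ∃ x : A' ⟶ kernel (theta (gen e) (H.Ω a) t (t + 1) rfl),
          x ≫ kernel.ι _ = u' ≫ repMap r (H.π a) t := ⟨kernel.lift _ _ hu', kernel.lift_ι _ _ _⟩
      refine ⟨A', ε, hε, x, ?_⟩
      -- Both chains start from the same element of Ker θ, so their difference starts from 0 and
      -- ends in Im θ.
      obtain ⟨m, hm⟩ := ((hrel.comp x).sub hrel').exists_theta (t₀ := t - 1) (by omega) 0 (by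
        rw [Preadditive.sub_comp, Category.assoc, hu, hx, sub_self, zero_comp])
      rw [← sub_eq_zero, ← Preadditive.sub_comp, comp_cls_eq_zero_iff _ t₁ ht₂]
      exact ⟨A', 𝟙 _, inferInstance, m, by
        rw [Category.id_comp, Preadditive.sub_comp, Category.assoc, hy', Category.assoc, hm]⟩)
  refine ⟨Sw, ?_⟩
  rintro U μ ξ u₁ v₁ w₁ ⟨κ, rfl, rfl⟩ hu₁ hv₁ hw₁ hθ
  have hcls : IsClass (gen e) (H.Ω c) t₂ (y.app U κ)
      (Sw.hom.app U ((cokernel.π (interIncl (gen e) (H.Ω a) t)).app U κ)) :=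
    ⟨y'.app U κ, app_congr hy' U κ, (app_congr hSw U κ).symm⟩
  have hu₂ := app_congr hu U κ
  have hv₂ := app_congr hrel.lift U κ
  have hw₂ := app_congr hrel.eq U κ
  rw [repMap_comp] at hv₁
  simp only [Hom.comp_app, AddCommGrpCat.comp_apply] at hu₂ hv₁ hv₂ hw₂
  obtain ⟨n, hn⟩ := exists_app_repMap_ι r H a b hb (u₁ - u.app U κ) (by
    rw [map_sub, hu₁, hu₂, sub_self])
  have h1 : (repMap r (H.π b) t₁).app U (v₁ - v.app U κ) =
      (thetaPow (gen e) (H.Ω b) (p - 1) t t₁ ht₁).app U n := by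
    have := mono_repMap_ι r H a b hb t₁
    refine app_injective (repMap r (H.ι a b hb) t₁) U ?_
    rw [map_sub, map_sub, hv₁, hv₂, ← map_sub, ← hn]
    exact app_congr (repMap_thetaPow (gen e) (H.ι a b hb) (p - 1) t t₁ ht₁) U n
  obtain ⟨n', rfl⟩ := exists_app_repMap_π r H b n
  obtain ⟨m, hm⟩ := exists_app_repMap_ι r H b c hc
    (v₁ - v.app U κ - (thetaPow (gen e) (H.Q b) (p - 1) t t₁ ht₁).app U n') (by
      rw [map_sub, h1, sub_eq_zero]
      exact (app_congr (repMap_thetaPow (gen e) (H.π b) (p - 1) t t₁ ht₁) U n'))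
  have h2 : w₁ - y.app U κ = (theta (gen e) (H.Ω c) t₁ t₂ ht₂).app U m := by
    have := mono_repMap_ι r H b c hc t₂
    refine app_injective (repMap r (H.ι b c hc) t₂) U ?_
    have h3 : (theta (gen e) (H.Q b) t₁ t₂ ht₂).app U
        ((thetaPow (gen e) (H.Q b) (p - 1) t t₁ ht₁).app U n') = 0 :=
      app_congr (thetaPow_zero_of_add_eq e (H.Q b) (p - 1) 1
        (by rw [add_comm, one_add_pred_prime]) t t₁ t₂ ht₁ ht₂) U n'
    have h4 : (repMap r (H.ι b c hc) t₂).app U ((theta (gen e) (H.Ω c) t₁ t₂ ht₂).app U m) =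
        (theta (gen e) (H.Q b) t₁ t₂ ht₂).app U ((repMap r (H.ι b c hc) t₁).app U m) :=
      (app_congr (repMap_thetaPow (gen e) (H.ι b c hc) 1 t₁ t₂ ht₂) U m).symm
    rw [h4, hm, map_sub, hw₁, hw₂, map_sub, h3, sub_zero, map_sub]
  exact hcls.of_sub_eq_theta t₁ ht₂ m h2 hθ

omit [Fintype E] in
theorem exists_odd_lift (hb : b = a + 1) (hc : c = b + 1)
    (ht₁ : t₁ = t + (p - 1 : ℕ)) (ht₂ : t₂ = t₁ + 1) {U : (PSpace k r).Opens}
    {μ : Γ(trivBundle r (H.Ω a).V t, U)} {ξ : Γ(F1 (gen e) (H.Ω a) t, U)}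
    (h : IsClass (gen e) (H.Ω a) t μ ξ) :
    ∃ (u : Γ(trivBundle r (H.Q a).V t, U)) (v : Γ(trivBundle r (H.Q b).V t₁, U))
      (w : Γ(trivBundle r (H.Ω c).V t₂, U)),
      (repMap r (H.π a) t).app U u = μ ∧
      (repMap r (H.π b ≫ H.ι a b hb) t₁).app U v =
        (thetaPow (gen e) (H.Q a) (p - 1) t t₁ ht₁).app U u ∧
      (repMap r (H.ι b c hc) t₂).app U w = (theta (gen e) (H.Q b) t₁ t₂ ht₂).app U v ∧
      (theta (gen e) (H.Ω c) t₂ (t₂ + 1) rfl).app U w = 0 := by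
  obtain ⟨κ, rfl, rfl⟩ := h
  obtain ⟨u, v, y, hrel, hu, hy⟩ := exists_oddRel_of_theta_eq_zero (e := e) (H := H) hb hc ht₁ ht₂
    (kernel.ι (theta (gen e) (H.Ω a) t (t + 1) rfl)) (kernel.condition _)
  refine ⟨u.app U κ, v.app U κ, y.app U κ, app_congr hu U κ, ?_, app_congr hrel.eq U κ,
    app_congr hy U κ⟩
  rw [repMap_comp]
  exact app_congr hrel.lift U κ

omit [Fintype E] in
-- The maps of a Heller shift carry a chain of lifts u, v, w on one side to a chain of lifts on the
-- other.
theorem IsOddSwitch.naturality {a' b' c' : ℤ} {hb' : b' = a' + 1} {hc' : c' = b' + 1}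
    {Sw : F1 (gen e) (H.Ω a) t ⟶ F1 (gen e) (H.Ω c) t₂} (hSw : IsOddSwitch e H hb hc ht₁ ht₂ Sw)
    {Sw' : F1 (gen e) (H.Ω a') t ⟶ F1 (gen e) (H.Ω c') t₂}
    (hSw' : IsOddSwitch e H hb' hc' ht₁ ht₂ Sw')
    (fa : H.Ω a ⟶ H.Ω a') (fb : H.Ω b ⟶ H.Ω b') (fc : H.Ω c ⟶ H.Ω c')
    (qa : H.Q a ⟶ H.Q a') (qb : H.Q b ⟶ H.Q b') (h1 : qa ≫ H.π a' = H.π a ≫ fa)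
    (h2 : H.ι a b hb ≫ qa = fb ≫ H.ι a' b' hb') (h3 : qb ≫ H.π b' = H.π b ≫ fb)
    (h4 : H.ι b c hc ≫ qb = fc ≫ H.ι b' c' hc') :
    F1map (gen e) fa t ≫ Sw' = Sw ≫ F1map (gen e) fc t₂ := by
  refine F1_hom_ext fun U μ ξ hμ => ?_
  obtain ⟨u, v, w, hu, hv, hw, hθ⟩ := exists_odd_lift hb hc ht₁ ht₂ hμ
  refine (hSw' U _ _ ((repMap r qa t).app U u) ((repMap r qb t₁).app U v)
    ((repMap r fc t₂).app U w) (hμ.map fa) ?_ ?_ ?_ ?_).unique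
    ((hSw U μ ξ u v w hμ hu hv hw hθ).map fc)
  · rw [← hu]
    refine app_congr (f := repMap r qa t ≫ repMap r (H.π a') t)
      (f' := repMap r (H.π a) t ≫ repMap r fa t) ?_ U u
    rw [← repMap_comp, h1, repMap_comp]
  · have h5 := congrArg ((repMap r qa t₁).app U) hv
    have h6 := app_congr (repMap_thetaPow (gen e) qa (p - 1) t t₁ ht₁) U u
    refine Eq.trans (Eq.trans ?_ h5) h6.symm
    refine app_congr (f := repMap r qb t₁ ≫ repMap r (H.π b' ≫ H.ι a' b' hb') t₁)
      (f' := repMap r (H.π b ≫ H.ι a b hb) t₁ ≫ repMap r qa t₁) ?_ U v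
    rw [← repMap_comp, ← repMap_comp, Category.assoc, h2, ← Category.assoc, h3, Category.assoc]
  · have h5 := congrArg ((repMap r qb t₂).app U) hw
    have h6 := app_congr (repMap_thetaPow (gen e) qb 1 t₁ t₂ ht₂) U v
    refine Eq.trans (Eq.trans ?_ h5) h6.symm
    refine app_congr (f := repMap r fc t₂ ≫ repMap r (H.ι b' c' hc') t₂)
      (f' := repMap r (H.ι b c hc) t₂ ≫ repMap r qb t₂) ?_ U w
    rw [← repMap_comp, ← repMap_comp, h4]
  · have h5 := congrArg ((repMap r fc (t₂ + 1)).app U) hθ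
    rw [map_zero] at h5
    exact (app_congr (repMap_thetaPow (gen e) fc 1 t₂ (t₂ + 1) rfl) U w).trans h5

end Odd

/-! ### The switch for `p = 2` -/

section Even

variable {e : E ≃* Multiplicative (Fin r → ZMod p)} {H} {a b : ℤ} {hb : b = a + 1} {t t₁ : ℤ}
  {ht₁ : t₁ = t + 1}

/-- `Sw` is the switchback map `ℱ₁(Ω^a k)(t) ⟶ ℱ₁(Ω^{a+1} k)(t + 1)`. -/
def IsEvenSwitch (e : E ≃* Multiplicative (Fin r → ZMod p)) (H : HellerShifts k E) {a b : ℤ}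
    (hb : b = a + 1) {t t₁ : ℤ} (ht₁ : t₁ = t + 1)
    (Sw : F1 (gen e) (H.Ω a) t ⟶ F1 (gen e) (H.Ω b) t₁) : Prop :=
  ∀ (U : (PSpace k r).Opens) (μ : Γ(trivBundle r (H.Ω a).V t, U)) (ξ : Γ(F1 (gen e) (H.Ω a) t, U))
    (u : Γ(trivBundle r (H.Q a).V t, U)) (w : Γ(trivBundle r (H.Ω b).V t₁, U)),
    IsClass (gen e) (H.Ω a) t μ ξ →
    (repMap r (H.π a) t).app U u = μ →
    (repMap r (H.ι a b hb) t₁).app U w = (theta (gen e) (H.Q a) t t₁ ht₁).app U u →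
    IsClass (gen e) (H.Ω b) t₁ w (Sw.app U ξ)

omit [CharP k p] [Fintype E] in
theorem exists_even_lift_hom (e : E ≃* Multiplicative (Fin r → ZMod p)) (hb : b = a + 1)
    (ht₁ : t₁ = t + 1) {A : (PSpace k r).Modules}
    (μ : A ⟶ trivBundle r (H.Ω a).V t) (hμ : μ ≫ theta (gen e) (H.Ω a) t t₁ ht₁ = 0) :
    ∃ (u : A ⟶ trivBundle r (H.Q a).V t) (y : A ⟶ trivBundle r (H.Ω b).V t₁),
      u ≫ repMap r (H.π a) t = μ ∧
      y ≫ repMap r (H.ι a b hb) t₁ = u ≫ theta (gen e) (H.Q a) t t₁ ht₁ := by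
  obtain ⟨u, rfl⟩ := exists_comp_repMap_π r H a μ
  obtain ⟨y, hy⟩ := exists_comp_repMap_ι r H a b hb (u ≫ theta (gen e) (H.Q a) t t₁ ht₁) (by
    rw [Category.assoc, ← repMap_thetaPow, ← Category.assoc, hμ])
  exact ⟨u, y, rfl, hy⟩

omit [Fintype E] in
theorem theta_theta_of_eq_two (hp : p = 2) (e : E ≃* Multiplicative (Fin r → ZMod p))
    (M : Rep.{u} k E) (t t₁ t₂ : ℤ) (h : t₁ = t + 1) (h' : t₂ = t₁ + 1) :
    theta (gen e) M t t₁ h ≫ theta (gen e) M t₁ t₂ h' = 0 := by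
  subst hp
  exact thetaPow_zero_of_add_eq e M 1 1 rfl t t₁ t₂ h h'

/-- This is the odd chase with one step instead of two. As θ ^ 2 = 0, an element w with ι w = θ u
lies in Ker θ automatically. -/
theorem exists_isEvenSwitch (hp : p = 2) (e : E ≃* Multiplicative (Fin r → ZMod p))
    (H : HellerShifts k E) {a b : ℤ} (hb : b = a + 1) {t t₁ : ℤ} (ht₁ : t₁ = t + 1) :
    ∃ Sw : F1 (gen e) (H.Ω a) t ≅ F1 (gen e) (H.Ω b) t₁, IsEvenSwitch e H hb ht₁ Sw.hom := by
  obtain ⟨u, y, hu, hy⟩ := exists_even_lift_hom (H := H) e hb rfl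
    (kernel.ι (theta (gen e) (H.Ω a) t (t + 1) rfl)) (kernel.condition _)
  subst ht₁
  obtain ⟨y', hy'⟩ : ∃ y' : kernel (theta (gen e) (H.Ω a) t (t + 1) rfl) ⟶
      kernel (theta (gen e) (H.Ω b) (t + 1) (t + 1 + 1) rfl), y' ≫ kernel.ι _ = y :=
    ⟨kernel.lift _ y (by
      have := mono_repMap_ι r H a b hb (t + 1 + 1)
      rw [← cancel_mono (repMap r (H.ι a b hb) (t + 1 + 1)), Category.assoc, ← repMap_thetaPow,
        ← Category.assoc, hy, Category.assoc, theta_theta_of_eq_two hp, comp_zero, zero_comp]),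
      kernel.lift_ι _ _ _⟩
  have hp1 : 1 + 1 = p := hp.symm
  -- Injectivity: u' - ι m is killed by θ, hence locally in the image of θ.
  have key : ∀ {A : (PSpace k r).Modules} (u' : A ⟶ trivBundle r (H.Q a).V t)
      (w : A ⟶ trivBundle r (H.Ω b).V (t + 1)) (m : A ⟶ trivBundle r (H.Ω b).V t),
      w ≫ repMap r (H.ι a b hb) (t + 1) = u' ≫ theta (gen e) (H.Q a) t (t + 1) rfl →
      w = m ≫ theta (gen e) (H.Ω b) t (t + 1) rfl →
      ∃ (A' : (PSpace k r).Modules) (ε : A' ⟶ A) (_ : Epi ε)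
        (ν : A' ⟶ trivBundle r (H.Ω a).V (t - 1)),
        ε ≫ u' ≫ repMap r (H.π a) t = ν ≫ theta (gen e) (H.Ω a) (t - 1) t (by omega) := by
    rintro A u' w m hw rfl
    obtain ⟨A', ε, hε, n, hn⟩ := exists_refinement_theta e (H.Q a) 1 1 hp1 le_rfl (t - 1) t (t + 1)
      (by omega) rfl (u' - m ≫ repMap r (H.ι a b hb) t) (by
        rw [Preadditive.sub_comp, ← hw, Category.assoc, Category.assoc, repMap_thetaPow, sub_self])
    refine ⟨A', ε, hε, n ≫ repMap r (H.π a) _, ?_⟩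
    have := congr($hn ≫ repMap r (H.π a) t)
    simpa only [Category.assoc, Preadditive.sub_comp, Preadditive.comp_sub, repMap_ι_π, comp_zero,
      sub_zero, ← repMap_thetaPow] using this
  -- Well-definedness: u' minus θ of a lift of ν comes from Ω^b, and θ ^ 2 = 0 removes the
  -- correction.
  have key' : ∀ {A : (PSpace k r).Modules} (u' : A ⟶ trivBundle r (H.Q a).V t)
      (w : A ⟶ trivBundle r (H.Ω b).V (t + 1)) (ν : A ⟶ trivBundle r (H.Ω a).V (t - 1)),
      w ≫ repMap r (H.ι a b hb) (t + 1) = u' ≫ theta (gen e) (H.Q a) t (t + 1) rfl →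
      u' ≫ repMap r (H.π a) t = ν ≫ theta (gen e) (H.Ω a) (t - 1) t (by omega) →
      ∃ m : A ⟶ trivBundle r (H.Ω b).V t, w = m ≫ theta (gen e) (H.Ω b) t (t + 1) rfl := by
    intro A u' w ν hw hν
    obtain ⟨n, rfl⟩ := exists_comp_repMap_π r H a ν
    obtain ⟨m, hm⟩ := exists_comp_repMap_ι r H a b hb
      (u' - n ≫ theta (gen e) (H.Q a) (t - 1) t (by omega)) (by
        rw [Preadditive.sub_comp, hν, Category.assoc, Category.assoc, repMap_thetaPow, sub_self])
    refine ⟨m, ?_⟩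
    have := mono_repMap_ι r H a b hb (t + 1)
    rw [← cancel_mono (repMap r (H.ι a b hb) (t + 1)), hw, Category.assoc, ← repMap_thetaPow,
      ← Category.assoc, hm, Preadditive.sub_comp, Category.assoc, theta_theta_of_eq_two hp,
      comp_zero, sub_zero]
  obtain ⟨Sw, hSw⟩ := exists_iso_cokernel (interIncl (gen e) (H.Ω a) t)
    (interIncl (gen e) (H.Ω b) (t + 1)) y' (by
      intro A x
      rw [comp_cls_eq_zero_iff x (t - 1) (by omega), comp_cls_eq_zero_iff (x ≫ y') t rfl]
      constructor
      · rintro ⟨A', ε, hε, ν, hν⟩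
        obtain ⟨m, hm⟩ := key' (ε ≫ x ≫ u) (ε ≫ x ≫ y) ν (by simp only [Category.assoc, hy])
          (by simp only [Category.assoc, hu, hν])
        exact ⟨A', ε, hε, m, by rw [Category.assoc, hy', ← hm]⟩
      · rintro ⟨A', ε, hε, m, hm⟩
        obtain ⟨A'', ε', hε', ν, hν⟩ := key (ε ≫ x ≫ u) (ε ≫ x ≫ y) m
          (by simp only [Category.assoc, hy]) (by rw [← hm, Category.assoc, hy'])
        refine ⟨A'', ε' ≫ ε, inferInstance, ν, ?_⟩
        rw [← hν]
        simp only [Category.assoc, hu]) (by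
      intro A z
      obtain ⟨A', ε, hε, u', hu'⟩ := exists_refinement_theta e (H.Q a) 1 1 hp1 le_rfl t (t + 1)
        (t + 1 + 1) rfl rfl (z ≫ kernel.ι _ ≫ repMap r (H.ι a b hb) (t + 1)) (by
          rw [Category.assoc, Category.assoc, repMap_thetaPow, ← Category.assoc (kernel.ι _),
            kernel.condition, zero_comp, comp_zero])
      obtain ⟨x, hx⟩ : ∃ x : A' ⟶ kernel (theta (gen e) (H.Ω a) t (t + 1) rfl),
          x ≫ kernel.ι _ = u' ≫ repMap r (H.π a) t := ⟨kernel.lift _ _ (by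
            rw [Category.assoc, repMap_thetaPow, ← Category.assoc, ← hu']
            simp only [Category.assoc, repMap_ι_π, comp_zero]), kernel.lift_ι _ _ _⟩
      refine ⟨A', ε, hε, x, ?_⟩
      obtain ⟨m, hm⟩ := key' (x ≫ u - u') (x ≫ y - ε ≫ z ≫ kernel.ι _) 0
        (by simp only [Preadditive.sub_comp, Category.assoc, hy, ← hu'])
        (by rw [Preadditive.sub_comp, Category.assoc, hu, hx, sub_self, zero_comp])
      rw [← sub_eq_zero, ← Preadditive.sub_comp, comp_cls_eq_zero_iff _ t rfl]
      exact ⟨A', 𝟙 _, inferInstance, m, by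
        rw [Category.id_comp, Preadditive.sub_comp, Category.assoc, hy', Category.assoc, hm]⟩)
  refine ⟨Sw, ?_⟩
  rintro U μ ξ u₁ w₁ ⟨κ, rfl, rfl⟩ hu₁ hw₁
  have hcls : IsClass (gen e) (H.Ω b) (t + 1) (y.app U κ)
      (Sw.hom.app U ((cokernel.π (interIncl (gen e) (H.Ω a) t)).app U κ)) :=
    ⟨y'.app U κ, app_congr hy' U κ, (app_congr hSw U κ).symm⟩
  have hu₂ := app_congr hu U κ
  have hw₂ := app_congr hy U κ
  simp only [Hom.comp_app, AddCommGrpCat.comp_apply] at hu₂ hw₂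
  obtain ⟨m, hm⟩ := exists_app_repMap_ι r H a b hb (u₁ - u.app U κ) (by
    rw [map_sub, hu₁, hu₂, sub_self])
  have h2 : w₁ - y.app U κ = (theta (gen e) (H.Ω b) t (t + 1) rfl).app U m := by
    have := mono_repMap_ι r H a b hb (t + 1)
    refine app_injective (repMap r (H.ι a b hb) (t + 1)) U ?_
    have h4 : (repMap r (H.ι a b hb) (t + 1)).app U
        ((theta (gen e) (H.Ω b) t (t + 1) rfl).app U m) =
        (theta (gen e) (H.Q a) t (t + 1) rfl).app U ((repMap r (H.ι a b hb) t).app U m) :=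
      (app_congr (repMap_thetaPow (gen e) (H.ι a b hb) 1 t (t + 1) rfl) U m).symm
    rw [h4, hm, map_sub, hw₁, hw₂, map_sub]
  have h5 : (theta (gen e) (H.Ω b) (t + 1) (t + 1 + 1) rfl).app U w₁ = 0 := by
    have h6 := app_congr (theta_theta_of_eq_two hp e (H.Ω b) t (t + 1) (t + 1 + 1) rfl rfl) U m
    simp only [Hom.comp_app, AddCommGrpCat.comp_apply] at h6
    rw [← h2, map_sub, hcls.theta_eq_zero, sub_zero] at h6
    exact h6
  exact hcls.of_sub_eq_theta t rfl m h2 h5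

omit [CharP k p] [Fintype E] in
theorem exists_even_lift (hb : b = a + 1) (ht₁ : t₁ = t + 1) {U : (PSpace k r).Opens}
    {μ : Γ(trivBundle r (H.Ω a).V t, U)} {ξ : Γ(F1 (gen e) (H.Ω a) t, U)}
    (h : IsClass (gen e) (H.Ω a) t μ ξ) :
    ∃ (u : Γ(trivBundle r (H.Q a).V t, U)) (w : Γ(trivBundle r (H.Ω b).V t₁, U)),
      (repMap r (H.π a) t).app U u = μ ∧
      (repMap r (H.ι a b hb) t₁).app U w = (theta (gen e) (H.Q a) t t₁ ht₁).app U u := by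
  obtain ⟨κ, rfl, rfl⟩ := h
  obtain ⟨u, y, hu, hy⟩ := exists_even_lift_hom (H := H) e hb ht₁
    (kernel.ι (theta (gen e) (H.Ω a) t (t + 1) rfl)) (by subst ht₁; exact kernel.condition _)
  exact ⟨u.app U κ, y.app U κ, app_congr hu U κ, app_congr hy U κ⟩

omit [CharP k p] [Fintype E] in
theorem IsEvenSwitch.naturality {a' b' : ℤ} {hb' : b' = a' + 1}
    {Sw : F1 (gen e) (H.Ω a) t ⟶ F1 (gen e) (H.Ω b) t₁} (hSw : IsEvenSwitch e H hb ht₁ Sw)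
    {Sw' : F1 (gen e) (H.Ω a') t ⟶ F1 (gen e) (H.Ω b') t₁} (hSw' : IsEvenSwitch e H hb' ht₁ Sw')
    (fa : H.Ω a ⟶ H.Ω a') (fb : H.Ω b ⟶ H.Ω b') (qa : H.Q a ⟶ H.Q a')
    (h1 : qa ≫ H.π a' = H.π a ≫ fa) (h2 : H.ι a b hb ≫ qa = fb ≫ H.ι a' b' hb') :
    F1map (gen e) fa t ≫ Sw' = Sw ≫ F1map (gen e) fb t₁ := by
  refine F1_hom_ext fun U μ ξ hμ => ?_
  obtain ⟨u, w, hu, hw⟩ := exists_even_lift hb ht₁ hμ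
  refine (hSw' U _ _ ((repMap r qa t).app U u) ((repMap r fb t₁).app U w) (hμ.map fa) ?_ ?_).unique
    ((hSw U μ ξ u w hμ hu hw).map fb)
  · rw [← hu]
    refine app_congr (f := repMap r qa t ≫ repMap r (H.π a') t)
      (f' := repMap r (H.π a) t ≫ repMap r fa t) ?_ U u
    rw [← repMap_comp, h1, repMap_comp]
  · have h5 := congrArg ((repMap r qa t₁).app U) hw
    have h6 := app_congr (repMap_thetaPow (gen e) qa 1 t t₁ ht₁) U u
    refine Eq.trans (Eq.trans ?_ h5) h6.symm
    refine app_congr (f := repMap r fb t₁ ≫ repMap r (H.ι a' b' hb') t₁)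
      (f' := repMap r (H.ι a b hb) t₁ ≫ repMap r qa t₁) ?_ U w
    rw [← repMap_comp, ← repMap_comp, h2]

end Even

end ElemAb

/-! ### Two-sided recursion and the families φ -/

theorem Int.exists_chain {X : ℤ → Type*} (R : ∀ l, X l → X (l + 1) → Prop) (x₀ : X 0)
    (hup : ∀ l x, ∃ y, R l x y) (hdown : ∀ l y, ∃ x, R l x y) :
    ∃ x : ∀ l, X l, x 0 = x₀ ∧ ∀ l, R l (x l) (x (l + 1)) := by
  choose up hup using hup
  choose down hdown using hdown
  let f : ∀ n : ℕ, X (Int.ofNat n) := fun n => Nat.rec x₀ (fun n y => up (Int.ofNat n) y) n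
  let g : ∀ n : ℕ, X (Int.negSucc n) := fun n =>
    Nat.rec (down (Int.negSucc 0) x₀) (fun n y => down (Int.negSucc (n + 1)) y) n
  refine ⟨fun l => Int.rec f g l, rfl, ?_⟩
  rintro (n | n)
  · exact hup (Int.ofNat n) (f n)
  · cases n with
    | zero => exact hdown (Int.negSucc 0) x₀
    | succ n => exact hdown (Int.negSucc (n + 1)) (g n)

/-- Bijective steps can be run backwards. The relational form is kept for Heller shifts of
homomorphisms, which exist in both directions without being unique. -/
theorem Int.exists_family {X : ℤ → Type*} (x₀ : X 0) (S : ∀ l, X l ≃ X (l + 1)) :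
    ∃ x : ∀ l, X l, x 0 = x₀ ∧ ∀ l, x (l + 1) = S l (x l) :=
  Int.exists_chain (fun l x y => y = S l x) x₀ (fun l x => ⟨S l x, rfl⟩)
    fun l y => ⟨(S l).symm y, ((S l).apply_symm_apply y).symm⟩

namespace ElemAb

open GradedTilde Scheme.Modules

attribute [local instance] MvPolynomial.gradedAlgebra

section Zero

variable {k : Type u} [Field k] {r : ℕ} {E : Type u} [Group E] (g : Fin r → E)

theorem unitHom_comp_trivMap {M N : Type u} [AddCommGroup M] [Module k M] [AddCommGroup N]
    [Module k N] (f : M →ₗ[k] N) (m : M) (t : ℤ) :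
    unitHom r m t ≫ trivMap r f t = unitHom r (f m) t :=
  tildeMap_comp _ _ _ _ _ _ _ _ _ _ _ _ _ _ _ _ _ _ _ (by ext; simp)

theorem isIso_unitHom_one (t : ℤ) : IsIso (unitHom (k := k) r (1 : k) t) := by
  have hdeg : ∀ j, ∀ n ∈ tensorGr k r k j,
      TensorProduct.AlgebraTensorModule.rid k (Poly k r) (Poly k r) n ∈ polyGr k r (j + 0) :=
    fun j n hn => map_mem_of_tmul ((TensorProduct.AlgebraTensorModule.rid k (Poly k r)
      (Poly k r)).toLinearMap.restrictScalars k) (polyGr k r j) (fun a ha m => by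
        simpa using (polyGr k r j).smul_mem m ha) n hn
  let i : trivBundle (k := k) r k t ⟶ lineBundle k r t :=
    tildeMap (polyGr k r) (tensorGr k r k) (polyGr k r)
      (TensorProduct.AlgebraTensorModule.rid k (Poly k r) (Poly k r)).toLinearMap 0 hdeg t t
      (by simp)
  refine ⟨i, ?_, ?_⟩
  · refine (tildeMap_comp _ _ _ _ _ _ _ _ _ _ LinearMap.id 0 (fun _ _ h => h) _ _ _ _ _ (by simp)
      (by ext; simp)).trans (tildeMap_id _ _ _ _ _ _ rfl)
  · refine (tildeMap_comp _ _ _ _ _ _ _ _ _ _ LinearMap.id 0 (fun _ _ h => h) _ _ _ _ _ (by simp)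
      (by ext; simp)).trans (tildeMap_id _ _ _ _ _ _ rfl)

theorem isIso_unitHom {M : Rep.{u} k E} (i : Rep.trivial k E k ≅ M) (t : ℤ) :
    IsIso (unitHom (k := k) r (i.hom.hom (1 : k)) t) := by
  have h1 : IsIso (repMap r i.hom t) := by
    refine ⟨repMap r i.inv t, ?_, ?_⟩
    · rw [← repMap_comp, i.hom_inv_id]
      exact trivMap_id r t
    · rw [← repMap_comp, i.inv_hom_id]
      exact trivMap_id r t
  have h2 := isIso_unitHom_one (k := k) (r := r) t
  have h3 : unitHom (k := k) r (1 : k) t ≫ repMap r i.hom t = unitHom r (i.hom.hom (1 : k)) t :=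
    unitHom_comp_trivMap _ _ t
  rw [← h3]
  exact IsIso.comp_isIso

theorem theta_eq_zero_of_iso_trivial {M : Rep.{u} k E} (i : Rep.trivial k E k ≅ M) (t t' : ℤ)
    (h : t' = t + 1) : theta g M t t' h = 0 := by
  refine tildeMap_zero _ _ _ _ _ _ _ _ _ ?_
  rw [pow_one, thetaLin]
  refine Finset.sum_eq_zero fun j _ => ?_
  have : xAct g M j = 0 := by
    refine LinearMap.ext fun m => ?_
    change M.ρ (g j) m - m = 0
    have hm : i.hom.hom (i.inv.hom m) = m := by simp
    rw [sub_eq_zero, ← hm, ← Rep.hom_comm_apply]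
    rfl
  rw [this, LinearMap.baseChange_zero, smul_zero]

theorem interIncl_eq_zero {M : Rep.{u} k E} (t : ℤ)
    (h : theta g M (t - 1) t (by ring) = 0) : interIncl g M t = 0 := by
  have h1 : image.ι (theta g M (t - 1) t (by ring)) = 0 := by
    rw [← cancel_epi (factorThruImage (theta g M (t - 1) t (by ring))), image.fac, h, comp_zero]
  have h1' : ∀ {Z : (PSpace k r).Modules} (x : Z ⟶ _),
      x ≫ image.ι (theta g M (t - 1) t (by ring)) = 0 := fun x => by rw [h1, comp_zero]
  rw [← cancel_mono (kernel.ι (theta g M t (t + 1) rfl)), zero_comp, interIncl, pullback.condition,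
    (h1' (pullback.snd _ _))]

/-- The group acts trivially, so θ = 0: the kernel of θ is everything, its image is zero, and ℱ₁ is
k ⊗ 𝒪. -/
theorem exists_iso_F1_of_iso_trivial {M : Rep.{u} k E} (i : Rep.trivial k E k ≅ M) (t : ℤ) :
    ∃ φ : lineBundle k r t ≅ F1 g M t, ∀ (U : (PSpace k r).Opens) (s : Γ(lineBundle k r t, U)),
      IsClass g M t ((unitHom r (i.hom.hom (1 : k)) t).app U s) (φ.hom.app U s) := by
  have hι : kernel.ι (theta g M t (t + 1) rfl) ≫ 𝟙 _ = kernel.ι (theta g M t (t + 1) rfl) :=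
    Category.comp_id _
  have h1 : IsIso (kernel.ι (theta g M t (t + 1) rfl)) := by
    rw [theta_eq_zero_of_iso_trivial g i]
    infer_instance
  have h2 : IsIso (cokernel.π (interIncl g M t)) := by
    rw [interIncl_eq_zero g t (theta_eq_zero_of_iso_trivial g i _ _ _)]
    infer_instance
  have h3 := isIso_unitHom (r := r) i t
  let x : lineBundle k r t ⟶ kernel (theta g M t (t + 1) rfl) :=
    unitHom r (i.hom.hom (1 : k)) t ≫ inv (kernel.ι (theta g M t (t + 1) rfl))
  have hx : x ≫ kernel.ι (theta g M t (t + 1) rfl) = unitHom r (i.hom.hom (1 : k)) t := by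
    simp [x]
  have hx' : IsIso x := IsIso.comp_isIso
  have hf' : IsIso (x ≫ cokernel.π (interIncl g M t)) := IsIso.comp_isIso
  let f : lineBundle k r t ⟶ F1 g M t := x ≫ cokernel.π (interIncl g M t)
  have hf : IsIso f := hf'
  refine ⟨asIso f, fun U s => ?_⟩
  have := isClass_app x s
  rwa [hx] at this

end Zero

section Families

variable {k : Type u} [Field k] {p r : ℕ} [Fact p.Prime] [CharP k p] {E : Type u} [CommGroup E]
  [Fintype E] (e : E ≃* Multiplicative (Fin r → ZMod p)) (H : HellerShifts k E)

/-- Along the recursion d stays fixed and t moves by p, so each step is composition with one switch.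
Indices are variables tied by equations, which avoids transport along equalities of integers. -/
theorem exists_odd_family :
    ∃ φ : ∀ l a d t : ℤ, a = 2 * l → t = d + p * l → (lineBundle k r d ≅ F1 (gen e) (H.Ω a) t),
      (∀ (d : ℤ) (h₁ : (0 : ℤ) = 2 * 0) (h₂ : d = d + p * 0) (U : (PSpace k r).Opens)
        (s : Γ(lineBundle k r d, U)),
        IsClass (gen e) (H.Ω 0) d ((unitHom r (H.trivialIso.hom.hom (1 : k)) d).app U s)
          ((φ 0 0 d d h₁ h₂).hom.app U s)) ∧
      ∀ (l a b c d t t₁ t₂ : ℤ) (ha : a = 2 * l) (hb : b = a + 1) (hc : c = b + 1)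
        (hc' : c = 2 * (l + 1)) (ht : t = d + p * l) (ht₁ : t₁ = t + (p - 1 : ℕ))
        (ht₂ : t₂ = t₁ + 1) (ht₂' : t₂ = d + p * (l + 1)),
        ∃ Sw : F1 (gen e) (H.Ω a) t ≅ F1 (gen e) (H.Ω c) t₂, IsOddSwitch e H hb hc ht₁ ht₂ Sw.hom ∧
          φ (l + 1) c d t₂ hc' ht₂' = φ l a d t ha ht ≪≫ Sw := by
  have hp := (Fact.out : p.Prime).one_le
  have hc' : ∀ l : ℤ, 2 * (l + 1) = 2 * l + 1 + 1 := fun l => by ring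
  have ht' : ∀ d l : ℤ, d + p * (l + 1) = d + p * l + (p - 1 : ℕ) + 1 := fun d l => by
    push_cast [hp]; ring
  choose Sw hSw using fun (l d a c t t₂ : ℤ) (ha : a = 2 * l) (hc : c = 2 * (l + 1))
    (ht : t = d + p * l) (ht₂ : t₂ = d + p * (l + 1)) =>
    exists_isOddSwitch e H (a := a) (b := a + 1) (c := c) rfl (by rw [ha, hc, hc']) (t := t)
    (t₁ := t + (p - 1 : ℕ)) (t₂ := t₂) rfl (by rw [ht, ht₂, ht'])
  choose φ₀ hφ₀ using fun d : ℤ => exists_iso_F1_of_iso_trivial (r := r) (gen e) H.trivialIso d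
  have h0 : ∀ d t : ℤ, t = d + p * 0 → t = d := fun d t h => by rw [h]; ring
  obtain ⟨x, hx0, hx⟩ := Int.exists_family
    (X := fun l => ∀ a d t : ℤ, a = 2 * l → t = d + p * l →
      (lineBundle k r d ≅ F1 (gen e) (H.Ω a) t))
    (fun a d t ha ht => by
      obtain rfl : a = 0 := ha
      obtain rfl : t = d := h0 d t ht
      exact φ₀ t)
    (fun l =>
      { toFun := fun φ c d t₂ hc ht₂ => φ _ d _ rfl rfl ≪≫ Sw l d _ c _ t₂ rfl hc rfl ht₂
        invFun := fun φ a d t ha ht => φ _ d _ rfl rfl ≪≫ (Sw l d a _ t _ ha rfl ht rfl).symm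
        left_inv := fun φ => by
          funext a d t ha ht
          subst ha ht
          dsimp only
          rw [Iso.trans_assoc, Iso.self_symm_id, Iso.trans_refl]
        right_inv := fun φ => by
          funext a d t ha ht
          subst ha ht
          dsimp only
          rw [Iso.trans_assoc, Iso.symm_self_id, Iso.trans_refl] })
  refine ⟨x, fun d _ _ U s => ?_, ?_⟩
  · rw [hx0]
    exact hφ₀ d U s
  · intro l a b c d t t₁ t₂ ha hb hc hc'' ht ht₁ ht₂ ht₂'
    subst ha hb ht ht₁
    refine ⟨Sw l d _ c _ t₂ rfl hc'' rfl ht₂', hSw l d _ c _ t₂ rfl hc'' rfl ht₂', ?_⟩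
    rw [hx]
    rfl

theorem exists_even_family (hp : p = 2) :
    ∃ φ : ∀ a d t : ℤ, t = d + a → (lineBundle k r d ≅ F1 (gen e) (H.Ω a) t),
      (∀ (d : ℤ) (h : d = d + 0) (U : (PSpace k r).Opens) (s : Γ(lineBundle k r d, U)),
        IsClass (gen e) (H.Ω 0) d ((unitHom r (H.trivialIso.hom.hom (1 : k)) d).app U s)
          ((φ 0 d d h).hom.app U s)) ∧
      ∀ (a b d t t₁ : ℤ) (hb : b = a + 1) (ht : t = d + a) (ht₁ : t₁ = t + 1) (ht₁' : t₁ = d + b),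
        ∃ Sw : F1 (gen e) (H.Ω a) t ≅ F1 (gen e) (H.Ω b) t₁, IsEvenSwitch e H hb ht₁ Sw.hom ∧
          φ b d t₁ ht₁' = φ a d t ht ≪≫ Sw := by
  choose Sw hSw using fun (a d b t t₁ : ℤ) (hb : b = a + 1) (ht : t = d + a) (ht₁ : t₁ = d + b) =>
    exists_isEvenSwitch hp e H hb (t := t) (t₁ := t₁) (by rw [ht, ht₁, hb, add_assoc])
  choose φ₀ hφ₀ using fun d : ℤ => exists_iso_F1_of_iso_trivial (r := r) (gen e) H.trivialIso d
  have h0 : ∀ d t : ℤ, t = d + 0 → t = d := fun d t h => by rw [h]; ring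
  obtain ⟨x, hx0, hx⟩ := Int.exists_family
    (X := fun a => ∀ d t : ℤ, t = d + a → (lineBundle k r d ≅ F1 (gen e) (H.Ω a) t))
    (fun d t ht => by
      obtain rfl : t = d := h0 d t ht
      exact φ₀ t)
    (fun a =>
      { toFun := fun φ d t₁ ht₁ => φ d _ rfl ≪≫ Sw a d _ _ t₁ rfl rfl ht₁
        invFun := fun φ d t ht => φ d _ rfl ≪≫ (Sw a d _ t _ rfl ht rfl).symm
        left_inv := fun φ => by
          funext d t ht
          subst ht
          dsimp only
          rw [Iso.trans_assoc, Iso.self_symm_id, Iso.trans_refl]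
        right_inv := fun φ => by
          funext d t ht
          subst ht
          dsimp only
          rw [Iso.trans_assoc, Iso.symm_self_id, Iso.trans_refl] })
  refine ⟨x, fun d _ U s => ?_, ?_⟩
  · rw [hx0]
    exact hφ₀ d U s
  · intro a b d t t₁ hb ht ht₁ ht₁'
    subst hb ht
    refine ⟨Sw a d _ _ t₁ rfl rfl ht₁', hSw a d _ _ t₁ rfl rfl ht₁', ?_⟩
    rw [hx]
    rfl

end Families

end ElemAb

/-! ### Multilinear evaluation on words and the bar differential -/

section Words

variable {S E V V' : Type*} [CommRing S] [Group E] [Fintype E] [AddCommGroup V] [Module S V]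
  [AddCommGroup V'] [Module S V']

/-- The value of a multilinear function of elements of the group algebra, given by its values `F` on
words in the group. -/
def wordSum : List (MonoidAlgebra S E) → (List E → V) → V
  | [], F => F []
  | a :: W, F => ∑ h, a.coeff h • wordSum W fun w => F (h :: w)

omit [Group E] in
theorem wordSum_sub (W : List (MonoidAlgebra S E)) (F G : List E → V) :
    wordSum W (fun w => F w - G w) = wordSum W F - wordSum W G := by
  induction W generalizing F G with
  | nil => rfl
  | cons a W ih => simp only [wordSum, ih, smul_sub, Finset.sum_sub_distrib]

omit [Group E] in
theorem map_wordSum (T : V →ₗ[S] V') (W : List (MonoidAlgebra S E)) (F : List E → V) :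
    T (wordSum W F) = wordSum W (fun w => T (F w)) := by
  induction W generalizing F with
  | nil => rfl
  | cons a W ih => simp only [wordSum, ← ih, map_sum, map_smul]

omit [Group E] in
theorem wordSum_congr (W : List (MonoidAlgebra S E)) {F G : List E → V}
    (h : ∀ w, w.length = W.length → F w = G w) : wordSum W F = wordSum W G := by
  induction W generalizing F G with
  | nil => exact h [] rfl
  | cons a W ih =>
    exact Finset.sum_congr rfl fun x _ => congrArg _ (ih fun w hw => h _ (by simp [hw]))

omit [Group E] in
theorem wordSum_sum {ι : Type*} (s : Finset ι) (W : List (MonoidAlgebra S E))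
    (F : ι → List E → V) : wordSum W (fun w => ∑ i ∈ s, F i w) = ∑ i ∈ s, wordSum W (F i) := by
  induction W generalizing F with
  | nil => rfl
  | cons a W ih =>
    simp only [wordSum, ih, Finset.smul_sum]
    exact Finset.sum_comm

omit [Fintype E] in
/-- The alternating sum of the values of `F` on the words obtained from `h :: w` by multiplying two
consecutive letters or omitting the last letter. -/
def innerFaces : List E → E → (List E → V) → V
  | [], _, F => F []
  | h' :: w, h, F => F ((h * h') :: w) - innerFaces w h' fun w' => F (h :: w')

omit [Fintype E] in
-- This matches the recursion with the alternating sum in the coboundary; contraction at the last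
-- index omits the last letter.
theorem innerFaces_ofFn {R : Type*} [Ring R] [Module R V] (m : ℕ) (x : Fin (m + 1) → E)
    (F : List E → V) :
    innerFaces (List.ofFn fun i => x i.succ) (x 0) F =
      ∑ j : Fin (m + 1), (-1 : R) ^ (j : ℕ) • F (List.ofFn (Fin.contractNth j (· * ·) x)) := by
  induction m generalizing F with
  | zero => simp [innerFaces]
  | succ m ih =>
    have h0 : List.ofFn (Fin.contractNth 0 (· * ·) x) =
        (x 0 * x 1) :: List.ofFn fun i : Fin m => x i.succ.succ := by
      rw [List.ofFn_succ]
      congr 1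
    have h1 : ∀ j : Fin (m + 1), List.ofFn (Fin.contractNth j.succ (· * ·) x) =
        x 0 :: List.ofFn (Fin.contractNth j (· * ·) fun i => x i.succ) := fun j => by
      rw [List.ofFn_succ]
      congr 2
      ext i
      simp [Fin.contractNth]
    rw [List.ofFn_succ, innerFaces, Fin.sum_univ_succ, h0, Fin.val_zero, pow_zero, one_smul,
      sub_eq_add_neg]
    congr 1
    rw [ih (fun i => x i.succ), ← Finset.sum_neg_distrib]
    refine Finset.sum_congr rfl fun j _ => ?_
    rw [h1, Fin.val_succ, pow_succ, mul_neg, mul_one, neg_smul]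

theorem sum_coeff_mul (a b : MonoidAlgebra S E) (G : E → V) :
    ∑ h, ∑ h', (a.coeff h * b.coeff h') • G (h * h') = ∑ x, (a * b).coeff x • G x := by
  have h1 : ∀ x, (a * b).coeff x = ∑ h, a.coeff h * b.coeff (h⁻¹ * x) := fun x => by
    rw [MonoidAlgebra.coeff_mul_apply_left, Finsupp.sum_fintype _ _ (by simp)]
  simp only [h1, Finset.sum_smul]
  rw [Finset.sum_comm (s := Finset.univ (α := E)) (t := Finset.univ (α := E))
    (f := fun x h => (a.coeff h * b.coeff (h⁻¹ * x)) • G x)]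
  refine Finset.sum_congr rfl fun h _ => ?_
  exact Fintype.sum_equiv (Equiv.mulLeft h) _ _ fun h' => by simp

/-- Consecutive letters of `a :: W` have product zero, and the last letter has augmentation zero. -/
def IsNullWord : MonoidAlgebra S E → List (MonoidAlgebra S E) → Prop
  | a, [] => ∑ h, a.coeff h = 0
  | a, b :: W => a * b = 0 ∧ IsNullWord b W

/-- The face merging the first two letters involves a b = 0, the inner ones vanish by induction, and
omitting the last letter leaves its augmentation, which is zero. -/
theorem sum_wordSum_innerFaces (a : MonoidAlgebra S E) (W : List (MonoidAlgebra S E))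
    (hW : IsNullWord a W) (F : List E → V) :
    ∑ h, a.coeff h • wordSum W (fun w => innerFaces w h F) = 0 := by
  induction W generalizing a F with
  | nil =>
    change ∑ h, a.coeff h • F [] = 0
    rw [← Finset.sum_smul, show ∑ h, a.coeff h = 0 from hW, zero_smul]
  | cons b W ih =>
    simp only [wordSum, innerFaces, wordSum_sub, smul_sub, Finset.sum_sub_distrib]
    have h1 : ∀ h, ∑ h', b.coeff h' • wordSum W (fun w => innerFaces w h' fun w' => F (h :: w')) =
        0 := fun h => ih b hW.2 _
    simp only [h1, smul_zero, Finset.sum_const_zero, sub_zero, Finset.smul_sum, smul_smul]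
    rw [sum_coeff_mul a b fun x => wordSum W fun w => F (x :: w), hW.1]
    simp

/-- On a null word the only surviving face is the one in which the first letter acts. This is the
mechanism that produces the lifts for the switchback. -/
theorem wordSum_coboundary (A : MonoidAlgebra S E →ₐ[S] Module.End S V) (a : MonoidAlgebra S E)
    (W : List (MonoidAlgebra S E)) (hW : IsNullWord a W) (F G : List E → V)
    (hG : ∀ h w, w.length = W.length →
      G (h :: w) = A (MonoidAlgebra.single h 1) (F w) - innerFaces w h F) :
    wordSum (a :: W) G = A a (wordSum W F) := by
  have h1 : ∀ h, (wordSum W fun w => G (h :: w)) =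
      A (MonoidAlgebra.single h 1) (wordSum W F) - wordSum W (fun w => innerFaces w h F) :=
    fun h => by rw [map_wordSum, ← wordSum_sub]; exact wordSum_congr _ (hG h)
  have h2 : a = ∑ h, a.coeff h • MonoidAlgebra.single h 1 := by
    ext x
    simp [MonoidAlgebra.coeff_sum]
  simp only [wordSum, h1, smul_sub, Finset.sum_sub_distrib, sum_wordSum_innerFaces a W hW, sub_zero]
  conv_rhs => rw [h2, map_sum, LinearMap.sum_apply]
  simp only [map_smul, LinearMap.smul_apply]

omit [Fintype E] in
/-- Extension of a function of tuples to words. -/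
def onWords {m : ℕ} {X : Type*} (F : (Fin m → E) → X) : List E → X :=
  fun w => F fun i => w.getD i 1

omit [Fintype E] in
-- The default letter 1 in `onWords` is never read on a word of length m.
theorem onWords_ofFn {m : ℕ} {X : Type*} (F : (Fin m → E) → X) (x : Fin m → E) :
    onWords F (List.ofFn x) = F x := by
  unfold onWords
  congr 1
  ext i
  simp

omit [Group E] [Fintype E] in
theorem exists_eq_ofFn {m : ℕ} (w : List E) (hw : w.length = m) :
    ∃ x : Fin m → E, w = List.ofFn x := by
  subst hw
  exact ⟨w.get, (List.ofFn_get w).symm⟩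

end Words

section Rep

variable {k : Type u} [Field k] {E : Type u} [Group E]

theorem onWords_d (M : Rep.{u} k E) {m : ℕ} (F : (Fin m → E) → M.V) (h : E) (w : List E)
    (hw : w.length = m) :
    onWords ((inhomogeneousCochains.d M m).hom F) (h :: w) =
      M.ρ h (onWords F w) - innerFaces w h (onWords F) := by
  obtain ⟨x, rfl⟩ := exists_eq_ofFn w hw
  have h1 : h :: List.ofFn x = List.ofFn (Fin.cons h x : Fin (m + 1) → E) := by
    rw [List.ofFn_succ]
    simp
  have h2 := innerFaces_ofFn (R := k) m (Fin.cons h x : Fin (m + 1) → E) (onWords F)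
  simp only [Fin.cons_zero, Fin.cons_succ] at h2
  rw [h1, onWords_ofFn, h2, onWords_ofFn, inhomogeneousCochains.d_hom_apply, sub_eq_add_neg,
    ← Finset.sum_neg_distrib]
  simp only [Fin.cons_zero, Fin.cons_succ, onWords_ofFn, pow_succ, mul_neg, mul_one, neg_smul]

theorem d_apply_ofFn (M : Rep.{u} k E) {m : ℕ} (F : (Fin m → E) → M.V) (x : Fin (m + 1) → E) :
    (inhomogeneousCochains.d M m).hom F x =
      M.ρ (x 0) (F fun i => x i.succ) -
        innerFaces (List.ofFn fun i => x i.succ) (x 0) (onWords F) := by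
  rw [← onWords_ofFn F, ← onWords_d M F _ _ (by simp), ← List.ofFn_succ, onWords_ofFn]

end Rep

namespace ElemAb

open GradedTilde Scheme.Modules

attribute [local instance] MvPolynomial.gradedAlgebra

/-! ### The cochain algebra, letter by letter -/

section Cochains

variable {k : Type u} [Field k] {E : Type u}

/-- The coefficient of a word in an element of the cochain algebra. -/
def wordCoeff (v : CochainAlg k E) (w : List E) : k := v.coeff (FreeMonoid.ofList w)

theorem wordCoeff_of_mul (h h' : E) (v : CochainAlg k E) (w : List E) [Decidable (h' = h)] :
    wordCoeff (MonoidAlgebra.single (FreeMonoid.of h) 1 * v) (h' :: w) =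
      if h' = h then wordCoeff v w else 0 := by
  unfold wordCoeff
  split_ifs with hh
  · subst hh
    rw [FreeMonoid.ofList_cons, MonoidAlgebra.coeff_single_mul_mul, one_mul]
  · refine MonoidAlgebra.coeff_single_mul_of_forall_mul_ne _ _ fun d hd => hh ?_
    have := congrArg FreeMonoid.toList hd
    rw [FreeMonoid.toList_of_mul] at this
    exact (List.cons.inj this).1.symm

theorem wordCoeff_of_mul_nil (h : E) (v : CochainAlg k E) :
    wordCoeff (MonoidAlgebra.single (FreeMonoid.of h) 1 * v) [] = 0 := by
  refine MonoidAlgebra.coeff_single_mul_of_forall_mul_ne _ _ fun d hd => ?_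
  have := congrArg FreeMonoid.toList hd
  rw [FreeMonoid.toList_of_mul] at this
  exact List.cons_ne_nil _ _ this

theorem wordCoeff_sum {ι : Type*} (s : Finset ι) (v : ι → CochainAlg k E) (w : List E) :
    wordCoeff (∑ i ∈ s, v i) w = ∑ i ∈ s, wordCoeff (v i) w := by
  simp [wordCoeff, MonoidAlgebra.coeff_sum]

theorem wordCoeff_smul (a : k) (v : CochainAlg k E) (w : List E) :
    wordCoeff (a • v) w = a * wordCoeff v w := by
  simp [wordCoeff]

variable [Fintype E]

theorem wordCoeff_sum_of_mul (v : E → CochainAlg k E) (h : E) (w : List E) :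
    wordCoeff (∑ h, MonoidAlgebra.single (FreeMonoid.of h) 1 * v h) (h :: w) =
      wordCoeff (v h) w := by
  classical
  simp [wordCoeff_sum, wordCoeff_of_mul]

theorem wordCoeff_sum_of_mul_nil (v : E → CochainAlg k E) :
    wordCoeff (∑ h, MonoidAlgebra.single (FreeMonoid.of h) 1 * v h) [] = 0 := by
  simp [wordCoeff_sum, wordCoeff_of_mul_nil]

variable [Group E] {p r : ℕ} (e : E ≃* Multiplicative (Fin r → ZMod p))

variable (k) in
/-- The value of the cochain representing the Bockstein of `y_i`. -/
def bockVal (i : Fin r) (h h' : E) : k :=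
  ((((coord e i h).val + (coord e i h').val - (coord e i (h * h')).val) / p : ℕ) : k)

/-- Sorting by the first letter gives the form in which coefficients and pairings can be read off
recursively. -/
theorem yCochain_mul (i : Fin r) (v : CochainAlg k E) :
    yCochain k e i * v =
      ∑ h, MonoidAlgebra.single (FreeMonoid.of h) 1 * (((coord e i h).val : k) • v) := by
  rw [yCochain, Finset.sum_mul]
  refine Finset.sum_congr rfl fun h _ => ?_
  rw [mul_smul_comm, ← smul_mul_assoc, MonoidAlgebra.smul_single, smul_eq_mul, mul_one]

theorem xCochain_mul (i : Fin r) (v : CochainAlg k E) :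
    xCochain k e i * v =
      ∑ h, MonoidAlgebra.single (FreeMonoid.of h) 1 *
        ∑ h', MonoidAlgebra.single (FreeMonoid.of h') 1 * (bockVal k e i h h' • v) := by
  rw [xCochain, Finset.sum_mul]
  refine Finset.sum_congr rfl fun h _ => ?_
  rw [Finset.sum_mul, Finset.mul_sum]
  refine Finset.sum_congr rfl fun h' _ => ?_
  rw [mul_smul_comm, mul_smul_comm, ← mul_assoc, MonoidAlgebra.single_mul_single, one_mul,
    ← smul_mul_assoc, MonoidAlgebra.smul_single, smul_eq_mul, mul_one]
  rfl

/-- Cocycles on words, with trivial coefficients. -/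
def IsWordCocycle (F : List E → k) : Prop := ∀ h w, F w = innerFaces w h F

theorem innerFaces_zero {V : Type*} [AddCommGroup V] {E : Type*} [Group E] (w : List E) (h : E) :
    innerFaces w h (fun _ => (0 : V)) = 0 := by
  induction w generalizing h with
  | nil => rfl
  | cons h' w ih => rw [innerFaces, ih, sub_zero]

theorem innerFaces_mul_left {S : Type*} [CommRing S] {E : Type*} [Group E] (a : S) (w : List E)
    (h : E) (F : List E → S) : innerFaces w h (fun w => a * F w) = a * innerFaces w h F := by
  induction w generalizing h F with
  | nil => rfl
  | cons h' w ih => rw [innerFaces, innerFaces, ih, mul_sub]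

theorem innerFaces_sum {ι V : Type*} [AddCommGroup V] {E : Type*} [Group E] (s : Finset ι)
    (w : List E) (h : E) (F : ι → List E → V) :
    innerFaces w h (fun w => ∑ i ∈ s, F i w) = ∑ i ∈ s, innerFaces w h (F i) := by
  induction w generalizing h F with
  | nil => rfl
  | cons h' w ih => simp only [innerFaces, ih, Finset.sum_sub_distrib]

end Cochains

end ElemAb

namespace ElemAb

open GradedTilde Scheme.Modules

attribute [local instance] MvPolynomial.gradedAlgebra

/-! ### The pairing of words with cochains -/

section Pairing

variable {k : Type u} [Field k] {r : ℕ} {E : Type u} [Group E] [Fintype E]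

/-- The pairing of words in the group algebra with cochains. -/
def pairing (W : List (MonoidAlgebra (Poly k r) E)) (v : CochainAlg k E) : Poly k r :=
  wordSum W fun w => MvPolynomial.C (wordCoeff v w)

omit [Group E] in
theorem pairing_sum_of_mul (a : MonoidAlgebra (Poly k r) E)
    (W : List (MonoidAlgebra (Poly k r) E)) (v : E → CochainAlg k E) :
    pairing (a :: W) (∑ h, MonoidAlgebra.single (FreeMonoid.of h) 1 * v h) =
      ∑ h, a.coeff h * pairing W (v h) := by
  simp only [pairing, wordSum, wordCoeff_sum_of_mul, smul_eq_mul]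

omit [Group E] in
theorem pairing_smul (c : k) (W : List (MonoidAlgebra (Poly k r) E)) (v : CochainAlg k E) :
    pairing W (c • v) = MvPolynomial.C c * pairing W v := by
  have := map_wordSum (LinearMap.mulLeft (Poly k r) (MvPolynomial.C c : Poly k r)) W
    fun w => MvPolynomial.C (wordCoeff v w)
  simp only [LinearMap.mulLeft_apply] at this
  simp only [pairing, wordCoeff_smul, MvPolynomial.C_mul, this]

omit [Group E] in
theorem pairing_finset_sum {ι : Type*} (s : Finset ι) (W : List (MonoidAlgebra (Poly k r) E))
    (v : ι → CochainAlg k E) : pairing W (∑ i ∈ s, v i) = ∑ i ∈ s, pairing W (v i) := by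
  simp only [pairing, wordCoeff_sum, map_sum, wordSum_sum]

omit [Group E] in
theorem pairing_nil_one : pairing ([] : List (MonoidAlgebra (Poly k r) E)) (1 : CochainAlg k E) = 1 := by
  change MvPolynomial.C ((1 : CochainAlg k E).coeff 1) = 1
  rw [MonoidAlgebra.coeff_one_one, map_one]

/-- Multiplication by `u` preserves cocycles, and is dual to removing the word `W` up to the factor
`q`. -/
structure PairsTo (W : List (MonoidAlgebra (Poly k r) E)) (u : CochainAlg k E) (q : Poly k r) :
    Prop where
  cocycle : ∀ v, IsWordCocycle (wordCoeff v) → IsWordCocycle (wordCoeff (u * v))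
  pairing : ∀ v W', pairing (W ++ W') (u * v) = q * pairing W' v

theorem PairsTo.one : PairsTo ([] : List (MonoidAlgebra (Poly k r) E)) 1 1 :=
  ⟨fun v hv => by rwa [one_mul], fun v W' => by rw [one_mul, one_mul, List.nil_append]⟩

/-- Both conditions quantify over whatever stands to the right, so they compose; no grading or
Leibniz rule for the cup product is needed. -/
theorem PairsTo.mul {W W' : List (MonoidAlgebra (Poly k r) E)} {u u' : CochainAlg k E}
    {q q' : Poly k r} (h : PairsTo W u q) (h' : PairsTo W' u' q') :
    PairsTo (W ++ W') (u * u') (q * q') :=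
  ⟨fun v hv => by rw [mul_assoc]; exact h.cocycle _ (h'.cocycle v hv), fun v W'' => by
    rw [mul_assoc, List.append_assoc, h.pairing, h'.pairing, mul_assoc]⟩

/-- The word `W` repeated `n` times. -/
def wordPow {A : Type*} (W : List A) : ℕ → List A
  | 0 => []
  | n + 1 => W ++ wordPow W n

theorem wordPow_add {A : Type*} (W : List A) (m n : ℕ) :
    wordPow W (m + n) = wordPow W m ++ wordPow W n := by
  induction m with
  | zero => simp [wordPow]
  | succ m ih => rw [Nat.succ_add, wordPow, wordPow, ih, List.append_assoc]

theorem PairsTo.pow {W : List (MonoidAlgebra (Poly k r) E)} {u : CochainAlg k E} {q : Poly k r}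
    (h : PairsTo W u q) (n : ℕ) : PairsTo (wordPow W n) (u ^ n) (q ^ n) := by
  induction n with
  | zero => exact PairsTo.one
  | succ n ih => rw [pow_succ', pow_succ']; exact h.mul ih

theorem PairsTo.list_prod {ι : Type*} {W : List (MonoidAlgebra (Poly k r) E)}
    {u : ι → CochainAlg k E} {q : ι → Poly k r} (h : ∀ i, PairsTo W (u i) (q i)) (s : ι → ℕ)
    (l : List ι) :
    PairsTo (wordPow W (l.map s).sum) (l.map fun i => u i ^ s i).prod
      (l.map fun i => q i ^ s i).prod := by
  induction l with
  | nil => exact PairsTo.one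
  | cons i l ih =>
    simp only [List.map_cons, List.prod_cons, List.sum_cons, wordPow_add]
    exact ((h i).pow (s i)).mul ih

theorem PairsTo.monomial {W : List (MonoidAlgebra (Poly k r) E)}
    {u : Fin r → CochainAlg k E} {q : Fin r → Poly k r} (h : ∀ i, PairsTo W (u i) (q i))
    (s : Fin r →₀ ℕ) :
    PairsTo (wordPow W s.degree) (List.ofFn fun i => u i ^ s i).prod (∏ i, q i ^ s i) := by
  have := PairsTo.list_prod h s (List.finRange r)
  simp only [← List.ofFn_eq_map] at this
  rwa [List.prod_ofFn, List.sum_ofFn, ← Finsupp.degree_eq_sum] at this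

omit [Fintype E] in
theorem isWordCocycle_one : IsWordCocycle (wordCoeff (1 : CochainAlg k E)) := by
  have h0 : ∀ h w, wordCoeff (1 : CochainAlg k E) (h :: w) = 0 := fun h w => by
    rw [wordCoeff, MonoidAlgebra.one_def]
    exact Finsupp.single_eq_of_ne (fun h' => List.cons_ne_nil h w (congrArg FreeMonoid.toList h'))
  intro h w
  cases w with
  | nil => rfl
  | cons h' w =>
    rw [innerFaces]
    simp only [h0, innerFaces_zero, sub_zero]

theorem isWordCocycle_evalCochain {W : List (MonoidAlgebra (Poly k r) E)}
    {u : Fin r → CochainAlg k E} {q : Fin r → Poly k r} (h : ∀ i, PairsTo W (u i) (q i))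
    (ζ : MvPolynomial (Fin r) k) : IsWordCocycle (wordCoeff (evalCochain u ζ)) := by
  intro x w
  have h1 : wordCoeff (evalCochain u ζ) = fun w => ∑ s ∈ ζ.support,
      ζ.coeff s * wordCoeff (List.ofFn fun i => u i ^ s i).prod w := by
    ext w
    simp only [evalCochain, wordCoeff_sum, wordCoeff_smul]
  rw [h1, innerFaces_sum]
  refine Finset.sum_congr rfl fun s _ => ?_
  rw [innerFaces_mul_left]
  have := (PairsTo.monomial h s).cocycle 1 isWordCocycle_one
  rw [mul_one] at this
  rw [← this]

/-- The word W does not depend on i, so all monomials of degree n pair with one and the same word, W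
repeated n times. -/
theorem pairing_evalCochain {W : List (MonoidAlgebra (Poly k r) E)}
    {u : Fin r → CochainAlg k E} {q : Fin r → Poly k r} (h : ∀ i, PairsTo W (u i) (q i))
    {n : ℕ} {ζ : MvPolynomial (Fin r) k} (hζ : ζ.IsHomogeneous n) :
    pairing (wordPow W n) (evalCochain u ζ) = MvPolynomial.aeval q ζ := by
  rw [evalCochain, pairing_finset_sum, MvPolynomial.aeval_def, MvPolynomial.eval₂_eq']
  refine Finset.sum_congr rfl fun s hs => ?_
  rw [pairing_smul, MvPolynomial.algebraMap_eq]
  have hs' : s.degree = n := by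
    have := hζ (MvPolynomial.mem_support_iff.1 hs)
    exact (congrArg (fun f => f s) Finsupp.degree_eq_weight_one).trans this
  have := (PairsTo.monomial h s).pairing 1 []
  rw [mul_one, List.append_nil, pairing_nil_one, mul_one, hs'] at this
  rw [this]

end Pairing

/-! ### Values of the cocycles of y_i and x_i on powers of X -/

section Generators

variable {k : Type u} [Field k] {p r : ℕ} [Fact p.Prime] {E : Type u} [CommGroup E]
  [Fintype E] (e : E ≃* Multiplicative (Fin r → ZMod p))

omit [Fintype E] in
-- The representatives in {0, …, p - 1} are additive up to multiples of p, which vanish in k.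
theorem wordCoeff_cocycle_y [CharP k p] [Fintype E] (i : Fin r) (v : CochainAlg k E)
    (hv : IsWordCocycle (wordCoeff v)) : IsWordCocycle (wordCoeff (yCochain k e i * v)) := by
  have hn : wordCoeff (yCochain k e i * v) [] = 0 := by
    rw [yCochain_mul, wordCoeff_sum_of_mul_nil]
  have hc : ∀ h w, wordCoeff (yCochain k e i * v) (h :: w) =
      ((coord e i h).val : k) * wordCoeff v w := fun h w => by
    rw [yCochain_mul, wordCoeff_sum_of_mul, wordCoeff_smul]
  have hadd : ∀ h h', ((coord e i (h * h')).val : k) = (coord e i h).val + (coord e i h').val :=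
    fun h h' => by
      rw [coord_mul, ZMod.val_add, ← Nat.cast_add, ← sub_eq_zero, ← neg_sub, ← Nat.cast_sub
        (Nat.mod_le _ _), neg_eq_zero, CharP.cast_eq_zero_iff k p]
      exact Nat.dvd_sub_mod _
  intro h w
  cases w with
  | nil => rfl
  | cons h' w =>
    rw [innerFaces]
    simp only [hc, innerFaces_mul_left, hadd, ← hv h' w]
    ring

omit [Fintype E] in
-- In ℕ, p times the carry of x and y plus the representative of x y is the sum of the
-- representatives of x and y. The cocycle identity times p follows from associativity, and p is
-- cancelled before passing to k.
theorem bockVal_cocycle (i : Fin r) (h h' h'' : E) :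
    bockVal k e i h' h'' + bockVal k e i h (h' * h'') =
      bockVal k e i (h * h') h'' + bockVal k e i h h' := by
  have key : ∀ x y : E, p * (((coord e i x).val + (coord e i y).val - (coord e i (x * y)).val) / p) +
      (coord e i (x * y)).val = (coord e i x).val + (coord e i y).val := fun x y => by
    have h2 : (coord e i (x * y)).val = ((coord e i x).val + (coord e i y).val) % p := by
      rw [coord_mul, ZMod.val_add]
    rw [h2, Nat.mul_div_cancel' (Nat.dvd_sub_mod _), Nat.sub_add_cancel (Nat.mod_le _ _)]
  simp only [bockVal, ← Nat.cast_add]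
  congr 1
  have h1 := key h' h''
  have h2 := key h (h' * h'')
  have h3 := key (h * h') h''
  have h4 := key h h'
  rw [mul_assoc] at h3
  rw [mul_assoc h h' h'']
  refine Nat.eq_of_mul_eq_mul_left (Fact.out : p.Prime).pos ?_
  rw [mul_add, mul_add]
  omega

omit [Fintype E] in
theorem wordCoeff_cocycle_x [Fintype E] (i : Fin r) (v : CochainAlg k E)
    (hv : IsWordCocycle (wordCoeff v)) : IsWordCocycle (wordCoeff (xCochain k e i * v)) := by
  have hn : wordCoeff (xCochain k e i * v) [] = 0 := by
    rw [xCochain_mul, wordCoeff_sum_of_mul_nil]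
  have hn' : ∀ h, wordCoeff (xCochain k e i * v) [h] = 0 := fun h => by
    rw [xCochain_mul, wordCoeff_sum_of_mul, wordCoeff_sum_of_mul_nil]
  have hc : ∀ h h' w, wordCoeff (xCochain k e i * v) (h :: h' :: w) =
      bockVal k e i h h' * wordCoeff v w := fun h h' w => by
    rw [xCochain_mul, wordCoeff_sum_of_mul, wordCoeff_sum_of_mul, wordCoeff_smul]
  intro h w
  cases w with
  | nil => rfl
  | cons h' w =>
    cases w with
    | nil => simp only [innerFaces, hn', sub_zero]
    | cons h'' w =>
      simp only [innerFaces, hc, innerFaces_mul_left, ← hv h'' w]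
      linear_combination (wordCoeff v w) * bockVal_cocycle (k := k) e i h h' h''

theorem thetaElt_coeff_sum (f : E → Poly k r) (g : Fin r → E) :
    ∑ h, (thetaElt g : MonoidAlgebra (Poly k r) E).coeff h * f h =
      ∑ j, MvPolynomial.X j * (f (g j) - f 1) := by
  classical
  simp only [thetaElt, MonoidAlgebra.coeff_sum, MonoidAlgebra.coeff_smul, Finsupp.finsetSum_apply,
    Finset.sum_mul]
  rw [Finset.sum_comm]
  refine Finset.sum_congr rfl fun j _ => ?_
  simp only [MonoidAlgebra.one_def, MonoidAlgebra.coeff_sub, MonoidAlgebra.coeff_single,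
    Finsupp.smul_apply, Finsupp.sub_apply, smul_eq_mul, mul_assoc, ← Finset.mul_sum, sub_mul,
    Finset.sum_sub_distrib]
  simp [Finsupp.single_apply]

theorem pairsTo_y [CharP k p] (i : Fin r) :
    PairsTo [(thetaElt (gen e) : MonoidAlgebra (Poly k r) E)] (yCochain k e i)
      (MvPolynomial.X i) := by
  refine ⟨wordCoeff_cocycle_y e i, fun v W' => ?_⟩
  rw [yCochain_mul, List.singleton_append, pairing_sum_of_mul]
  simp only [pairing_smul]
  rw [thetaElt_coeff_sum]
  have : Fact (1 < p) := ⟨(Fact.out : p.Prime).one_lt⟩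
  rw [Finset.sum_eq_single i]
  · simp [coord_gen, coord_one, ZMod.val_one]
  · intro j _ hj
    simp [coord_gen, coord_one, hj.symm]
  · simp

/-- Multiplication by X turns the indicator of coordinate c + 1 into Y_i times the indicator of c
minus that of c + 1. With t recording the i-th coordinate, this extracts the coefficient of t ^ c in
(Y_i (t - 1)) ^ m; as m ≤ c < p nothing wraps around modulo p. -/
theorem thetaElt_pow_coeff_sum (i : Fin r) (m c : ℕ) (hmc : m ≤ c) (hc : c < p) :
    ∑ h, ((thetaElt (gen e) : MonoidAlgebra (Poly k r) E) ^ m).coeff h *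
      (if coord e i h = c then 1 else 0) = if c = m then MvPolynomial.X i ^ m else 0 := by
  classical
  have hp : Fact (1 < p) := ⟨(Fact.out : p.Prime).one_lt⟩
  induction m generalizing c with
  | zero =>
    have h0 : ((c : ZMod p) = 0) ↔ c = 0 := by
      rw [ZMod.natCast_eq_zero_iff]
      exact ⟨fun h => Nat.eq_zero_of_dvd_of_lt h hc, fun h => h ▸ dvd_zero p⟩
    simp only [pow_zero, MonoidAlgebra.one_def, MonoidAlgebra.coeff_single, Finsupp.single_apply,
      ite_mul, one_mul, zero_mul, Finset.sum_ite_eq, Finset.mem_univ, if_true, coord_one]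
    simp only [eq_comm (a := (0 : ZMod p)), h0]
  | succ m ih =>
    obtain ⟨c, rfl⟩ : ∃ c', c = c' + 1 := ⟨c - 1, by omega⟩
    have h1 := sum_coeff_mul ((thetaElt (gen e) : MonoidAlgebra (Poly k r) E) ^ m)
      (thetaElt (gen e)) fun h => (if coord e i h = ((c + 1 : ℕ) : ZMod p) then (1 : Poly k r) else 0)
    simp only [smul_eq_mul, mul_assoc, ← Finset.mul_sum] at h1
    rw [pow_succ, ← h1]
    have h2 : ∀ h, ∑ h', (thetaElt (gen e) : MonoidAlgebra (Poly k r) E).coeff h' *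
        (if coord e i (h * h') = ((c + 1 : ℕ) : ZMod p) then (1 : Poly k r) else 0) =
        MvPolynomial.X i * ((if coord e i h = (c : ZMod p) then 1 else 0) -
          if coord e i h = ((c + 1 : ℕ) : ZMod p) then 1 else 0) := fun h => by
      rw [thetaElt_coeff_sum (fun h' => if coord e i (h * h') = ((c + 1 : ℕ) : ZMod p) then
        (1 : Poly k r) else 0), Finset.sum_eq_single i]
      · simp [coord_mul, coord_gen]
      · intro j _ hj
        simp [coord_mul, coord_gen, hj.symm]
      · simp
    simp only [h2, mul_left_comm _ (MvPolynomial.X i : Poly k r), ← Finset.mul_sum, mul_sub,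
      Finset.sum_sub_distrib]
    rw [ih c (by omega) (by omega), ih (c + 1) (by omega) hc, if_neg (by omega : ¬ c + 1 = m),
      mul_zero, sub_zero, pow_succ']
    by_cases hcm : c = m <;> simp [hcm]

omit [Fintype E] in
theorem bockVal_one (i : Fin r) (h : E) : bockVal k e i h 1 = 0 := by
  simp [bockVal, coord_one]

omit [Fintype E] in
-- Adding 1 to a residue produces a carry only at p - 1.
theorem bockVal_gen (i j : Fin r) (h : E) :
    bockVal k e i h (gen e j) =
      if j = i then (if coord e i h = ((p - 1 : ℕ) : ZMod p) then 1 else 0) else 0 := by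
  have hp : Fact (1 < p) := ⟨(Fact.out : p.Prime).one_lt⟩
  have hp' := hp.out
  rw [bockVal, coord_mul, coord_gen]
  split_ifs with h1 h2 h3 h4
  · rw [h3, ZMod.val_add, ZMod.val_one, ZMod.val_cast_of_lt (by omega), Nat.sub_add_cancel hp'.le,
      Nat.mod_self, Nat.sub_zero, Nat.div_self (by omega), Nat.cast_one]
  · have h5 : (coord e i h).val ≠ p - 1 := fun h5 => h3 (by
      rw [← h5, ZMod.natCast_val, ZMod.cast_id])
    have h6 := ZMod.val_lt (coord e i h)
    rw [ZMod.val_add, ZMod.val_one, Nat.mod_eq_of_lt (by omega), Nat.sub_self, Nat.zero_div,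
      Nat.cast_zero]
  all_goals simp_all

/-- Against the last letter X only g_i contributes: it gives Y_i times the indicator of coordinate p
- 1, by the carry. The letter X ^ (p - 1) takes the value Y_i ^ (p - 1) on this indicator. -/
theorem pairsTo_x (i : Fin r) :
    PairsTo [(thetaElt (gen e) : MonoidAlgebra (Poly k r) E) ^ (p - 1), thetaElt (gen e)]
      (xCochain k e i) (MvPolynomial.X i ^ p) := by
  have hp := (Fact.out : p.Prime).one_lt
  refine ⟨wordCoeff_cocycle_x e i, fun v W' => ?_⟩
  rw [xCochain_mul, List.cons_append, List.singleton_append, pairing_sum_of_mul]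
  simp only [pairing_sum_of_mul, pairing_smul]
  have h1 : ∀ h, ∑ h', (thetaElt (gen e) : MonoidAlgebra (Poly k r) E).coeff h' *
      (MvPolynomial.C (bockVal k e i h h') * pairing W' v) =
      (MvPolynomial.X i * pairing W' v) *
        if coord e i h = ((p - 1 : ℕ) : ZMod p) then 1 else 0 := fun h => by
    rw [thetaElt_coeff_sum (fun h' => MvPolynomial.C (bockVal k e i h h') * pairing W' v),
      Finset.sum_eq_single i]
    · rw [bockVal_one, bockVal_gen, if_pos rfl]
      split_ifs <;> simp
    · intro j _ hj
      rw [bockVal_one, bockVal_gen, if_neg hj, sub_self, mul_zero]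
    · simp
  simp only [h1, mul_left_comm _ (MvPolynomial.X i * pairing W' v), ← Finset.mul_sum]
  rw [thetaElt_pow_coeff_sum e i (p - 1) (p - 1) le_rfl (by omega), if_pos rfl, mul_right_comm,
    ← pow_succ', Nat.sub_add_cancel hp.le]

end Generators

end ElemAb

namespace ElemAb

open GradedTilde Scheme.Modules

attribute [local instance] MvPolynomial.gradedAlgebra

/-! ### Maps from line bundles given by homogeneous elements -/

section ElemHom

variable {k : Type u} [Field k] {r : ℕ}

/-- The map `𝒪(d) ⟶ M ⊗ 𝒪(t)`, `t = d + e`, `s ↦ s η`, given by an element `η` of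
`k[Y_1, …, Y_r] ⊗ M` of degree `e`. -/
def elemHom {M : Type u} [AddCommGroup M] [Module k M] (η : Poly k r ⊗[k] M) (e : ℕ)
    (hη : η ∈ tensorGr k r M e) (d t : ℤ) (h : t = d + e) :
    lineBundle k r d ⟶ trivBundle (k := k) r M t :=
  tildeMap (polyGr k r) (polyGr k r) (tensorGr k r M)
    (LinearMap.toSpanSingleton (Poly k r) _ η) e
    (fun _ _ ha => by
      rw [LinearMap.toSpanSingleton_apply]
      exact SetLike.GradedSMul.smul_mem ha hη) d t h

variable {M N : Type u} [AddCommGroup M] [Module k M] [AddCommGroup N] [Module k N]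
  {η : Poly k r ⊗[k] M} {e : ℕ} (hη : η ∈ tensorGr k r M e) (d t : ℤ) (h : t = d + e)

theorem elemHom_comp_trivMap (f : M →ₗ[k] N) {η' : Poly k r ⊗[k] N}
    (hη' : η' ∈ tensorGr k r N e) (hf : f.baseChange (Poly k r) η = η') :
    elemHom η e hη d t h ≫ trivMap r f t = elemHom η' e hη' d t h :=
  tildeMap_comp _ _ _ _ _ _ _ _ _ _ _ _ _ _ _ _ _ _ _ (by ext; simp [hf])

theorem mulHom_comp_elemHom (f : Poly k r) (e' : ℕ) (hf : f.IsHomogeneous e') (d' : ℤ)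
    (h' : d = d' + e') {η' : Poly k r ⊗[k] M} {n : ℕ} (hη' : η' ∈ tensorGr k r M n)
    (hfη : f • η = η') (h'' : t = d' + n) :
    mulHom f e' hf d' d h' ≫ elemHom η e hη d t h = elemHom η' n hη' d' t h'' :=
  tildeMap_comp _ _ _ _ _ _ _ _ _ _ _ _ _ _ _ _ _ _ _ (by ext; simp [hfη])

theorem unitHom_eq_elemHom (m : M) (h : t = t + (0 : ℕ))
    (hm : (1 : Poly k r) ⊗ₜ[k] m ∈ tensorGr k r M 0) :
    unitHom r m t = elemHom ((1 : Poly k r) ⊗ₜ[k] m) 0 hm t t h := rfl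

theorem elemHom_comp_thetaPow {E : Type u} [Group E] (g : Fin r → E) (M : Rep.{u} k E)
    {η η' : Poly k r ⊗[k] M.V} {e e' n : ℕ} (hη : η ∈ tensorGr k r M.V e)
    (hη' : η' ∈ tensorGr k r M.V n) (hθ : (thetaLin g M ^ e') η = η') (d t t' : ℤ) (h : t = d + e)
    (h' : t' = t + e') (h'' : t' = d + n) :
    elemHom η e hη d t h ≫ thetaPow g M e' t t' h' = elemHom η' n hη' d t' h'' :=
  tildeMap_comp _ _ _ _ _ _ _ _ _ _ _ _ _ _ _ _ _ _ _ (by ext; simp [hθ])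

end ElemHom

/-! ### Degrees of values on words -/

section WordDegree

variable {k : Type u} [Field k] {r : ℕ} {E : Type u} [Fintype E]

/-- All coefficients are homogeneous of degree `d`. -/
def IsHomElt (a : MonoidAlgebra (Poly k r) E) (d : ℕ) : Prop := ∀ h, (a.coeff h).IsHomogeneous d

theorem IsHomElt.mul [Group E] {a b : MonoidAlgebra (Poly k r) E} {d d' : ℕ} (ha : IsHomElt a d)
    (hb : IsHomElt b d') : IsHomElt (a * b) (d + d') := fun h => by
  rw [MonoidAlgebra.coeff_mul_apply_left, Finsupp.sum_fintype _ _ (by simp)]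
  exact MvPolynomial.IsHomogeneous.sum _ _ _ fun x _ => (ha x).mul (hb _)

omit [Fintype E] in
theorem isHomElt_thetaElt [CommGroup E] (g : Fin r → E) :
    IsHomElt (thetaElt g : MonoidAlgebra (Poly k r) E) 1 := fun h => by
  classical
  simp only [thetaElt, MonoidAlgebra.coeff_sum, MonoidAlgebra.coeff_smul, Finsupp.finsetSum_apply,
    MonoidAlgebra.one_def, MonoidAlgebra.coeff_sub, MonoidAlgebra.coeff_single,
    Finsupp.smul_apply, Finsupp.sub_apply, smul_eq_mul, Finsupp.single_apply]
  refine MvPolynomial.IsHomogeneous.sum _ _ _ fun j _ => (MvPolynomial.isHomogeneous_X k j).mul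
    (m := 1) (n := 0) (MvPolynomial.IsHomogeneous.sub ?_ ?_)
  · split_ifs
    exacts [MvPolynomial.isHomogeneous_one _ _, MvPolynomial.isHomogeneous_zero _ _ _]
  · split_ifs
    exacts [MvPolynomial.isHomogeneous_one _ _, MvPolynomial.isHomogeneous_zero _ _ _]

theorem IsHomElt.pow [Group E] {a : MonoidAlgebra (Poly k r) E} (ha : IsHomElt a 1) (n : ℕ) :
    IsHomElt (a ^ n) n := by
  classical
  induction n with
  | zero =>
    intro h
    rw [pow_zero, MonoidAlgebra.one_def, MonoidAlgebra.coeff_single, Finsupp.single_apply]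
    split_ifs
    exacts [MvPolynomial.isHomogeneous_one _ _, MvPolynomial.isHomogeneous_zero _ _ _]
  | succ n ih =>
    rw [pow_succ]
    exact ih.mul ha

variable {M : Type u} [AddCommGroup M] [Module k M]

/-- The value in `k[Y_1, …, Y_r] ⊗ M` of an `M`-valued function of words. -/
def wordVal (W : List (MonoidAlgebra (Poly k r) E)) (F : List E → M) : Poly k r ⊗[k] M :=
  wordSum W fun w => (1 : Poly k r) ⊗ₜ[k] F w

theorem wordVal_nil_mem (F : List E → M) :
    wordVal ([] : List (MonoidAlgebra (Poly k r) E)) F ∈ tensorGr k r M 0 :=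
  tmul_mem_tensorGr (SetLike.one_mem_graded (polyGr k r)) _

theorem wordVal_cons_mem {a : MonoidAlgebra (Poly k r) E} {d n : ℕ} (ha : IsHomElt a d)
    {W : List (MonoidAlgebra (Poly k r) E)}
    (hW : ∀ F : List E → M, wordVal W F ∈ tensorGr k r M n) (F : List E → M) :
    wordVal (a :: W) F ∈ tensorGr k r M (d + n) :=
  sum_mem fun h _ => SetLike.GradedSMul.smul_mem (A := polyGr k r) (ha h) (hW fun w => F (h :: w))

theorem baseChange_wordVal {N : Type u} [AddCommGroup N] [Module k N] (f : M →ₗ[k] N)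
    (W : List (MonoidAlgebra (Poly k r) E)) (F : List E → M) :
    f.baseChange (Poly k r) (wordVal W F) = wordVal W fun w => f (F w) := by
  rw [wordVal, map_wordSum]
  rfl

omit [Fintype E] in
theorem innerFaces_tmul [Group E] (w : List E) (h : E) (F : List E → M) :
    innerFaces w h (fun w => (1 : Poly k r) ⊗ₜ[k] F w) = 1 ⊗ₜ[k] innerFaces w h F := by
  induction w generalizing h F with
  | nil => rfl
  | cons h' w ih => rw [innerFaces, innerFaces, ih, TensorProduct.tmul_sub]

end WordDegree

theorem wordVal_d {k : Type u} [Field k] {r : ℕ} {E : Type u} [CommGroup E] [Fintype E]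
    (M : Rep.{u} k E) (a : MonoidAlgebra (Poly k r) E) (W : List (MonoidAlgebra (Poly k r) E))
    (hW : IsNullWord a W) {m : ℕ} (hm : W.length = m) (F : (Fin m → E) → M.V) :
    wordVal (a :: W) (onWords ((inhomogeneousCochains.d M m).hom F)) =
      groupAlgebraAction r M a (wordVal W (onWords F)) :=
  wordSum_coboundary _ a W hW _ _ fun h w hw => by
    rw [onWords_d M F h w (hw.trans hm), TensorProduct.tmul_sub, innerFaces_tmul,
      groupAlgebraAction_single, one_smul, LinearMap.baseChange_tmul]

end ElemAb

namespace ElemAb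

open GradedTilde Scheme.Modules

attribute [local instance] MvPolynomial.gradedAlgebra

theorem elemHom_congr {k : Type u} [Field k] {r : ℕ} {M : Type u} [AddCommGroup M] [Module k M]
    {η η' : Poly k r ⊗[k] M} {e e' : ℕ} (hη : η ∈ tensorGr k r M e) (hη' : η' ∈ tensorGr k r M e')
    (d t : ℤ) (h : t = d + e) (h' : t = d + e') (hηη' : η = η') (he : e = e') :
    elemHom η e hη d t h = elemHom η' e' hη' d t h' := by
  subst hηη' he
  rfl

theorem baseChange_thetaLin_pow {k : Type u} [Field k] {r : ℕ} {E : Type u} [Group E]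
    (g : Fin r → E) {M N : Rep.{u} k E} (f : M ⟶ N) (n : ℕ) (x : Poly k r ⊗[k] M.V) :
    f.hom.toLinearMap.baseChange (Poly k r) ((thetaLin g M ^ n) x) =
      (thetaLin g N ^ n) (f.hom.toLinearMap.baseChange (Poly k r) x) := by
  have hlin : thetaLin g N ∘ₗ f.hom.toLinearMap.baseChange (Poly k r) =
      f.hom.toLinearMap.baseChange (Poly k r) ∘ₗ thetaLin g M := by
    ext m
    simp [thetaLin_tmul, xAct, Rep.hom_comm_apply, TensorProduct.tmul_sub]
  induction n with
  | zero => rfl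
  | succ n ih =>
    rw [pow_succ', pow_succ', Module.End.mul_apply, Module.End.mul_apply, ← ih]
    exact (LinearMap.congr_fun hlin _).symm

theorem groupAlgebraAction_thetaElt_pow {k : Type u} [Field k] {r : ℕ} {E : Type u} [CommGroup E]
    (g : Fin r → E) (M : Rep.{u} k E) (n : ℕ) :
    groupAlgebraAction r M (thetaElt g ^ n) = thetaLin g M ^ n := by
  rw [map_pow, groupAlgebraAction_thetaElt]

/-! ### Comparison maps and cocycles on words -/

section Comparison

variable {k : Type u} [Field k] {r : ℕ} {E : Type u} [CommGroup E] [Fintype E]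
  {H : HellerShifts k E}

/-- The differential of Q_* is ι π, while the bar differential of a null word is the action of its
first letter. Compatibility of the two is one step of a switchback. -/
theorem IsComparison.action_wordVal {c : ∀ (m : ℕ) (a : ℤ), a = m → (Fin m → E) → (H.Q a).V}
    (hc : IsComparison H c) (x : MonoidAlgebra (Poly k r) E) (W : List (MonoidAlgebra (Poly k r) E))
    (hW : IsNullWord x W) {m m' : ℕ} (hm : W.length = m) (hm' : m' = m + 1) {a b : ℤ} (ha : a = m)
    (hb : b = m') (hab : b = a + 1) :
    groupAlgebraAction r (H.Q a) x (wordVal W (onWords (c m a ha))) =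
      (H.ι a b hab).hom.toLinearMap.baseChange (Poly k r)
        ((H.π b).hom.toLinearMap.baseChange (Poly k r)
          (wordVal (x :: W) (onWords (c m' b hb)))) := by
  subst hm'
  rw [baseChange_wordVal, baseChange_wordVal, ← wordVal_d (H.Q a) x W hW hm]
  exact congrArg _ (funext fun w => (hc.differential m a b ha hb hab _).symm)

omit [Fintype E] in
theorem thetaLin_trivial (g : Fin r → E) : thetaLin g (Rep.trivial k E k) = 0 := by
  refine Finset.sum_eq_zero fun j _ => ?_
  have : xAct g (Rep.trivial k E k) j = 0 := sub_self _
  rw [this, LinearMap.baseChange_zero, smul_zero]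

/-- A word whose pairing with coboundaries vanishes. -/
def IsClosedWord : List (MonoidAlgebra (Poly k r) E) → Prop
  | [] => True
  | x :: W => IsNullWord x W ∧ groupAlgebraAction r (Rep.trivial k E k) x = 0

/-- The value of a coboundary is the first letter acting on the trivial module, which is zero. In
degree zero the incoming differential itself is zero. -/
theorem wordVal_boundary (W : List (MonoidAlgebra (Poly k r) E)) (hW : IsClosedWord W) {N : ℕ}
    (hN : W.length = N)
    (w : (groupCohomology.inhomogeneousCochains (Rep.trivial k E k)).X
      ((ComplexShape.up ℕ).prev N)) :
    wordVal W (onWords (((groupCohomology.inhomogeneousCochains (Rep.trivial k E k)).d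
      ((ComplexShape.up ℕ).prev N) N).hom w : (Fin N → E) → k)) = 0 := by
  cases N with
  | zero =>
    obtain rfl := List.length_eq_zero_iff.1 hN
    have h0 : (groupCohomology.inhomogeneousCochains (Rep.trivial k E k)).d
        ((ComplexShape.up ℕ).prev 0) 0 = 0 := HomologicalComplex.shape _ _ _ (by simp)
    rw [h0]
    exact TensorProduct.tmul_zero _ _
  | succ N =>
    obtain ⟨x, W, rfl⟩ := List.exists_cons_of_length_eq_add_one hN
    generalize hj : (ComplexShape.up ℕ).prev (N + 1) = j at w
    obtain rfl : N = j := by rw [← hj, CochainComplex.prev_nat_succ]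
    rw [groupCohomology.inhomogeneousCochains.d_def]
    exact (wordVal_d (Rep.trivial k E k) x W hW.1 (Nat.succ.inj hN) w).trans (by rw [hW.2]; rfl)

omit [Fintype E] [CommGroup E] in
theorem onWords_component [Group E] (v : CochainAlg k E) {N : ℕ} (w : List E) (hw : w.length = N) :
    onWords (component v N) w = wordCoeff v w := by
  obtain ⟨x, rfl⟩ := exists_eq_ofFn w hw
  rw [onWords_ofFn]
  rfl

/-- The cocycle induced by f and the given one differ by a coboundary, which vanishes on a closed
word. -/
theorem RepresentsClass.exists_wordVal {N : ℕ} {v : CochainAlg k E} {a : ℤ} {ha : a = N}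
    {f : H.Ω a ⟶ H.Ω 0} (hf : RepresentsClass H N (component v N) a ha f)
    (W : List (MonoidAlgebra (Poly k r) E)) (hW : IsClosedWord W) (hN : W.length = N) :
    ∃ c, ∃ _ : IsComparison H c,
      f.hom.toLinearMap.baseChange (Poly k r) ((H.π a).hom.toLinearMap.baseChange (Poly k r)
        (wordVal W (onWords (c N a ha)))) =
        pairing W v • ((1 : Poly k r) ⊗ₜ[k] H.trivialIso.hom.hom (1 : k)) := by
  obtain ⟨c, hc, w, hw⟩ := hf
  refine ⟨c, hc, ?_⟩
  have hbd := wordVal_boundary W hW hN w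
  rw [hw] at hbd
  let T : k →ₗ[k] (H.Ω 0).V := H.trivialIso.hom.hom.toLinearMap
  have hT : ∀ x : (H.Ω 0).V, T (H.trivialIso.inv.hom x) = x := fun x => by
    have : H.trivialIso.hom.hom (H.trivialIso.inv.hom x) = x := by simp
    exact this
  have h1 := congrArg (T.baseChange (Poly k r)) hbd
  rw [map_zero, baseChange_wordVal] at h1
  have h2 : wordVal W (fun w => T (component v N fun i => w.getD i 1)) =
      pairing W v • ((1 : Poly k r) ⊗ₜ[k] T 1) := by
    rw [← LinearMap.toSpanSingleton_apply (Poly k r) _ ((1 : Poly k r) ⊗ₜ[k] T 1), pairing,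
      map_wordSum]
    refine wordSum_congr W fun w hw => ?_
    have h3 : (component v N fun i => w.getD i 1) = wordCoeff v w :=
      onWords_component v w (hw.trans hN)
    dsimp only
    have h4 : T (wordCoeff v w) = wordCoeff v w • T 1 := by
      rw [← T.map_smul, smul_eq_mul, mul_one]
    rw [h3, h4, LinearMap.toSpanSingleton_apply, TensorProduct.tmul_smul,
      MvPolynomial.C_eq_smul_one, smul_assoc, one_smul]
  rw [baseChange_wordVal, baseChange_wordVal]
  refine Eq.trans ?_ h2
  rw [← sub_eq_zero, wordVal, wordVal, ← wordSum_sub, ← h1, wordVal]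
  refine congrArg _ (funext fun w => ?_)
  rw [← TensorProduct.tmul_sub]
  refine congrArg _ ?_
  change _ = T (H.trivialIso.inv.hom _ - _)
  rw [map_sub, hT]
  rfl

end Comparison

end ElemAb

namespace ElemAb

open GradedTilde Scheme.Modules

attribute [local instance] MvPolynomial.gradedAlgebra

/-! ### The words attached to X -/

section Words

variable (k : Type u) [Field k] {r : ℕ} {E : Type u} [CommGroup E] (g : Fin r → E) (p : ℕ)

/-- The word `X ^ (p - 1), X, …, X ^ (p - 1), X` of length `2 n`, where `X` is the generic
shifted element `θ`. -/
def oddWord (n : ℕ) : List (MonoidAlgebra (Poly k r) E) :=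
  wordPow [thetaElt g ^ (p - 1), thetaElt g] n

/-- The word `X, …, X` of length `n`. -/
def evenWord (n : ℕ) : List (MonoidAlgebra (Poly k r) E) := wordPow [thetaElt g] n

theorem length_wordPow {A : Type*} (W : List A) (n : ℕ) :
    (wordPow W n).length = n * W.length := by
  induction n with
  | zero => simp [wordPow]
  | succ n ih => rw [wordPow, List.length_append, ih, Nat.succ_mul, add_comm]

theorem length_oddWord (n : ℕ) : (oddWord k g p n).length = 2 * n := by
  rw [oddWord, length_wordPow, mul_comm]
  rfl

theorem length_evenWord (n : ℕ) : (evenWord k g n).length = n := by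
  rw [evenWord, length_wordPow, List.length_singleton, mul_one]

variable [Fintype E] {k g p}

theorem thetaElt_augmentation : ∑ h, (thetaElt g : MonoidAlgebra (Poly k r) E).coeff h = 0 := by
  have := thetaElt_coeff_sum (k := k) (fun _ => (1 : Poly k r)) g
  simpa using this

theorem isNullWord_oddWord (hX : (thetaElt g : MonoidAlgebra (Poly k r) E) ^ p = 0) (hp : 1 ≤ p)
    (n : ℕ) : IsNullWord (thetaElt g) (oddWord k g p n) := by
  induction n with
  | zero => exact thetaElt_augmentation
  | succ n ih =>
    refine ⟨?_, ?_, ih⟩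
    · rw [← pow_succ', Nat.sub_add_cancel hp, hX]
    · rw [← pow_succ, Nat.sub_add_cancel hp, hX]

theorem isNullWord_cons_oddWord (hX : (thetaElt g : MonoidAlgebra (Poly k r) E) ^ p = 0)
    (hp : 1 ≤ p) (n : ℕ) :
    IsNullWord (thetaElt g ^ (p - 1)) (thetaElt g :: oddWord k g p n) :=
  ⟨by rw [← pow_succ, Nat.sub_add_cancel hp, hX], isNullWord_oddWord hX hp n⟩

theorem isNullWord_evenWord (hX : (thetaElt g : MonoidAlgebra (Poly k r) E) ^ 2 = 0) (n : ℕ) :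
    IsNullWord (thetaElt g) (evenWord k g n) := by
  induction n with
  | zero => exact thetaElt_augmentation
  | succ n ih => exact ⟨by rw [← pow_two, hX], ih⟩

/-- The bound p ≥ 2 makes p - 1 positive, so that X ^ (p - 1) acts as zero on k. -/
theorem isClosedWord_oddWord (hX : (thetaElt g : MonoidAlgebra (Poly k r) E) ^ p = 0) (hp : 2 ≤ p)
    (n : ℕ) : IsClosedWord (oddWord k g p n) := by
  cases n with
  | zero => trivial
  | succ n =>
    refine ⟨isNullWord_cons_oddWord hX (by omega) n, ?_⟩
    rw [groupAlgebraAction_thetaElt_pow, thetaLin_trivial, zero_pow (by omega)]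

theorem isClosedWord_evenWord (hX : (thetaElt g : MonoidAlgebra (Poly k r) E) ^ 2 = 0) (n : ℕ) :
    IsClosedWord (evenWord k g n) := by
  cases n with
  | zero => trivial
  | succ n => exact ⟨isNullWord_evenWord hX n, by rw [groupAlgebraAction_thetaElt, thetaLin_trivial]⟩

variable {M : Type u} [AddCommGroup M] [Module k M]

theorem wordVal_oddWord_mem (hp : 1 ≤ p) (n : ℕ) (F : List E → M) :
    wordVal (oddWord k g p n) F ∈ tensorGr k r M (p * n) := by
  induction n generalizing F with
  | zero => exact wordVal_nil_mem F
  | succ n ih =>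
    have h1 := wordVal_cons_mem ((isHomElt_thetaElt (k := k) g).pow (p - 1))
      (wordVal_cons_mem (isHomElt_thetaElt (k := k) g) ih) F
    have h2 : p - 1 + (1 + p * n) = p * (n + 1) := by
      rw [mul_add, mul_one]
      omega
    rwa [h2] at h1

theorem wordVal_evenWord_mem (n : ℕ) (F : List E → M) :
    wordVal (evenWord k g n) F ∈ tensorGr k r M n := by
  induction n generalizing F with
  | zero => exact wordVal_nil_mem F
  | succ n ih =>
    have h1 := wordVal_cons_mem (isHomElt_thetaElt (k := k) g) ih F
    rwa [add_comm 1 n] at h1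

end Words

theorem elemHom_comp_theta_eq_zero {k : Type u} [Field k] {r : ℕ} {E : Type u} [Group E]
    (g : Fin r → E) (M : Rep.{u} k E) {η : Poly k r ⊗[k] M.V} {n : ℕ}
    (hη : η ∈ tensorGr k r M.V n) (hθ : thetaLin g M η = 0) (d t t' : ℤ) (h : t = d + n)
    (h' : t' = t + 1) : elemHom η n hη d t h ≫ theta g M t t' h' = 0 := by
  refine (elemHom_comp_thetaPow g M hη (zero_mem (tensorGr k r M.V (n + 1))) ?_ d t t' h h'
    (by push_cast; omega)).trans (tildeMap_zero _ _ _ _ _ _ _ _ _ ?_)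
  · rw [pow_one, hθ]
  · ext
    simp

theorem IsComparison.baseChange_thetaLin {k : Type u} [Field k] {r : ℕ} {E : Type u} [CommGroup E]
    [Fintype E] {g : Fin r → E} {H : HellerShifts k E}
    {c : ∀ (m : ℕ) (a : ℤ), a = m → (Fin m → E) → (H.Q a).V} (hc : IsComparison H c)
    (W : List (MonoidAlgebra (Poly k r) E)) (hW : IsNullWord (thetaElt g) W) {m : ℕ}
    (hm : W.length = m) {a : ℤ} (ha : a = m) :
    (H.π a).hom.toLinearMap.baseChange (Poly k r)
      (thetaLin g (H.Q a) (wordVal W (onWords (c m a ha)))) = 0 := by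
  rw [← groupAlgebraAction_thetaElt, hc.action_wordVal _ W hW hm rfl ha
    (b := a + 1) (by rw [ha]; push_cast; rfl) rfl, ← LinearMap.comp_apply,
    ← LinearMap.baseChange_comp, (splitting H a (a + 1) rfl).π_ι, LinearMap.baseChange_zero,
    LinearMap.zero_apply]

/-! ### The diagram for polynomials in the x_i -/

section Odd

variable {k : Type u} [Field k] {p r : ℕ} [Fact p.Prime] [CharP k p] {E : Type u} [CommGroup E]
  [Fintype E] {e : E ≃* Multiplicative (Fin r → ZMod p)} {H : HellerShifts k E}

omit [Fintype E] in
theorem thetaElt_gen_pow (e : E ≃* Multiplicative (Fin r → ZMod p)) :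
    (thetaElt (gen e) : MonoidAlgebra (Poly k r) E) ^ p = 0 :=
  thetaElt_pow (gen e) fun i => pow_prime_eq_one e (gen e i)

/-- The local section `s ↦ s π(η)` is in the class of `φ_l(s)`, where `η` is the value of the
comparison map on the word `X ^ (p - 1), X, …, X ^ (p - 1), X`. -/
theorem isClass_oddWord
    {φ : ∀ l a d t : ℤ, a = 2 * l → t = d + p * l → (lineBundle k r d ≅ F1 (gen e) (H.Ω a) t)}
    (hφ₀ : ∀ (d : ℤ) (h₁ : (0 : ℤ) = 2 * 0) (h₂ : d = d + p * 0) (U : (PSpace k r).Opens)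
      (s : Γ(lineBundle k r d, U)),
      IsClass (gen e) (H.Ω 0) d ((unitHom r (H.trivialIso.hom.hom (1 : k)) d).app U s)
        ((φ 0 0 d d h₁ h₂).hom.app U s))
    (hφ : ∀ (l a b c d t t₁ t₂ : ℤ) (ha : a = 2 * l) (hb : b = a + 1) (hc : c = b + 1)
      (hc' : c = 2 * (l + 1)) (ht : t = d + p * l) (ht₁ : t₁ = t + (p - 1 : ℕ))
      (ht₂ : t₂ = t₁ + 1) (ht₂' : t₂ = d + p * (l + 1)),
      ∃ Sw : F1 (gen e) (H.Ω a) t ≅ F1 (gen e) (H.Ω c) t₂, IsOddSwitch e H hb hc ht₁ ht₂ Sw.hom ∧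
        φ (l + 1) c d t₂ hc' ht₂' = φ l a d t ha ht ≪≫ Sw)
    {c : ∀ (m : ℕ) (a : ℤ), a = m → (Fin m → E) → (H.Q a).V} (hc : IsComparison H c)
    (n : ℕ) (l a d t : ℤ) (hl : l = n) (ha : a = (2 * n : ℕ)) (ha' : a = 2 * l)
    (ht : t = d + p * l) (ht' : t = d + (p * n : ℕ))
    (hη : (H.π a).hom.toLinearMap.baseChange (Poly k r)
      (wordVal (oddWord k (gen e) p n) (onWords (c (2 * n) a ha))) ∈ tensorGr k r (H.Ω a).V (p * n))
    (U : (PSpace k r).Opens) (s : Γ(lineBundle k r d, U)) :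
    IsClass (gen e) (H.Ω a) t ((elemHom _ (p * n) hη d t ht').app U s)
      ((φ l a d t ha' ht).hom.app U s) := by
  have hp := (Fact.out : p.Prime).two_le
  have hX := thetaElt_gen_pow (k := k) e
  induction n generalizing l a t with
  | zero =>
    obtain rfl : l = 0 := by simpa using hl
    obtain rfl : a = 0 := by simpa using ha
    obtain rfl : t = d := by simpa using ht
    refine Eq.mp (congrArg (fun x => IsClass (gen e) (H.Ω 0) t x _) ?_) (hφ₀ t ha' ht U s)
    refine app_congr ?_ U s
    rw [unitHom_eq_elemHom t _ (by simp)
      (tmul_mem_tensorGr (SetLike.one_mem_graded (polyGr k r)) _)]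
    refine elemHom_congr _ _ _ _ _ _ ?_ rfl
    rw [baseChange_wordVal]
    exact congrArg _ (hc.augmentation _).symm
  | succ n ih =>
    obtain rfl : l = (n : ℤ) + 1 := by simpa using hl
    obtain ⟨a₀, ha₀⟩ : ∃ a₀ : ℤ, a₀ = (2 * n : ℕ) := ⟨_, rfl⟩
    obtain ⟨b, hb⟩ : ∃ b, b = a₀ + 1 := ⟨_, rfl⟩
    have hab : a = b + 1 := by rw [ha, hb, ha₀]; push_cast; ring
    have hb' : b = (2 * n + 1 : ℕ) := by rw [hb, ha₀]; push_cast; ring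
    obtain ⟨t₀, ht₀⟩ : ∃ t₀ : ℤ, t₀ = d + (p * n : ℕ) := ⟨_, rfl⟩
    obtain ⟨t₁, ht₁⟩ : ∃ t₁, t₁ = t₀ + (p - 1 : ℕ) := ⟨_, rfl⟩
    have ht₂ : t = t₁ + 1 := by
      rw [ht, ht₁, ht₀, Nat.cast_sub (by omega)]; push_cast; ring
    obtain ⟨Sw, hSw, hφ'⟩ := hφ n a₀ b a d t₀ t₁ t (by rw [ha₀]; push_cast; ring) hb hab ha'
      (by rw [ht₀]; push_cast; ring) ht₁ ht₂ ht
    rw [hφ']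
    let F₀ := onWords (c (2 * n) a₀ ha₀)
    let F₁ := onWords (c (2 * n + 1) b hb')
    let F₂ := onWords (c (2 * (n + 1)) a ha)
    have hm₀ : wordVal (oddWord k (gen e) p n) F₀ ∈ tensorGr k r (H.Q a₀).V (p * n) :=
      wordVal_oddWord_mem (by omega) n _
    have hm₁ : (thetaLin (gen e) (H.Q b) ^ (p - 2))
        (wordVal (thetaElt (gen e) :: oddWord k (gen e) p n) F₁) ∈
        tensorGr k r (H.Q b).V (1 + p * n + (p - 2)) :=
      thetaLin_pow_mem _ _ _ _ _ (wordVal_cons_mem (isHomElt_thetaElt (k := k) (gen e))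
        (wordVal_oddWord_mem (by omega) n) _)
    have rel₀ : thetaLin (gen e) (H.Q a₀) (wordVal (oddWord k (gen e) p n) F₀) =
        (H.ι a₀ b hb).hom.toLinearMap.baseChange (Poly k r)
          ((H.π b).hom.toLinearMap.baseChange (Poly k r)
            (wordVal (thetaElt (gen e) :: oddWord k (gen e) p n) F₁)) := by
      rw [← groupAlgebraAction_thetaElt]
      exact hc.action_wordVal _ _ (isNullWord_oddWord hX (by omega) n) (length_oddWord ..) rfl
        ha₀ hb' hb
    have rel₁ : (thetaLin (gen e) (H.Q b) ^ (p - 1))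
        (wordVal (thetaElt (gen e) :: oddWord k (gen e) p n) F₁) =
        (H.ι b a hab).hom.toLinearMap.baseChange (Poly k r)
          ((H.π a).hom.toLinearMap.baseChange (Poly k r)
            (wordVal (oddWord k (gen e) p (n + 1)) F₂)) := by
      rw [← groupAlgebraAction_thetaElt_pow]
      exact hc.action_wordVal _ _ (isNullWord_cons_oddWord hX (by omega) n)
        (by rw [List.length_cons, length_oddWord]) rfl hb' ha hab
    have hθpow : ∀ {M : Rep.{u} k E} (x : Poly k r ⊗[k] M.V), (thetaLin (gen e) M ^ (p - 1)) x =
        (thetaLin (gen e) M ^ (p - 2)) (thetaLin (gen e) M x) := fun x => by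
      rw [← Module.End.mul_apply, ← pow_succ]
      congr 2
      omega
    have hθpow' : ∀ {M : Rep.{u} k E} (x : Poly k r ⊗[k] M.V), (thetaLin (gen e) M ^ (p - 1)) x =
        (thetaLin (gen e) M ^ 1) ((thetaLin (gen e) M ^ (p - 2)) x) := fun x => by
      rw [← Module.End.mul_apply, ← pow_add]
      congr 2
      omega
    have ht₁' : t₁ = d + (1 + p * n + (p - 2) : ℕ) := by omega
    have hmθ : (thetaLin (gen e) (H.Q a₀) ^ (p - 1)) (wordVal (oddWord k (gen e) p n) F₀) ∈
        tensorGr k r (H.Q a₀).V (1 + p * n + (p - 2)) := by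
      have := thetaLin_pow_mem (gen e) (H.Q a₀) (p - 1) _ _ hm₀
      have h3 : 1 + p * n + (p - 2) = p * n + (p - 1) := by omega
      rwa [h3]
    have hmι : (H.ι b a hab).hom.toLinearMap.baseChange (Poly k r)
          ((H.π a).hom.toLinearMap.baseChange (Poly k r)
            (wordVal (oddWord k (gen e) p (n + 1)) F₂)) ∈ tensorGr k r (H.Q b).V (p * (n + 1)) :=
      baseChange_mem _ _ _ hη
    -- The chain of lifts is u = s c(W_n), v = s θ ^ (p - 2) c(X, W_n) and w = s π c(W_{n+1}). By
    -- `rel₀` and `rel₁`, ι π v = θ ^ (p - 1) u and ι w = θ v.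
    refine hSw U _ _ ((elemHom _ (p * n) hm₀ d t₀ ht₀).app U s)
      ((elemHom _ (1 + p * n + (p - 2)) hm₁ d t₁ ht₁').app U s) _
      (ih n a₀ t₀ rfl ha₀ (by rw [ha₀]; push_cast; ring) (by rw [ht₀]; push_cast; ring) ht₀
        (baseChange_mem _ _ _ hm₀)) ?_ ?_ ?_ ?_
    · exact app_congr (elemHom_comp_trivMap hm₀ d t₀ ht₀ (H.π a₀).hom.toLinearMap _ rfl) U s
    · refine app_congr (f := elemHom _ _ hm₁ d t₁ ht₁' ≫ repMap r (H.π b ≫ H.ι a₀ b hb) t₁)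
        (f' := elemHom _ _ hm₀ d t₀ ht₀ ≫ thetaPow (gen e) (H.Q a₀) (p - 1) t₀ t₁ ht₁) ?_ U s
      rw [repMap, elemHom_comp_trivMap hm₁ d t₁ _ (H.π b ≫ H.ι a₀ b hb).hom.toLinearMap hmθ,
        elemHom_comp_thetaPow (gen e) (H.Q a₀) hm₀ hmθ rfl]
      rw [baseChange_thetaLin_pow, hθpow, rel₀, Rep.hom_comp_toLinearMap,
        LinearMap.baseChange_comp, LinearMap.comp_apply]
    · refine app_congr (f := elemHom _ _ hη d t ht' ≫ repMap r (H.ι b a hab) t)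
        (f' := elemHom _ _ hm₁ d t₁ ht₁' ≫ theta (gen e) (H.Q b) t₁ t ht₂) ?_ U s
      rw [repMap, elemHom_comp_trivMap hη d t ht' _ hmι rfl,
        elemHom_comp_thetaPow (gen e) (H.Q b) hm₁ hmι _ _ _ _ _ _ ht']
      rw [← hθpow', rel₁]
    · refine app_congr (f := elemHom _ _ hη d t ht' ≫ theta (gen e) (H.Ω a) t (t + 1) rfl)
        (f' := 0) ?_ U s
      refine elemHom_comp_theta_eq_zero (gen e) (H.Ω a) hη ?_ d t (t + 1) ht' rfl
      rw [← pow_one (thetaLin (gen e) (H.Ω a)), ← baseChange_thetaLin_pow, pow_one]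
      exact hc.baseChange_thetaLin _ (isNullWord_oddWord hX (by omega) _) (length_oddWord ..) ha

/-- Applying f to s π c(W_n) gives ρ(ζ) s ⊗ 1 by the pairing, and φ_0 sends ρ(ζ) s to the class of
the same section. -/
theorem odd_comm_zero
    {φ : ∀ l a d t : ℤ, a = 2 * l → t = d + p * l → (lineBundle k r d ≅ F1 (gen e) (H.Ω a) t)}
    (hφ₀ : ∀ (d : ℤ) (h₁ : (0 : ℤ) = 2 * 0) (h₂ : d = d + p * 0) (U : (PSpace k r).Opens)
      (s : Γ(lineBundle k r d, U)),
      IsClass (gen e) (H.Ω 0) d ((unitHom r (H.trivialIso.hom.hom (1 : k)) d).app U s)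
        ((φ 0 0 d d h₁ h₂).hom.app U s))
    (hφ : ∀ (l a b c d t t₁ t₂ : ℤ) (ha : a = 2 * l) (hb : b = a + 1) (hc : c = b + 1)
      (hc' : c = 2 * (l + 1)) (ht : t = d + p * l) (ht₁ : t₁ = t + (p - 1 : ℕ))
      (ht₂ : t₂ = t₁ + 1) (ht₂' : t₂ = d + p * (l + 1)),
      ∃ Sw : F1 (gen e) (H.Ω a) t ≅ F1 (gen e) (H.Ω c) t₂, IsOddSwitch e H hb hc ht₁ ht₂ Sw.hom ∧
        φ (l + 1) c d t₂ hc' ht₂' = φ l a d t ha ht ≪≫ Sw)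
    {n : ℕ} {ζ : MvPolynomial (Fin r) k} (hζ : ζ.IsHomogeneous n) {l a d t : ℤ} (hl : l = n)
    (ha : a = (2 * n : ℕ)) (ha' : a = 2 * l) (ht : t = d + p * l) {f : H.Ω a ⟶ H.Ω 0}
    (hf : RepresentsClass H (2 * n) (component (evalCochain (xCochain k e) ζ) (2 * n)) a ha f)
    (h0 : (0 : ℤ) = 2 * 0) (ht' : t = t + p * 0) (hd : t = d + (p * n : ℕ)) :
    (φ l a d t ha' ht).hom ≫ F1map (gen e) f t =
      mulHom (rhoOdd k r p ζ) (p * n) (rhoOdd_isHomogeneous p hζ) d t hd ≫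
        (φ 0 0 t t h0 ht').hom := by
  have hp := (Fact.out : p.Prime).two_le
  have hX := thetaElt_gen_pow (k := k) e
  obtain ⟨c, hc, hval⟩ := hf.exists_wordVal (oddWord k (gen e) p n) (isClosedWord_oddWord hX hp n)
    (length_oddWord ..)
  rw [oddWord, pairing_evalCochain (pairsTo_x e) hζ] at hval
  have hη : (H.π a).hom.toLinearMap.baseChange (Poly k r)
      (wordVal (oddWord k (gen e) p n) (onWords (c (2 * n) a ha))) ∈
        tensorGr k r (H.Ω a).V (p * n) :=
    baseChange_mem _ _ _ (wordVal_oddWord_mem (by omega) n _)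
  have h1 := tmul_mem_tensorGr (SetLike.one_mem_graded (polyGr k r))
    (H.trivialIso.hom.hom (1 : k))
  have h2 : rhoOdd k r p ζ • ((1 : Poly k r) ⊗ₜ[k] H.trivialIso.hom.hom (1 : k)) ∈
      tensorGr k r (H.Ω 0).V (p * n) :=
    SetLike.GradedSMul.smul_mem (A := polyGr k r) (rhoOdd_isHomogeneous p hζ) h1
  refine hom_ext _ _ fun U => ?_
  ext s
  refine ((isClass_oddWord hφ₀ hφ hc n l a d t hl ha ha' ht hd hη U s).map f).unique ?_
  refine Eq.mp (congrArg (fun x => IsClass (gen e) (H.Ω 0) t x _) ?_) (hφ₀ t h0 ht' U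
    ((mulHom (rhoOdd k r p ζ) (p * n) (rhoOdd_isHomogeneous p hζ) d t hd).app U s))
  refine app_congr (f := mulHom (rhoOdd k r p ζ) (p * n) (rhoOdd_isHomogeneous p hζ) d t hd ≫ unitHom r (H.trivialIso.hom.hom (1 : k)) t)
    (f' := elemHom _ (p * n) hη d t hd ≫ repMap r f t) ?_ U s
  rw [unitHom_eq_elemHom t _ (by simp) h1, mulHom_comp_elemHom h1 t t _ _ _ _ d hd h2 rfl hd,
    repMap, elemHom_comp_trivMap hη d t hd _ h2 hval]

omit [Fintype E] in
-- By naturality the two diagrams differ by a switch, which can be cancelled. The map `x` of line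
-- bundles is the same in both because d and d' stay fixed while the twist t moves by p.
theorem odd_comm_succ_iff
    {φ : ∀ l a d t : ℤ, a = 2 * l → t = d + p * l → (lineBundle k r d ≅ F1 (gen e) (H.Ω a) t)}
    (hφ : ∀ (l a b c d t t₁ t₂ : ℤ) (ha : a = 2 * l) (hb : b = a + 1) (hc : c = b + 1)
      (hc' : c = 2 * (l + 1)) (ht : t = d + p * l) (ht₁ : t₁ = t + (p - 1 : ℕ))
      (ht₂ : t₂ = t₁ + 1) (ht₂' : t₂ = d + p * (l + 1)),
      ∃ Sw : F1 (gen e) (H.Ω a) t ≅ F1 (gen e) (H.Ω c) t₂, IsOddSwitch e H hb hc ht₁ ht₂ Sw.hom ∧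
        φ (l + 1) c d t₂ hc' ht₂' = φ l a d t ha ht ≪≫ Sw)
    {N : ℕ} {f : ∀ a b : ℤ, a = b + N → (H.Ω a ⟶ H.Ω b)}
    {q : ∀ a b : ℤ, a = b + N → (H.Q a ⟶ H.Q b)}
    (hfq : ∀ (a b : ℤ) (h : a = b + N), q a b h ≫ H.π b = H.π a ≫ f a b h)
    (hqf : ∀ (a b a' b' : ℤ) (h : a = b + N) (h' : a' = b' + N) (ha : a' = a + 1)
      (hb : b' = b + 1), H.ι a a' ha ≫ q a b h = f a' b' h' ≫ H.ι b b' hb)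
    {l j a b a' b' d d' t t' : ℤ} (x : lineBundle k r d ⟶ lineBundle k r d') (ha : a = 2 * l)
    (hb : b = 2 * j) (ha' : a' = 2 * (l + 1)) (hb' : b' = 2 * (j + 1)) (hab : a = b + N)
    (hab' : a' = b' + N) (ht : t = d + p * l) (ht' : t' = d + p * (l + 1)) (hd : t = d' + p * j)
    (hd' : t' = d' + p * (j + 1)) :
    (φ l a d t ha ht).hom ≫ F1map (gen e) (f a b hab) t = x ≫ (φ j b d' t hb hd).hom ↔
      (φ (l + 1) a' d t' ha' ht').hom ≫ F1map (gen e) (f a' b' hab') t' =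
        x ≫ (φ (j + 1) b' d' t' hb' hd').hom := by
  have hp := (Fact.out : p.Prime).two_le
  obtain ⟨t₁, ht₁⟩ : ∃ t₁, t₁ = t + (p - 1 : ℕ) := ⟨_, rfl⟩
  have ht₂ : t' = t₁ + 1 := by
    rw [ht₁, ht, ht', Nat.cast_sub (by omega)]; push_cast; ring
  obtain ⟨Sw, hSw, h1⟩ := hφ l a (a + 1) a' d t t₁ t' ha rfl (by omega) ha' ht ht₁ ht₂ ht'
  obtain ⟨Sw', hSw', h2⟩ := hφ j b (b + 1) b' d' t t₁ t' hb rfl (by omega) hb' hd ht₁ ht₂ hd'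
  have hnat := hSw.naturality hSw' (f a b hab) (f (a + 1) (b + 1) (by omega)) (f a' b' hab')
    (q a b hab) (q (a + 1) (b + 1) (by omega)) (hfq ..) (hqf ..) (hfq ..) (hqf ..)
  rw [h1, h2, Iso.trans_hom, Iso.trans_hom, Category.assoc, ← hnat, ← Category.assoc,
    ← Category.assoc, cancel_mono]

/-- The twist t is left arbitrary because the induction on j, in both directions, changes it. -/
theorem odd_comm
    {φ : ∀ l a d t : ℤ, a = 2 * l → t = d + p * l → (lineBundle k r d ≅ F1 (gen e) (H.Ω a) t)}
    (hφ₀ : ∀ (d : ℤ) (h₁ : (0 : ℤ) = 2 * 0) (h₂ : d = d + p * 0) (U : (PSpace k r).Opens)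
      (s : Γ(lineBundle k r d, U)),
      IsClass (gen e) (H.Ω 0) d ((unitHom r (H.trivialIso.hom.hom (1 : k)) d).app U s)
        ((φ 0 0 d d h₁ h₂).hom.app U s))
    (hφ : ∀ (l a b c d t t₁ t₂ : ℤ) (ha : a = 2 * l) (hb : b = a + 1) (hc : c = b + 1)
      (hc' : c = 2 * (l + 1)) (ht : t = d + p * l) (ht₁ : t₁ = t + (p - 1 : ℕ))
      (ht₂ : t₂ = t₁ + 1) (ht₂' : t₂ = d + p * (l + 1)),
      ∃ Sw : F1 (gen e) (H.Ω a) t ≅ F1 (gen e) (H.Ω c) t₂, IsOddSwitch e H hb hc ht₁ ht₂ Sw.hom ∧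
        φ (l + 1) c d t₂ hc' ht₂' = φ l a d t ha ht ≪≫ Sw)
    {n : ℕ} {ζ : MvPolynomial (Fin r) k} (hζ : ζ.IsHomogeneous n)
    {f : ∀ a b : ℤ, a = b + (2 * n : ℕ) → (H.Ω a ⟶ H.Ω b)}
    {q : ∀ a b : ℤ, a = b + (2 * n : ℕ) → (H.Q a ⟶ H.Q b)}
    (hfq : ∀ (a b : ℤ) (h : a = b + (2 * n : ℕ)), q a b h ≫ H.π b = H.π a ≫ f a b h)
    (hqf : ∀ (a b a' b' : ℤ) (h : a = b + (2 * n : ℕ)) (h' : a' = b' + (2 * n : ℕ))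
      (ha : a' = a + 1) (hb : b' = b + 1), H.ι a a' ha ≫ q a b h = f a' b' h' ≫ H.ι b b' hb)
    (hf : RepresentsClass H (2 * n) (component (evalCochain (xCochain k e) ζ) (2 * n)) (2 * n : ℕ)
      rfl (f (2 * n : ℕ) 0 (by simp)))
    (j : ℤ) : ∀ (l a b d d' t : ℤ) (_ : l = n + j) (ha : a = 2 * l) (hb : b = 2 * j)
    (hab : a = b + (2 * n : ℕ)) (ht : t = d + p * l) (ht' : t = d' + p * j)
    (hd : d' = d + (p * n : ℕ)),
    (φ l a d t ha ht).hom ≫ F1map (gen e) (f a b hab) t =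
      mulHom (rhoOdd k r p ζ) (p * n) (rhoOdd_isHomogeneous p hζ) d d' hd ≫
        (φ j b d' t hb ht').hom := by
  induction j using Int.induction_on with
  | zero =>
    intro l a b d d' t hl ha hb hab ht ht' hd
    obtain rfl : b = 0 := by simpa using hb
    obtain rfl : t = d' := by simpa using ht'
    obtain rfl : a = (2 * n : ℕ) := by simpa using hab
    exact odd_comm_zero hφ₀ hφ hζ (by simpa using hl) rfl ha ht hf hb ht' hd
  | succ j ih =>
    intro l a b d d' t hl ha hb hab ht ht' hd
    obtain ⟨l, rfl⟩ : ∃ l', l = l' + 1 := ⟨l - 1, by ring⟩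
    exact (odd_comm_succ_iff hφ hfq hqf _ (a := 2 * l) (b := 2 * j) (t := d + p * l) rfl rfl ha hb
      (by omega) hab rfl ht (by rw [hd]; push_cast; rw [show l = n + j by omega]; ring) ht').1
      (ih _ _ _ _ _ _ (by omega) _ _ _ _ _ _)
  | pred j ih =>
    intro l a b d d' t hl ha hb hab ht ht' hd
    -- The known case is written as the successor of the wanted one, so that the equivalence can be
    -- used backwards.
    rw [← sub_add_cancel (-(j : ℤ)) 1] at ih
    exact (odd_comm_succ_iff hφ hfq hqf _ (a' := 2 * (l + 1)) (b' := 2 * (-(j : ℤ) - 1 + 1))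
      (t' := d + p * (l + 1)) ha hb rfl rfl hab (by omega) ht rfl ht'
      (by rw [hd]; push_cast; rw [show l = n + (-j - 1) by omega]; ring)).2
      (ih _ _ _ _ _ _ (by omega) _ _ _ _ _ _)

end Odd

end ElemAb

namespace ElemAb

open GradedTilde Scheme.Modules

attribute [local instance] MvPolynomial.gradedAlgebra

/-! ### The diagram for p = 2 -/

section Even

variable {k : Type u} [Field k] {p r : ℕ} [Fact p.Prime] [CharP k p] {E : Type u} [CommGroup E]
  [Fintype E] {e : E ≃* Multiplicative (Fin r → ZMod p)} {H : HellerShifts k E}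

omit [Fintype E] in
theorem thetaElt_gen_sq (e : E ≃* Multiplicative (Fin r → ZMod p)) (hp : p = 2) :
    (thetaElt (gen e) : MonoidAlgebra (Poly k r) E) ^ 2 = 0 :=
  hp ▸ thetaElt_gen_pow e

/-- The local section `s ↦ s π(η)` is in the class of `φ_a(s)`, where `η` is the value of the
comparison map on the word `X, …, X`. -/
theorem isClass_evenWord (hp : p = 2)
    {φ : ∀ a d t : ℤ, t = d + a → (lineBundle k r d ≅ F1 (gen e) (H.Ω a) t)}
    (hφ₀ : ∀ (d : ℤ) (h : d = d + 0) (U : (PSpace k r).Opens) (s : Γ(lineBundle k r d, U)),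
      IsClass (gen e) (H.Ω 0) d ((unitHom r (H.trivialIso.hom.hom (1 : k)) d).app U s)
        ((φ 0 d d h).hom.app U s))
    (hφ : ∀ (a b d t t₁ : ℤ) (hb : b = a + 1) (ht : t = d + a) (ht₁ : t₁ = t + 1)
      (ht₁' : t₁ = d + b),
      ∃ Sw : F1 (gen e) (H.Ω a) t ≅ F1 (gen e) (H.Ω b) t₁, IsEvenSwitch e H hb ht₁ Sw.hom ∧
        φ b d t₁ ht₁' = φ a d t ht ≪≫ Sw)
    {c : ∀ (m : ℕ) (a : ℤ), a = m → (Fin m → E) → (H.Q a).V} (hc : IsComparison H c)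
    (n : ℕ) (a d t : ℤ) (ha : a = n) (ht : t = d + a) (ht' : t = d + n)
    (hη : (H.π a).hom.toLinearMap.baseChange (Poly k r)
      (wordVal (evenWord k (gen e) n) (onWords (c n a ha))) ∈ tensorGr k r (H.Ω a).V n)
    (U : (PSpace k r).Opens) (s : Γ(lineBundle k r d, U)) :
    IsClass (gen e) (H.Ω a) t ((elemHom _ n hη d t ht').app U s) ((φ a d t ht).hom.app U s) := by
  have hX := thetaElt_gen_sq (k := k) e hp
  induction n generalizing a t with
  | zero =>
    obtain rfl : a = 0 := by simpa using ha
    obtain rfl : t = d := by simpa using ht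
    refine Eq.mp (congrArg (fun x => IsClass (gen e) (H.Ω 0) t x _) ?_) (hφ₀ t ht U s)
    refine app_congr ?_ U s
    rw [unitHom_eq_elemHom t _ (by simp)
      (tmul_mem_tensorGr (SetLike.one_mem_graded (polyGr k r)) _)]
    refine elemHom_congr _ _ _ _ _ _ ?_ rfl
    rw [baseChange_wordVal]
    exact congrArg _ (hc.augmentation _).symm
  | succ n ih =>
    obtain ⟨a₀, ha₀⟩ : ∃ a₀ : ℤ, a₀ = n := ⟨_, rfl⟩
    have hb : a = a₀ + 1 := by rw [ha, ha₀]; push_cast; ring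
    obtain ⟨t₀, ht₀⟩ : ∃ t₀ : ℤ, t₀ = d + n := ⟨_, rfl⟩
    have ht₁ : t = t₀ + 1 := by rw [ht', ht₀]; push_cast; ring
    obtain ⟨Sw, hSw, hφ'⟩ := hφ a₀ a d t₀ t hb (by rw [ht₀, ha₀]) ht₁ ht
    rw [hφ']
    have hm : wordVal (evenWord k (gen e) n) (onWords (c n a₀ ha₀)) ∈
        tensorGr k r (H.Q a₀).V n := wordVal_evenWord_mem n _
    have rel : thetaLin (gen e) (H.Q a₀) (wordVal (evenWord k (gen e) n) (onWords (c n a₀ ha₀))) =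
        (H.ι a₀ a hb).hom.toLinearMap.baseChange (Poly k r)
          ((H.π a).hom.toLinearMap.baseChange (Poly k r)
            (wordVal (evenWord k (gen e) (n + 1)) (onWords (c (n + 1) a ha)))) := by
      rw [← groupAlgebraAction_thetaElt]
      exact hc.action_wordVal _ _ (isNullWord_evenWord hX n) (length_evenWord ..) rfl ha₀ ha hb
    have hmι : (H.ι a₀ a hb).hom.toLinearMap.baseChange (Poly k r)
          ((H.π a).hom.toLinearMap.baseChange (Poly k r)
            (wordVal (evenWord k (gen e) (n + 1)) (onWords (c (n + 1) a ha)))) ∈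
        tensorGr k r (H.Q a₀).V (n + 1) := baseChange_mem _ _ _ hη
    -- One switch suffices: u = s c(W_n) and w = s π c(W_{n+1}), where W_{n+1} = (X, W_n).
    refine hSw U _ _ ((elemHom _ n hm d t₀ ht₀).app U s) _
      (ih a₀ t₀ ha₀ (by rw [ht₀, ha₀]) ht₀ (baseChange_mem _ _ _ hm)) ?_ ?_
    · exact app_congr (elemHom_comp_trivMap hm d t₀ ht₀ (H.π a₀).hom.toLinearMap _ rfl) U s
    · refine app_congr (f := elemHom _ _ hη d t ht' ≫ repMap r (H.ι a₀ a hb) t)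
        (f' := elemHom _ _ hm d t₀ ht₀ ≫ theta (gen e) (H.Q a₀) t₀ t ht₁) ?_ U s
      rw [repMap, elemHom_comp_trivMap hη d t ht' _ hmι rfl,
        elemHom_comp_thetaPow (gen e) (H.Q a₀) hm hmι _ _ _ _ _ _ ht']
      rw [pow_one, rel]

theorem even_comm_zero (hp : p = 2)
    {φ : ∀ a d t : ℤ, t = d + a → (lineBundle k r d ≅ F1 (gen e) (H.Ω a) t)}
    (hφ₀ : ∀ (d : ℤ) (h : d = d + 0) (U : (PSpace k r).Opens) (s : Γ(lineBundle k r d, U)),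
      IsClass (gen e) (H.Ω 0) d ((unitHom r (H.trivialIso.hom.hom (1 : k)) d).app U s)
        ((φ 0 d d h).hom.app U s))
    (hφ : ∀ (a b d t t₁ : ℤ) (hb : b = a + 1) (ht : t = d + a) (ht₁ : t₁ = t + 1)
      (ht₁' : t₁ = d + b),
      ∃ Sw : F1 (gen e) (H.Ω a) t ≅ F1 (gen e) (H.Ω b) t₁, IsEvenSwitch e H hb ht₁ Sw.hom ∧
        φ b d t₁ ht₁' = φ a d t ht ≪≫ Sw)
    {n : ℕ} {ζ : MvPolynomial (Fin r) k} (hζ : ζ.IsHomogeneous n) {a d t : ℤ}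
    (ha : a = n) (ht : t = d + a) {f : H.Ω a ⟶ H.Ω 0}
    (hf : RepresentsClass H n (component (evalCochain (yCochain k e) ζ) n) a ha f)
    (ht' : t = t + 0) (hd : t = d + n) :
    (φ a d t ht).hom ≫ F1map (gen e) f t =
      mulHom (rhoEven k r ζ) n (rhoEven_isHomogeneous hζ) d t hd ≫ (φ 0 t t ht').hom := by
  have hX := thetaElt_gen_sq (k := k) e hp
  obtain ⟨c, hc, hval⟩ := hf.exists_wordVal (evenWord k (gen e) n) (isClosedWord_evenWord hX n)
    (length_evenWord ..)
  rw [evenWord, pairing_evalCochain (pairsTo_y e) hζ] at hval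
  have hη : (H.π a).hom.toLinearMap.baseChange (Poly k r)
      (wordVal (evenWord k (gen e) n) (onWords (c n a ha))) ∈ tensorGr k r (H.Ω a).V n :=
    baseChange_mem _ _ _ (wordVal_evenWord_mem n _)
  have h1 := tmul_mem_tensorGr (SetLike.one_mem_graded (polyGr k r))
    (H.trivialIso.hom.hom (1 : k))
  have h2 : rhoEven k r ζ • ((1 : Poly k r) ⊗ₜ[k] H.trivialIso.hom.hom (1 : k)) ∈
      tensorGr k r (H.Ω 0).V n :=
    SetLike.GradedSMul.smul_mem (A := polyGr k r) (rhoEven_isHomogeneous hζ) h1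
  refine hom_ext _ _ fun U => ?_
  ext s
  refine ((isClass_evenWord hp hφ₀ hφ hc n a d t ha ht hd hη U s).map f).unique ?_
  refine Eq.mp (congrArg (fun x => IsClass (gen e) (H.Ω 0) t x _) ?_) (hφ₀ t ht' U
    ((mulHom (rhoEven k r ζ) n (rhoEven_isHomogeneous hζ) d t hd).app U s))
  refine app_congr (f := mulHom (rhoEven k r ζ) n (rhoEven_isHomogeneous hζ) d t hd ≫
      unitHom r (H.trivialIso.hom.hom (1 : k)) t)
    (f' := elemHom _ n hη d t hd ≫ repMap r f t) ?_ U s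
  rw [unitHom_eq_elemHom t _ (by simp) h1, mulHom_comp_elemHom h1 t t _ _ _ _ d hd h2 rfl hd,
    repMap, elemHom_comp_trivMap hη d t hd _ h2 hval]

omit [CharP k p] [Fintype E] in
theorem even_comm_succ_iff
    {φ : ∀ a d t : ℤ, t = d + a → (lineBundle k r d ≅ F1 (gen e) (H.Ω a) t)}
    (hφ : ∀ (a b d t t₁ : ℤ) (hb : b = a + 1) (ht : t = d + a) (ht₁ : t₁ = t + 1)
      (ht₁' : t₁ = d + b),
      ∃ Sw : F1 (gen e) (H.Ω a) t ≅ F1 (gen e) (H.Ω b) t₁, IsEvenSwitch e H hb ht₁ Sw.hom ∧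
        φ b d t₁ ht₁' = φ a d t ht ≪≫ Sw)
    {N : ℕ} {f : ∀ a b : ℤ, a = b + N → (H.Ω a ⟶ H.Ω b)}
    {q : ∀ a b : ℤ, a = b + N → (H.Q a ⟶ H.Q b)}
    (hfq : ∀ (a b : ℤ) (h : a = b + N), q a b h ≫ H.π b = H.π a ≫ f a b h)
    (hqf : ∀ (a b a' b' : ℤ) (h : a = b + N) (h' : a' = b' + N) (ha : a' = a + 1)
      (hb : b' = b + 1), H.ι a a' ha ≫ q a b h = f a' b' h' ≫ H.ι b b' hb)
    {a b a' b' d d' t t' : ℤ} (x : lineBundle k r d ⟶ lineBundle k r d') (ha : a' = a + 1)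
    (hb : b' = b + 1) (hab : a = b + N) (hab' : a' = b' + N) (ht : t = d + a) (ht' : t' = d + a')
    (hd : t = d' + b) (hd' : t' = d' + b') :
    (φ a d t ht).hom ≫ F1map (gen e) (f a b hab) t = x ≫ (φ b d' t hd).hom ↔
      (φ a' d t' ht').hom ≫ F1map (gen e) (f a' b' hab') t' = x ≫ (φ b' d' t' hd').hom := by
  have ht₁ : t' = t + 1 := by omega
  obtain ⟨Sw, hSw, h1⟩ := hφ a a' d t t' ha ht ht₁ ht'
  obtain ⟨Sw', hSw', h2⟩ := hφ b b' d' t t' hb hd ht₁ hd'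
  have hnat := hSw.naturality hSw' (f a b hab) (f a' b' hab') (q a b hab) (hfq ..) (hqf ..)
  rw [h1, h2, Iso.trans_hom, Iso.trans_hom, Category.assoc, ← hnat, ← Category.assoc,
    ← Category.assoc, cancel_mono]

theorem even_comm (hp : p = 2)
    {φ : ∀ a d t : ℤ, t = d + a → (lineBundle k r d ≅ F1 (gen e) (H.Ω a) t)}
    (hφ₀ : ∀ (d : ℤ) (h : d = d + 0) (U : (PSpace k r).Opens) (s : Γ(lineBundle k r d, U)),
      IsClass (gen e) (H.Ω 0) d ((unitHom r (H.trivialIso.hom.hom (1 : k)) d).app U s)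
        ((φ 0 d d h).hom.app U s))
    (hφ : ∀ (a b d t t₁ : ℤ) (hb : b = a + 1) (ht : t = d + a) (ht₁ : t₁ = t + 1)
      (ht₁' : t₁ = d + b),
      ∃ Sw : F1 (gen e) (H.Ω a) t ≅ F1 (gen e) (H.Ω b) t₁, IsEvenSwitch e H hb ht₁ Sw.hom ∧
        φ b d t₁ ht₁' = φ a d t ht ≪≫ Sw)
    {n : ℕ} {ζ : MvPolynomial (Fin r) k} (hζ : ζ.IsHomogeneous n)
    {f : ∀ a b : ℤ, a = b + n → (H.Ω a ⟶ H.Ω b)}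
    {q : ∀ a b : ℤ, a = b + n → (H.Q a ⟶ H.Q b)}
    (hfq : ∀ (a b : ℤ) (h : a = b + n), q a b h ≫ H.π b = H.π a ≫ f a b h)
    (hqf : ∀ (a b a' b' : ℤ) (h : a = b + n) (h' : a' = b' + n) (ha : a' = a + 1)
      (hb : b' = b + 1), H.ι a a' ha ≫ q a b h = f a' b' h' ≫ H.ι b b' hb)
    (hf : RepresentsClass H n (component (evalCochain (yCochain k e) ζ) n) n rfl
      (f n 0 (by simp)))
    (j : ℤ) : ∀ (a d d' t : ℤ) (hab : a = j + n) (ht : t = d + a) (ht' : t = d' + j)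
    (hd : d' = d + n),
    (φ a d t ht).hom ≫ F1map (gen e) (f a j hab) t =
      mulHom (rhoEven k r ζ) n (rhoEven_isHomogeneous hζ) d d' hd ≫ (φ j d' t ht').hom := by
  induction j using Int.induction_on with
  | zero =>
    intro a d d' t hab ht ht' hd
    obtain rfl : t = d' := by simpa using ht'
    obtain rfl : a = n := by simpa using hab
    exact even_comm_zero hp hφ₀ hφ hζ rfl ht hf ht' hd
  | succ j ih =>
    intro a d d' t hab ht ht' hd
    exact (even_comm_succ_iff hφ hfq hqf _ (a := a - 1) (t := t - 1) (by ring) rfl (by omega) hab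
      (by omega) ht (by omega) ht').1 (ih _ _ _ _ _ _ _ _)
  | pred j ih =>
    intro a d d' t hab ht ht' hd
    rw [← sub_add_cancel (-(j : ℤ)) 1] at ih
    exact (even_comm_succ_iff hφ hfq hqf _ (a' := a + 1) (t' := t + 1) rfl rfl hab (by omega) ht
      (by omega) ht' (by omega)).2 (ih _ _ _ _ _ _ _ _)

end Even

end ElemAb

/-! ### Cochains with coefficients and vanishing of cohomology -/

theorem innerFaces_congr {E V : Type*} [Group E] [AddCommGroup V] (w : List E) (h : E)
    {F G : List E → V} (hFG : ∀ w', w'.length = w.length → F w' = G w') :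
    innerFaces w h F = innerFaces w h G := by
  induction w generalizing h F G with
  | nil => exact hFG [] rfl
  | cons h' w ih =>
    rw [innerFaces, innerFaces, hFG ((h * h') :: w) rfl, ih h' fun w' hw' => hFG _ (by simp [hw'])]

theorem map_innerFaces {E V V' : Type*} [Group E] [AddCommGroup V] [AddCommGroup V']
    (T : V →+ V') (w : List E) (h : E) (F : List E → V) :
    T (innerFaces w h F) = innerFaces w h fun w' => T (F w') := by
  induction w generalizing h F with
  | nil => rfl
  | cons h' w ih => rw [innerFaces, innerFaces, map_sub, ih]

namespace Rep

variable {k E : Type u} [Field k] [Group E]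

/-- An equivariant linear map, as a morphism of representations. -/
def homMk {A B : Rep.{u} k E} (L : A.V →ₗ[k] B.V) (h : ∀ g m, L (A.ρ g m) = B.ρ g (L m)) : A ⟶ B :=
  Rep.ofHom { L with isIntertwining' := fun g => LinearMap.ext fun m => h g m }

theorem homMk_apply {A B : Rep.{u} k E} (L : A.V →ₗ[k] B.V)
    (h : ∀ g m, L (A.ρ g m) = B.ρ g (L m)) (m : A.V) : (homMk L h).hom m = L m := rfl

theorem exists_comp_eq {A B C : Rep.{u} k E} (i : B ⟶ C) (hi : Function.Injective i.hom)
    (x : A ⟶ C) (hx : ∀ m, x.hom m ∈ Set.range i.hom) : ∃ f : A ⟶ B, f ≫ i = x := by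
  choose L hL using hx
  refine ⟨homMk ⟨⟨L, fun m n => hi ?_⟩, fun c m => hi ?_⟩ fun g m => hi ?_, ?_⟩
  · rw [map_add, hL, hL, hL, map_add]
  · change i.hom.toLinearMap (L (c • m)) = i.hom.toLinearMap (c • L m)
    rw [LinearMap.map_smul]
    refine (hL _).trans ((x.hom.toLinearMap.map_smul c m).trans (congrArg _ (hL m).symm))
  · refine (hL _).trans ?_
    rw [Rep.hom_comm_apply, Rep.hom_comm_apply]
    exact congrArg _ (hL m).symm
  · ext m
    exact hL m

/-- The coboundary of an inhomogeneous cochain. -/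
def cobd (A : Rep.{u} k E) (m : ℕ) : ((Fin m → E) → A.V) →ₗ[k] ((Fin (m + 1) → E) → A.V) :=
  (inhomogeneousCochains.d A m).hom

theorem cobd_cobd (A : Rep.{u} k E) {m : ℕ} (F : (Fin m → E) → A.V) :
    cobd A (m + 1) (cobd A m F) = 0 :=
  congr(($(groupCohomology.inhomogeneousCochains.d_comp_d (n := m) (A := A))).hom F)

theorem cobd_apply (A : Rep.{u} k E) {m : ℕ} (F : (Fin m → E) → A.V) (x : Fin (m + 1) → E) :
    cobd A m F x = A.ρ (x 0) (F fun i => x i.succ) -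
      innerFaces (List.ofFn fun i => x i.succ) (x 0) (onWords F) :=
  d_apply_ofFn A F x

theorem map_cobd {A B : Rep.{u} k E} (f : A ⟶ B) {m : ℕ} (F : (Fin m → E) → A.V)
    (x : Fin (m + 1) → E) : f.hom (cobd A m F x) = cobd B m (fun y => f.hom (F y)) x := by
  rw [cobd_apply, cobd_apply, map_sub, Rep.hom_comm_apply]
  congr 1
  exact map_innerFaces f.hom.toLinearMap.toAddMonoidHom _ _ _

/-- With T of trace one, y(w) = ∑ g T z(g⁻¹, w) is a primitive. In its coboundary the cocycle
identity for (g⁻¹, h, w) leaves ∑ g T g⁻¹ z(h, w) = z(h, w), the other two sums cancelling after a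
translation of g. -/
theorem exists_cobd_eq [Fintype E] (Q : Rep.{u} k E) [Projective Q] {n : ℕ}
    (z : (Fin (n + 1) → E) → Q.V) (hz : cobd Q (n + 1) z = 0) : ∃ y, cobd Q n y = z := by
  obtain ⟨T, hT⟩ := exists_trace_eq_one Q
  let y : List E → Q.V := fun w => ∑ g, Q.ρ g (T (onWords z (g⁻¹ :: w)))
  have hz' : ∀ g h w, w.length = n → innerFaces w h (fun w' => onWords z (g :: w')) =
      onWords z ((g * h) :: w) - Q.ρ g (onWords z (h :: w)) := fun g h w hw => by
    have h1 := onWords_d Q z g (h :: w) (by simp [hw])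
    have h2 : (inhomogeneousCochains.d Q (n + 1)).hom z = 0 := hz
    rw [h2, innerFaces] at h1
    have h3 : onWords (0 : (Fin (n + 1 + 1) → E) → Q.V) (g :: h :: w) = 0 := rfl
    rw [h3] at h1
    rw [eq_sub_iff_add_eq, ← sub_eq_zero]
    refine Eq.trans ?_ h1.symm
    abel
  refine ⟨fun x => y (List.ofFn x), funext fun x => ?_⟩
  have h4 : innerFaces (List.ofFn fun i => x i.succ) (x 0)
      (onWords fun x : Fin n → E => y (List.ofFn x)) =
      innerFaces (List.ofFn fun i => x i.succ) (x 0) y := innerFaces_congr _ _ fun w' hw' => by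
    obtain ⟨v, rfl⟩ := exists_eq_ofFn (m := n) w' (by simpa using hw')
    rw [onWords_ofFn]
  rw [cobd_apply, h4]
  generalize hw : (List.ofFn fun i => x i.succ) = w
  have hwl : w.length = n := by rw [← hw, List.length_ofFn]
  have hx : z x = onWords z (x 0 :: w) := by
    rw [← hw, ← List.ofFn_succ, onWords_ofFn]
  have h5 : innerFaces w (x 0) y = ∑ g, Q.ρ g (T (onWords z ((g⁻¹ * x 0) :: w))) -
      ∑ g, Q.ρ g (T (Q.ρ g⁻¹ (onWords z (x 0 :: w)))) := by
    rw [← Finset.sum_sub_distrib, ElemAb.innerFaces_sum]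
    refine Finset.sum_congr rfl fun g _ => ?_
    rw [← map_sub, ← map_sub, ← hz' _ _ _ hwl]
    exact (map_innerFaces ((Q.ρ g).toAddMonoidHom.comp T.toAddMonoidHom) w (x 0)
      fun w' => onWords z (g⁻¹ :: w')).symm
  rw [h5, hT, hx, map_sum]
  refine Eq.trans ?_ (zero_add _)
  rw [← sub_add]
  congr 1
  rw [sub_eq_zero]
  refine Fintype.sum_equiv (Equiv.mulLeft (x 0)) _ _ fun g => ?_
  rw [Equiv.coe_mulLeft, map_mul, mul_inv_rev, mul_assoc, inv_mul_cancel, mul_one]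
  rfl

/-- A cochain is a coboundary. -/
def IsCoboundary (A : Rep.{u} k E) : ∀ {N : ℕ}, ((Fin N → E) → A.V) → Prop
  | 0, x => x = 0
  | n + 1, x => ∃ w, cobd A n w = x

theorem IsCoboundary.map {A B : Rep.{u} k E} (f : A ⟶ B) {N : ℕ} {x : (Fin N → E) → A.V}
    (hx : IsCoboundary A x) : IsCoboundary B fun h => f.hom (x h) := by
  cases N with
  | zero =>
    obtain rfl : x = 0 := hx
    exact funext fun _ => map_zero _
  | succ n =>
    obtain ⟨w, rfl⟩ := hx
    exact ⟨_, funext fun h => (map_cobd f w h).symm⟩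

/-- A primitive can be lifted and its coboundary taken; a general cocycle need not lift to a
cocycle. -/
theorem IsCoboundary.exists_lift {A B : Rep.{u} k E} (f : A ⟶ B) (hf : Function.Surjective f.hom)
    {N : ℕ} {x : (Fin N → E) → B.V} (hx : IsCoboundary B x) :
    ∃ y, cobd A N y = 0 ∧ ∀ h, f.hom (y h) = x h := by
  cases N with
  | zero =>
    obtain rfl : x = 0 := hx
    exact ⟨0, map_zero _, fun _ => map_zero _⟩
  | succ n =>
    obtain ⟨w, rfl⟩ := hx
    choose v hv using fun h => hf (w h)
    refine ⟨cobd A n v, cobd_cobd A v, fun h => ?_⟩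
    rw [map_cobd]
    simp only [hv]

end Rep

namespace ElemAb

open Rep

/-! ### Existence of representing homomorphisms -/

section Existence

variable {k : Type u} [Field k] {E : Type u} [CommGroup E] [Fintype E] (H : HellerShifts k E)

omit [Fintype E] in
-- Values on the basis of the bar resolution are chosen degree by degree. The recursion carries d (π
-- c_m) = 0, which places d c_m in the kernel of π and hence in the image of ι.
theorem exists_isComparison : ∃ c, IsComparison H c := by
  let P : ℕ → Type u := fun m =>
    {c : (Fin m → E) → (H.Q m).V // cobd (H.Ω m) m (fun h => (H.π m).hom (c h)) = 0}
  obtain ⟨x₀, hx₀⟩ := H.π_surjective 0 (H.trivialIso.hom.hom (1 : k))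
  let c₀ : P 0 := ⟨fun _ => x₀, funext fun h => by
    rw [cobd_apply]
    change (H.Ω 0).ρ (h 0) ((H.π 0).hom x₀) - (H.π 0).hom x₀ = 0
    rw [hx₀, ← Rep.hom_comm_apply, sub_eq_zero]
    rfl⟩
  have step : ∀ m (c : P m), ∃ c' : P (m + 1), ∀ (hab : ((m + 1 : ℕ) : ℤ) = m + 1) h,
      (H.ι m (m + 1 : ℕ) hab).hom ((H.π (m + 1 : ℕ)).hom (c'.1 h)) = cobd (H.Q m) m c.1 h := by
    intro m c
    have hab : ((m + 1 : ℕ) : ℤ) = m + 1 := by push_cast; rfl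
    have h1 : ∀ h, ∃ y, (H.ι m (m + 1 : ℕ) hab).hom ((H.π (m + 1 : ℕ)).hom y) =
        cobd (H.Q m) m c.1 h := fun h => by
      obtain ⟨y, hy⟩ := (H.exact m _ hab (cobd (H.Q m) m c.1 h)).1 (by
        rw [map_cobd, c.2]
        rfl)
      obtain ⟨y', rfl⟩ := H.π_surjective _ y
      exact ⟨y', hy⟩
    choose y hy using h1
    refine ⟨⟨y, funext fun h => H.ι_injective m _ hab ?_⟩, fun _ => hy⟩
    rw [map_cobd]
    simp only [hy]
    rw [cobd_cobd]
    exact (map_zero _).symm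
  choose S hS using step
  let s : ∀ m, P m := fun m => Nat.rec c₀ S m
  refine ⟨fun m a ha => by rw [ha]; exact (s m).1, fun h => hx₀, ?_⟩
  intro m a b ha hb hab h
  subst ha hb
  exact hS m (s m) hab h

variable {H}

omit [CommGroup E] [Fintype E] in
theorem exists_lift_up [Group E] {H : HellerShifts k E} {a b : ℤ} (f : H.Ω a ⟶ H.Ω b) {a' b' : ℤ}
    (ha : a' = a + 1) (hb : b' = b + 1) :
    ∃ (q : H.Q a ⟶ H.Q b) (f' : H.Ω a' ⟶ H.Ω b'), q ≫ H.π b = H.π a ≫ f ∧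
      H.ι a a' ha ≫ q = f' ≫ H.ι b b' hb := by
  have := H.projective a
  have : Epi (H.π b) := (Rep.epi_iff_surjective _).2 (H.π_surjective b)
  have hq := Projective.factorThru_comp (H.π a ≫ f) (H.π b)
  obtain ⟨f', hf'⟩ := Rep.exists_comp_eq (H.ι b b' hb) (H.ι_injective b b' hb)
    (H.ι a a' ha ≫ Projective.factorThru (H.π a ≫ f) (H.π b)) fun m => by
      refine (H.exact b b' hb _).1 ?_
      refine congr(($hq).hom ((H.ι a a' ha).hom m)).trans ?_
      change f.hom ((H.π a).hom ((H.ι a a' ha).hom m)) = 0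
      rw [(H.exact a a' ha).apply_apply_eq_zero, map_zero]
  exact ⟨_, f', hq, hf'.symm⟩

/-- The projective Q_b is injective relative to k-split inclusions. The k-linear extension L of ι f'
is averaged with Higman's T to an equivariant q, which still extends ι f' because T has trace one; f
is induced by q on quotients. -/
theorem exists_lift_down {a b a' b' : ℤ} (f' : H.Ω a' ⟶ H.Ω b') (ha : a' = a + 1)
    (hb : b' = b + 1) :
    ∃ (q : H.Q a ⟶ H.Q b) (f : H.Ω a ⟶ H.Ω b), q ≫ H.π b = H.π a ≫ f ∧
      H.ι a a' ha ≫ q = f' ≫ H.ι b b' hb := by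
  have := H.projective b
  obtain ⟨T, hT⟩ := exists_trace_eq_one (H.Q b)
  let S := splitting H a a' ha
  let L : (H.Q a).V →ₗ[k] (H.Q b).V :=
    (H.ι b b' hb).hom.toLinearMap ∘ₗ f'.hom.toLinearMap ∘ₗ S.ρ
  let q : H.Q a ⟶ H.Q b :=
    Rep.homMk (∑ g, (H.Q b).ρ g ∘ₗ T ∘ₗ L ∘ₗ (H.Q a).ρ g⁻¹) fun g m => by
      simp only [LinearMap.sum_apply, LinearMap.comp_apply, map_sum]
      refine (Fintype.sum_equiv (Equiv.mulLeft g) _ _ fun x => ?_).symm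
      rw [Equiv.coe_mulLeft, mul_inv_rev, map_mul, map_mul, ← Module.End.mul_apply ((H.Q a).ρ _ * _),
        mul_assoc, ← map_mul (H.Q a).ρ g⁻¹ g, inv_mul_cancel, map_one, mul_one]
      rfl
  have hL : ∀ x, L ((H.ι a a' ha).hom x) = (H.ι b b' hb).hom (f'.hom x) := fun x =>
    congrArg (fun y => (H.ι b b' hb).hom (f'.hom y)) (LinearMap.congr_fun S.ρ_ι x)
  have hq : ∀ x, q.hom ((H.ι a a' ha).hom x) = (H.ι b b' hb).hom (f'.hom x) := fun x => by
    rw [Rep.homMk_apply, ← hT ((H.ι b b' hb).hom (f'.hom x)), LinearMap.sum_apply]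
    refine Finset.sum_congr rfl fun g _ => ?_
    simp only [LinearMap.comp_apply]
    rw [← Rep.hom_comm_apply, hL, Rep.hom_comm_apply, Rep.hom_comm_apply]
  let L' : (H.Ω a).V →ₗ[k] (H.Ω b).V :=
    (H.π b).hom.toLinearMap ∘ₗ q.hom.toLinearMap ∘ₗ S.σ
  have hL' : ∀ m, L' ((H.π a).hom m) = (H.π b).hom (q.hom m) := fun m => by
    have h1 : (H.ι a a' ha).hom (S.ρ m) + S.σ ((H.π a).hom m) = m := LinearMap.congr_fun S.decomp m
    conv_rhs => rw [← h1, map_add, map_add, hq, (H.exact b b' hb).apply_apply_eq_zero, zero_add]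
    rfl
  refine ⟨q, Rep.homMk L' fun g m => ?_, ?_, ?_⟩
  · obtain ⟨m, rfl⟩ := H.π_surjective a m
    rw [← Rep.hom_comm_apply, hL', hL', Rep.hom_comm_apply, Rep.hom_comm_apply]
  · ext m
    exact (hL' m).symm
  · ext m
    exact hq m

/-- A homomorphism `Ω^N k ⟶ k` is a member of a family of Heller shifts. -/
theorem exists_heller_family (N : ℕ) {a : ℤ} (ha : a = 0 + N) (f₀ : H.Ω a ⟶ H.Ω 0) :
    ∃ (f : ∀ a b : ℤ, a = b + N → (H.Ω a ⟶ H.Ω b)) (q : ∀ a b : ℤ, a = b + N → (H.Q a ⟶ H.Q b)),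
      (∀ (a b : ℤ) (h : a = b + N), q a b h ≫ H.π b = H.π a ≫ f a b h) ∧
      (∀ (a b a' b' : ℤ) (h : a = b + N) (h' : a' = b' + N) (ha : a' = a + 1) (hb : b' = b + 1),
        H.ι a a' ha ≫ q a b h = f a' b' h' ≫ H.ι b b' hb) ∧ f a 0 ha = f₀ := by
  subst ha
  have h1 : ∀ b : ℤ, b + 1 + N = b + N + 1 := fun b => by ring
  obtain ⟨x, hx₀, hx⟩ := Int.exists_chain (X := fun b => H.Ω (b + N) ⟶ H.Ω b)
    (fun b f f' => ∃ q : H.Q (b + N) ⟶ H.Q b, q ≫ H.π b = H.π (b + N) ≫ f ∧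
      H.ι (b + N) (b + 1 + N) (h1 b) ≫ q = f' ≫ H.ι b (b + 1) rfl) f₀
    (fun b f => by
      obtain ⟨q, f', h⟩ := exists_lift_up f (h1 b) (rfl : b + 1 = b + 1)
      exact ⟨f', q, h⟩)
    (fun b f' => by
      obtain ⟨q, f, h⟩ := exists_lift_down f' (h1 b) (rfl : b + 1 = b + 1)
      exact ⟨f, q, h⟩)
  choose q hq using hx
  refine ⟨fun a b h => eqToHom (by rw [h]) ≫ x b, fun a b h => eqToHom (by rw [h]) ≫ q b, ?_, ?_, ?_⟩
  · intro a b h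
    subst h
    simpa using (hq b).1
  · intro a b a' b' h h' ha hb
    subst h h' hb
    simpa using (hq b).2
  · simpa using hx₀

/-- Dimension shifting, with b arbitrary because the induction lowers b together with N. In Q the
cocycle ι z is a coboundary d y, then π y is a cocycle one degree lower, and the homomorphism found
for π y is shifted up. -/
theorem IsComparison.exists_hom {c : ∀ (m : ℕ) (a : ℤ), a = m → (Fin m → E) → (H.Q a).V}
    (hc : IsComparison H c) (N : ℕ) : ∀ (a b : ℤ) (ha : a = N) (z : (Fin N → E) → (H.Ω b).V),
    cobd (H.Ω b) N z = 0 →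
    ∃ f : H.Ω a ⟶ H.Ω b,
      IsCoboundary (H.Ω b) fun h => f.hom ((H.π a).hom (c N a ha h)) - z h := by
  induction N with
  | zero =>
    intro a b ha z hz
    obtain rfl : a = 0 := by simpa using ha
    have hinv : ∀ g, (H.Ω b).ρ g (z default) = z default := fun g => by
      have h1 := congrFun hz fun _ => g
      rw [cobd_apply] at h1
      rw [← sub_eq_zero]
      refine Eq.trans ?_ h1
      exact congrArg₂ (· - ·) (congrArg _ (congrArg z (Subsingleton.elim _ _)))
        (congrArg z (Subsingleton.elim _ _))
    let i : Rep.trivial k E k ⟶ H.Ω b :=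
      Rep.homMk (LinearMap.toSpanSingleton k (H.Ω b).V (z default)) fun g m =>
        ((((H.Ω b).ρ g).map_smul m _).trans (congrArg _ (hinv g))).symm
    refine ⟨H.trivialIso.inv ≫ i, funext fun h => ?_⟩
    obtain rfl : h = default := Subsingleton.elim _ _
    rw [hc.augmentation]
    have h2 : H.trivialIso.inv.hom (H.trivialIso.hom.hom (1 : k)) = (1 : k) := by simp
    change i.hom (H.trivialIso.inv.hom (H.trivialIso.hom.hom (1 : k))) - z default = 0
    rw [h2, sub_eq_zero]
    exact one_smul k _
  | succ N ih =>
    intro a b ha z hz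
    have ha' : a = (N : ℤ) + 1 := by rw [ha]; push_cast; rfl
    obtain ⟨b, rfl⟩ : ∃ b', b = b' + 1 := ⟨b - 1, by ring⟩
    have := H.projective b
    let ιb := H.ι b (b + 1) rfl
    obtain ⟨y, hy⟩ := exists_cobd_eq (H.Q b) (fun h => ιb.hom (z h)) (funext fun h => by
      rw [← map_cobd, hz]
      exact map_zero _)
    obtain ⟨f, hf⟩ := ih N b rfl (fun h => (H.π b).hom (y h)) (funext fun h => by
      rw [← map_cobd, hy]
      exact (H.exact b (b + 1) rfl).apply_apply_eq_zero _)
    obtain ⟨q, f', hq, hf'⟩ := exists_lift_up f ha' (rfl : b + 1 = b + 1)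
    obtain ⟨x, hx, hx'⟩ := hf.exists_lift (H.π b) (H.π_surjective b)
    -- The correction x is a cocycle with π x = f π c_N - π y. So q c_N - y - x comes from the image
    -- of ι, and its coboundary is ι applied to f' π c_{N+1} - z.
    have h1 : ∀ h, ∃ w, ιb.hom w = q.hom (c N N rfl h) - y h - x h := fun h => by
      refine (H.exact b (b + 1) rfl _).1 ?_
      rw [map_sub, map_sub, hx', sub_eq_zero, sub_left_inj]
      exact congr(($hq).hom (c N N rfl h))
    choose w hw using h1
    refine ⟨f', w, funext fun h => H.ι_injective b (b + 1) rfl ?_⟩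
    change ιb.hom _ = ιb.hom _
    rw [map_cobd]
    simp only [hw]
    have h2 : cobd (H.Q b) N (fun h => q.hom (c N N rfl h) - y h - x h) =
        cobd (H.Q b) N (fun h => q.hom (c N N rfl h)) - cobd (H.Q b) N y - cobd (H.Q b) N x := by
      rw [← map_sub, ← map_sub]
      rfl
    rw [h2, hx, hy, sub_zero, map_sub, Pi.sub_apply, ← map_cobd]
    congr 1
    refine (congrArg (q.hom) (hc.differential N N a rfl ha ha' h)).symm.trans ?_
    exact congr(($hf').hom ((H.π a).hom (c (N + 1) a ha h)))

theorem exists_represents {N : ℕ} {v : CochainAlg k E} (hv : IsWordCocycle (wordCoeff v)) (a b : ℤ)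
    (hab : a = b + N) : ∃ f, Represents H N (component v N) a b hab f := by
  obtain ⟨c, hc⟩ := exists_isComparison H
  obtain ⟨a₀, ha₀⟩ : ∃ a₀ : ℤ, a₀ = N := ⟨_, rfl⟩
  have hz : cobd (Rep.trivial k E k) N (component v N) = 0 := funext fun x => by
    rw [cobd_apply, innerFaces_congr _ _ fun w' hw' =>
      onWords_component v w' (hw'.trans List.length_ofFn), ← hv]
    exact sub_self _
  obtain ⟨f₀, hf₀⟩ := hc.exists_hom N a₀ 0 ha₀
    (fun h => H.trivialIso.hom.hom (component v N h)) (funext fun h => by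
      rw [← map_cobd, hz]
      exact map_zero _)
  obtain ⟨f, q, h1, h2, h3⟩ := exists_heller_family N (by simpa using ha₀) f₀
  refine ⟨_, f, q, h1, h2, rfl, c, hc, ?_⟩
  subst ha₀
  rw [h3]
  have h4 : IsCoboundary (Rep.trivial k E k) fun h => (H.trivialIso.inv.hom
      (f₀.hom ((H.π N).hom (c N N rfl h))) : k) - component v N h := by
    convert hf₀.map H.trivialIso.inv using 2 with h
    rw [map_sub]
    congr 1
    have : H.trivialIso.inv.hom (H.trivialIso.hom.hom (component v N h)) = component v N h := by
      simp
    exact this.symm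
  cases N with
  | zero =>
    refine ⟨0, ?_⟩
    rw [map_zero]
    exact h4.symm
  | succ N =>
    obtain ⟨w, hw⟩ := h4
    generalize hj : (ComplexShape.up ℕ).prev (N + 1) = j
    obtain rfl : N = j := by rw [← hj, CochainComplex.prev_nat_succ]
    rw [groupCohomology.inhomogeneousCochains.d_def]
    exact ⟨w, hw⟩

end Existence

end ElemAb

end

theorem mainTheorem7 {k : Type u} [Field k] (p : ℕ) [Fact p.Prime] [CharP k p] (r : ℕ)
    {E : Type u} [CommGroup E] [Fintype E] (e : E ≃* Multiplicative (Fin r → ZMod p))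
    (H : ElemAb.HellerShifts k E) :
    (p ≠ 2 →
      ∃ φ : ∀ l a d t : ℤ, a = 2 * l → t = d + p * l →
          (ElemAb.lineBundle k r d ≅ ElemAb.F1 (ElemAb.gen e) (H.Ω a) t),
        ElemAb.IsOddIdentification (ElemAb.gen e) H p φ ∧
        ∀ (n : ℕ) (j : ℤ) (ζ : MvPolynomial (Fin r) k) (hζ : ζ.IsHomogeneous n),
          (∃ f : H.Ω (2 * (n + j)) ⟶ H.Ω (2 * j),
            ElemAb.Represents H (2 * n)
              (ElemAb.component (ElemAb.evalCochain (ElemAb.xCochain k e) ζ) (2 * n))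
              (2 * (n + j)) (2 * j) (by push_cast; ring) f) ∧
          ∀ f : H.Ω (2 * (n + j)) ⟶ H.Ω (2 * j),
            ElemAb.Represents H (2 * n)
              (ElemAb.component (ElemAb.evalCochain (ElemAb.xCochain k e) ζ) (2 * n))
              (2 * (n + j)) (2 * j) (by push_cast; ring) f →
            (φ (n + j) (2 * (n + j)) (-(p * (n + j))) 0 rfl (by ring)).hom ≫
                ElemAb.F1map (ElemAb.gen e) f 0 =
              ElemAb.mulHom (ElemAb.rhoOdd k r p ζ) (p * n) (ElemAb.rhoOdd_isHomogeneous p hζ)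
                  (-(p * (n + j))) (-(p * j)) (by push_cast; ring) ≫
                (φ j (2 * j) (-(p * j)) 0 rfl (by ring)).hom) ∧
    (p = 2 →
      ∃ φ : ∀ a d t : ℤ, t = d + a →
          (ElemAb.lineBundle k r d ≅ ElemAb.F1 (ElemAb.gen e) (H.Ω a) t),
        ElemAb.IsEvenIdentification (ElemAb.gen e) H φ ∧
        ∀ (n : ℕ) (j : ℤ) (ζ : MvPolynomial (Fin r) k) (hζ : ζ.IsHomogeneous n),
          (∃ f : H.Ω (n + j) ⟶ H.Ω j,
            ElemAb.Represents H n
              (ElemAb.component (ElemAb.evalCochain (ElemAb.yCochain k e) ζ) n)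
              (n + j) j (by ring) f) ∧
          ∀ f : H.Ω (n + j) ⟶ H.Ω j,
            ElemAb.Represents H n
              (ElemAb.component (ElemAb.evalCochain (ElemAb.yCochain k e) ζ) n)
              (n + j) j (by ring) f →
            (φ (n + j) (-(n + j)) 0 (by ring)).hom ≫ ElemAb.F1map (ElemAb.gen e) f 0 =
              ElemAb.mulHom (ElemAb.rhoEven k r ζ) n (ElemAb.rhoEven_isHomogeneous hζ)
                  (-(n + j)) (-j) (by ring) ≫
                (φ j (-j) 0 (by ring)).hom) := by
  refine ⟨fun _ => ?_, fun hp => ?_⟩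
  · obtain ⟨φ, hφ₀, hφ⟩ := ElemAb.exists_odd_family e H
    refine ⟨φ, ⟨hφ₀, ?_⟩, fun n j ζ hζ => ⟨ElemAb.exists_represents
      (ElemAb.isWordCocycle_evalCochain (ElemAb.pairsTo_x e) ζ) _ _ _, ?_⟩⟩
    · intro l a b c d t t₁ t₂ ha hb hc hc' ht ht₁ ht₂ ht₂' U s μ u v w hμ hu hv hw hw'
      obtain ⟨Sw, hSw, h⟩ := hφ l a b c d t t₁ t₂ ha hb hc hc' ht ht₁ ht₂ ht₂'
      rw [h]
      exact hSw U μ _ u v w hμ hu hv hw hw'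
    -- The given homomorphism comes with a whole family of Heller shifts whose member over 0
    -- represents ζ; the induction on j runs along this family, and the claim is the case of twist
    -- 0.
    · rintro _ ⟨f, q, hfq, hqf, rfl, hf⟩
      exact ElemAb.odd_comm hφ₀ hφ hζ hfq hqf hf j _ _ _ _ _ _ rfl _ _ _ _ _ _
  · obtain ⟨φ, hφ₀, hφ⟩ := ElemAb.exists_even_family e H hp
    refine ⟨φ, ⟨hφ₀, ?_⟩, fun n j ζ hζ => ⟨ElemAb.exists_represents
      (ElemAb.isWordCocycle_evalCochain (ElemAb.pairsTo_y e) ζ) _ _ _, ?_⟩⟩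
    · intro a b d t t₁ hb ht ht₁ ht₁' U s μ u w hμ hu hw
      obtain ⟨Sw, hSw, h⟩ := hφ a b d t t₁ hb ht ht₁ ht₁'
      rw [h]
      exact hSw U μ _ u w hμ hu hw
    · rintro _ ⟨f, q, hfq, hqf, rfl, hf⟩
      exact ElemAb.even_comm hp hφ₀ hφ hζ hfq hqf hf j _ _ _ _ _ _ _ _
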